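/- An \emph{embedded planar st-graph} is a finite acyclic directed graph $G=(V,E)$ without parallel edges, with exactly one source $s$ and exactly one sink $t\neq s$, together with a fixed planar embedding in which $s$ and $t$ lie on the outer face; the edge $(s,t)$ need not be present. For $u\in V$ let $S(u)=(v_1,\dots,v_m)$ be the successors of $u$ in the order in which the outgoing edges $(u,v_1),\dots,(u,v_m)$ appear clockwise around $u$, starting, for $u\ne s$, directly after an incoming edge and, for $u=s$, directly after the outer face (the outgoing edges of $u \neq s$ are consecutive around $u$). An \emph{st-ordering} of $G$ is a bijection $\pi:V\to\{1,\dots,|V|\}$ with $\pi(s)=1$, $\pi(t)=|V|$ and $\pi(u)<\pi(v)$ for every edge $(u,v)$. It is \emph{bitonic} if for every $u\in V$ with $S(u)=(v_1,\dots,v_m)$, $m\ge1$, there is $1\le h\le m$ with $\pi(v_1)<\dots<\pi(v_h)>\dots>\pi(v_m)$. \textbf{Theorem.} There is an algorithm that, given an embedded planar st-graph $G=(V,E)$ (as lists of the vertices of all edge ends and of the clockwise next edge end for every edge end, together with the edge leaving $s$ that has the outer face on its left), decides in time $O(|V|+|E|)$ whether $G$ admits a bitonic st-ordering and, if it does, outputs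 such an ordering within the same time bound. The machine model is the unit-cost random access machine with words of $O(\log(|V|+|E|))$ bits and with addition, truncated subtraction, comparison and indirect addressing. -/

import Mathlib

/-! ### Word random access machines -/

namespace RAM

/-- A memory state: registers `reg 0, reg 1, …` and arrays `mem 0, mem 1, …` of natural numbers.
A program mentions only finitely many registers and arrays. -/
structure State where
  reg : ℕ → ℕ
  mem : ℕ → ℕ → ℕ

/-- Arithmetic expressions: constants, registers, addition, truncated subtraction and
reading the entry of array `a` at the position given by an expression. -/
inductive Expr where
  | const (k : ℕ)
  | reg (r : ℕ)
  | add (e f : Expr)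
  | sub (e f : Expr)
  | load (a : ℕ) (e : Expr)

/-- A machine word holds the numbers less than `W`; any other number is an overflow, on which the
machine gets stuck. -/
def word (W k : ℕ) : Option ℕ := if k < W then some k else none

/-- Evaluation; every intermediate value, in particular every address, has to fit in a word. -/
def Expr.eval (W : ℕ) (σ : State) : Expr → Option ℕ
  | .const k => word W k
  | .reg r => word W (σ.reg r)
  | .add e f => (e.eval W σ).bind fun x => (f.eval W σ).bind fun y => word W (x + y)
  | .sub e f => (e.eval W σ).bind fun x => (f.eval W σ).bind fun y => word W (x - y)
  | .load a e => (e.eval W σ).bind fun x => word W (σ.mem a x)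

/-- The number of elementary operations in the evaluation of an expression. -/
def Expr.cost : Expr → ℕ
  | .const _ => 1
  | .reg _ => 1
  | .add e f => e.cost + f.cost + 1
  | .sub e f => e.cost + f.cost + 1
  | .load _ e => e.cost + 1

/-- Comparisons of two values. -/
inductive Test where
  | lt (e f : Expr)
  | eq (e f : Expr)

def Test.eval (W : ℕ) (σ : State) : Test → Option Bool
  | .lt e f => (e.eval W σ).bind fun x => (f.eval W σ).bind fun y => some (decide (x < y))
  | .eq e f => (e.eval W σ).bind fun x => (f.eval W σ).bind fun y => some (decide (x = y))

def Test.cost : Test → ℕ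
  | .lt e f => e.cost + f.cost + 1
  | .eq e f => e.cost + f.cost + 1

/-- Programs. -/
inductive Prog where
  | skip
  | assign (r : ℕ) (e : Expr)
  | store (a : ℕ) (i e : Expr)
  | seq (p q : Prog)
  | ite (b : Test) (p q : Prog)
  | loop (b : Test) (p : Prog)

def State.setReg (σ : State) (r x : ℕ) : State :=
  { σ with reg := Function.update σ.reg r x }

def State.setMem (σ : State) (a i x : ℕ) : State :=
  { σ with mem := Function.update σ.mem a (Function.update (σ.mem a) i x) }

/-- `Exec W p σ τ T`: on words holding the numbers less than `W`, the program `p` started in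
the state `σ` halts without overflow in the state `τ` after exactly `T` elementary steps. -/
inductive Exec (W : ℕ) : Prog → State → State → ℕ → Prop where
  | skip (σ : State) : Exec W .skip σ σ 1
  | assign {σ : State} {r : ℕ} {e : Expr} {x : ℕ} (hx : e.eval W σ = some x) :
      Exec W (.assign r e) σ (σ.setReg r x) (e.cost + 1)
  | store {σ : State} {a : ℕ} {i e : Expr} {j x : ℕ}
      (hj : i.eval W σ = some j) (hx : e.eval W σ = some x) :
      Exec W (.store a i e) σ (σ.setMem a j x) (i.cost + e.cost + 1)
  | seq {p q : Prog} {σ τ υ : State} {T U : ℕ} (hp : Exec W p σ τ T) (hq : Exec W q τ υ U) :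
      Exec W (.seq p q) σ υ (T + U)
  | ite_true {b : Test} {p q : Prog} {σ τ : State} {T : ℕ}
      (hb : b.eval W σ = some true) (hp : Exec W p σ τ T) :
      Exec W (.ite b p q) σ τ (b.cost + T)
  | ite_false {b : Test} {p q : Prog} {σ τ : State} {T : ℕ}
      (hb : b.eval W σ = some false) (hq : Exec W q σ τ T) :
      Exec W (.ite b p q) σ τ (b.cost + T)
  | loop_true {b : Test} {p : Prog} {σ τ υ : State} {T U : ℕ}
      (hb : b.eval W σ = some true) (hp : Exec W p σ τ T) (hl : Exec W (.loop b p) τ υ U) :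
      Exec W (.loop b p) σ υ (b.cost + T + U)
  | loop_false {b : Test} {p : Prog} {σ : State} (hb : b.eval W σ = some false) :
      Exec W (.loop b p) σ σ b.cost

end RAM

/-! ### Embedded planar st-graphs -/

/-- A directed graph with vertex set `V` and edge set `E`, together with a combinatorial embedding.
Every edge `e` has two ends (darts): `Sum.inl e` at its tail `src e` and `Sum.inr e` at its head
`tgt e`. The permutation `rot` sends a dart to the clockwise next dart around the same vertex.
The edge `first` fixes the outer face: it is the face to the left of `first`. -/
structure EmbeddedDigraph (V E : Type*) where
  src : E → V
  tgt : E → V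
  rot : Equiv.Perm (E ⊕ E)
  rot_sameCycle : ∀ d d' : E ⊕ E,
    rot.SameCycle d d' ↔ Sum.elim src tgt d = Sum.elim src tgt d'
  first : E

namespace EmbeddedDigraph

variable {V E : Type*} (G : EmbeddedDigraph V E)

/-- The vertex at which a dart is attached. -/
def vert (d : E ⊕ E) : V := Sum.elim G.src G.tgt d

/-- Walking along the edge of the dart `d`, away from its vertex, and continuing with the next dart
on the boundary of the face to the left of `d`. The faces are the cycles of this permutation. -/
def facePerm : Equiv.Perm (E ⊕ E) := (Equiv.sumComm E E).trans G.rot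

/-- The number of faces. -/
noncomputable def numFaces : ℕ := Nat.card (Quotient (Equiv.Perm.SameCycle.setoid G.facePerm))

/-- There is an edge from `u` to `v`. -/
def Adj (u v : V) : Prop := ∃ e, G.src e = u ∧ G.tgt e = v

/-- `G` is an embedded planar st-graph with source `s` and sink `t`. As an acyclic digraph with a
single source is connected, Euler's formula says that the combinatorial embedding is planar. -/
structure IsPlanarST [Fintype V] [Fintype E] (s t : V) : Prop where
  no_parallel : ∀ e f, G.src e = G.src f → G.tgt e = G.tgt f → e = f
  acyclic : ∀ v, ¬ Relation.TransGen G.Adj v v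
  source : ∀ v, (∀ e, G.tgt e ≠ v) ↔ v = s
  sink : ∀ v, (∀ e, G.src e ≠ v) ↔ v = t
  planar : Fintype.card V + G.numFaces = Fintype.card E + 2
  first_source : G.src G.first = s
  sink_outer : ∃ d, G.facePerm.SameCycle (Sum.inl G.first) d ∧ G.vert d = t

/-- `l = [(u, v₁), …, (u, vₘ)]` lists the edges leaving `u` in clockwise order. The list starts, for
the source `s`, with the edge that has the outer face to its left, and for every other vertex with
the edge whose predecessor in the clockwise order around `u` is an edge entering `u`. -/
structure IsSuccList (s u : V) (l : List E) : Prop where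
  nodup : l.Nodup
  mem_iff : ∀ e, e ∈ l ↔ G.src e = u
  clockwise : l.IsChain fun e f => G.rot (Sum.inl e) = Sum.inl f
  head_source : u = s → ∀ e ∈ l.head?, e = G.first
  head_other : u ≠ s → ∀ e ∈ l.head?, ∃ f, G.rot (Sum.inr f) = Sum.inl e

/-- `π` is an st-ordering, given by the ranks `1, …, |V|` of the vertices. -/
structure IsSTOrdering [Fintype V] (s t : V) (π : V → ℕ) : Prop where
  bijOn : Set.BijOn π Set.univ (Set.Icc 1 (Fintype.card V))
  rank_source : π s = 1
  rank_sink : π t = Fintype.card V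
  lt : ∀ e, π (G.src e) < π (G.tgt e)

end EmbeddedDigraph

/-- The sequence strictly increases up to some position `h` and strictly decreases from there on;
the empty sequence (the case of the sink, which has no successors) is bitonic. -/
def IsBitonic (l : List ℕ) : Prop :=
  l ≠ [] → ∃ h < l.length, ∀ (i : ℕ) (hi : i + 1 < l.length),
    (i < h → l[i] < l[i + 1]) ∧ (h ≤ i → l[i] > l[i + 1])

namespace EmbeddedDigraph

/-- `π` is a bitonic st-ordering: an st-ordering for which the ranks along every successor list
form a bitonic sequence. -/
def IsBitonicSTOrdering {V E : Type*} [Fintype V] (G : EmbeddedDigraph V E) (s t : V)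
    (π : V → ℕ) : Prop :=
  G.IsSTOrdering s t π ∧
    ∀ u, ∃ l, G.IsSuccList s u l ∧ IsBitonic (l.map fun e => π (G.tgt e))

/-- The number of a dart: the dart at the tail of the edge `e` has number `e` and the dart at its
head has number `m + e`. -/
def dartCode {m : ℕ} (d : Fin m ⊕ Fin m) : ℕ := (finSumFinEquiv d : Fin (m + m))

/-- The input for an embedded digraph with vertices `0, …, n - 1` and edges `0, …, m - 1`:
registers `0, 1, 2` hold `n`, `m` and the number of the edge `first`; array `0` holds the vertex of
every dart and array `1` the clockwise next dart; everything else is `0`. -/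
def input {n m : ℕ} (G : EmbeddedDigraph (Fin n) (Fin m)) : RAM.State where
  reg r := if r = 0 then n else if r = 1 then m else if r = 2 then (G.first : ℕ) else 0
  mem a i :=
    if h : i < m + m then
      if a = 0 then (G.vert (finSumFinEquiv.symm ⟨i, h⟩) : ℕ)
      else if a = 1 then dartCode (G.rot (finSumFinEquiv.symm ⟨i, h⟩))
      else 0
    else 0

end EmbeddedDigraph

/-! Let `e`, `f` be consecutive edges in the successor list of `u`. They bound a common inner face.
Every face has exactly one source corner and exactly one sink corner: each face has at least one of
either kind, every vertex other than `s`, `t` has at least one corner from an incoming to an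
outgoing edge, and Euler's formula leaves no room for more (`corner_counts`). If the sink of the
face between `e` and `f` is the head of `f`, the rest of its boundary is a path from the head of `e`
to the head of `f`, so every st-ordering ascends from `e` to `f`. If the sink is the head of `e`,
every st-ordering descends. In all other cases neither direction is forced.

A forced descent followed, later in the same list, by a forced ascent therefore excludes a bitonic
st-ordering (`IsBitonicSTOrdering.not_forced`). Conversely, if this never happens, add an edge
between the heads of any two consecutive edges of a list, pointing forward before the first forced
descent and backward from there on. No added edge contradicts a forced direction, and a topological
order of the augmented graph is a bitonic st-ordering (`isBitonicSTOrdering_of_down`), provided that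
this graph is acyclic.

Acyclicity (`augAdj_acyclic`) is proved by planar duality in linear algebra. A directed cycle, with
each added edge rerouted through the common tail of its two edges, is a circulation, hence the
coboundary of a face potential (`range_coboundary`). Corrected for the added edges, which split
faces, this potential never drops when an edge is crossed from right to left. The dual graph without
the outer face is acyclic (`dualAdj_acyclic`), so a maximum principle makes the corrected potential
constant and the cycle trivial.

The algorithm reads the forced directions off the rotation, walks once along every successor list,
writes down at most twice the given number of edges and runs Kahn's algorithm. Each loop is verified
by an invariant and a decreasing measure (`Computes.loop`); a uniform bound on all cells excludes
overflow. -/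

namespace EmbeddedDigraph

open Sum

/-! ### Darts and rotations -/

section Basic

variable {V E : Type*} {G : EmbeddedDigraph V E}

theorem vert_inl (e : E) : G.vert (inl e) = G.src e := rfl

theorem vert_inr (e : E) : G.vert (inr e) = G.tgt e := rfl

theorem vert_rot (d : E ⊕ E) : G.vert (G.rot d) = G.vert d :=
  ((G.rot_sameCycle d (G.rot d)).1 ⟨1, by simp⟩).symm

theorem facePerm_inl (e : E) : G.facePerm (inl e) = G.rot (inr e) := rfl

theorem facePerm_inr (e : E) : G.facePerm (inr e) = G.rot (inl e) := rfl

theorem vert_facePerm (d : E ⊕ E) : G.vert (G.facePerm d) = G.vert d.swap := vert_rot _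

theorem src_eq_of_rot {e f : E} (h : G.rot (inl e) = inl f) : G.src e = G.src f := by
  have := vert_rot (G := G) (inl e)
  rw [h] at this
  exact this.symm

theorem tgt_eq_of_rot {e f : E} (h : G.rot (inr e) = inr f) : G.tgt e = G.tgt f := by
  have := vert_rot (G := G) (inr e)
  rw [h] at this
  exact this.symm

/-- A cycle of a permutation that meets both a set and its complement enters the set. -/
theorem exists_switch {α : Type*} [Finite α] (σ : Equiv.Perm α) (p : α → Prop) {a b : α}
    (h : σ.SameCycle a b) (ha : ¬ p a) (hb : p b) :
    ∃ c, σ.SameCycle a c ∧ ¬ p c ∧ p (σ c) := by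
  by_contra! hc
  obtain ⟨n, hn⟩ := h.exists_nat_pow_eq
  have key : ∀ k : ℕ, ¬ p ((σ ^ k) a) := by
    intro k
    induction k with
    | zero => simpa using ha
    | succ k ih =>
      rw [pow_succ', Equiv.Perm.mul_apply]
      exact hc _ ⟨k, by simp⟩ ih
  exact key n (hn ▸ hb)

end Basic

/-! ### Euler's formula and the counting of corners -/

section Planar

variable {V E : Type*} [Fintype V] [Fintype E] {G : EmbeddedDigraph V E} {s t : V}

/-- A finite acyclic relation has a strictly increasing rank function. -/
theorem exists_rank {α : Type*} [Finite α] {r : α → α → Prop}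
    (h : ∀ v, ¬ Relation.TransGen r v v) : ∃ τ : α → ℕ, ∀ v w, r v w → τ v < τ w := by
  refine ⟨fun v => {w | Relation.TransGen r w v}.ncard, fun v w hvw => ?_⟩
  refine Set.ncard_lt_ncard ⟨fun x hx => Relation.TransGen.tail hx hvw, fun hs => ?_⟩
    (Set.toFinite _)
  exact h v (hs (Relation.TransGen.single hvw))

theorem IsPlanarST.exists_rank (hG : G.IsPlanarST s t) :
    ∃ τ : V → ℕ, ∀ e, τ (G.src e) < τ (G.tgt e) := by
  obtain ⟨τ, hτ⟩ := EmbeddedDigraph.exists_rank hG.acyclic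
  exact ⟨τ, fun e => hτ _ _ ⟨e, rfl, rfl⟩⟩

theorem IsPlanarST.source_ne_sink (hG : G.IsPlanarST s t) : s ≠ t := by
  intro h
  exact (hG.sink t).2 rfl G.first (h ▸ hG.first_source)

theorem IsPlanarST.tgt_ne_source (hG : G.IsPlanarST s t) (e : E) : G.tgt e ≠ s :=
  (hG.source s).2 rfl e

theorem IsPlanarST.src_ne_sink (hG : G.IsPlanarST s t) (e : E) : G.src e ≠ t :=
  (hG.sink t).2 rfl e

theorem IsPlanarST.exists_tgt (hG : G.IsPlanarST s t) {v : V} (hv : v ≠ s) :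
    ∃ e, G.tgt e = v := by
  by_contra! h
  exact hv ((hG.source v).1 h)

theorem IsPlanarST.exists_src (hG : G.IsPlanarST s t) {v : V} (hv : v ≠ t) :
    ∃ e, G.src e = v := by
  by_contra! h
  exact hv ((hG.sink v).1 h)

/-- A dart of the face whose vertex has maximal rank must be a head end: after a tail end the face
continues at the head of the same edge, which is higher. -/
theorem exists_inr_of_face (hG : G.IsPlanarST s t) (d : E ⊕ E) :
    ∃ e, G.facePerm.SameCycle d (inr e) := by
  obtain ⟨τ, hτ⟩ := hG.exists_rank
  obtain ⟨a, ha, hmax⟩ := Set.exists_max_image {a | G.facePerm.SameCycle d a}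
    (fun a => τ (G.vert a)) (Set.toFinite _) ⟨d, Equiv.Perm.SameCycle.refl _ _⟩
  rcases a with e | e
  · have h1 := hmax (G.facePerm (inl e)) (Equiv.Perm.sameCycle_apply_right.2 ha)
    rw [vert_facePerm] at h1
    exact absurd (hτ e) (not_lt.2 h1)
  · exact ⟨e, ha⟩

theorem exists_inl_of_face (hG : G.IsPlanarST s t) (d : E ⊕ E) :
    ∃ e, G.facePerm.SameCycle d (inl e) := by
  obtain ⟨τ, hτ⟩ := hG.exists_rank
  obtain ⟨a, ha, hmax⟩ := Set.exists_min_image {a | G.facePerm.SameCycle d a}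
    (fun a => τ (G.vert a)) (Set.toFinite _) ⟨d, Equiv.Perm.SameCycle.refl _ _⟩
  rcases a with e | e
  · exact ⟨e, ha⟩
  · have h1 := hmax (G.facePerm (inr e)) (Equiv.Perm.sameCycle_apply_right.2 ha)
    rw [vert_facePerm] at h1
    exact absurd (hτ e) (not_lt.2 h1)

/-- Every face has a source corner. -/
theorem exists_source_corner (hG : G.IsPlanarST s t) (d : E ⊕ E) :
    ∃ e, G.facePerm.SameCycle d (inr e) ∧ (G.rot (inl e)).isLeft := by
  obtain ⟨e, he⟩ := exists_inr_of_face hG d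
  obtain ⟨f, hf⟩ := exists_inl_of_face hG d
  -- A switch from head ends to tail ends along a face is a source corner, since `facePerm (inr c) =
  -- rot (inl c)`.
  obtain ⟨c, h1, h2, h3⟩ := exists_switch G.facePerm (fun c => c.isLeft) (he.symm.trans hf)
    (by simp) (by simp)
  rcases c with c | c
  · simp at h2
  · exact ⟨c, he.trans h1, h3⟩

/-- Every face has a sink corner. -/
theorem exists_sink_corner (hG : G.IsPlanarST s t) (d : E ⊕ E) :
    ∃ e, G.facePerm.SameCycle d (inl e) ∧ (G.rot (inr e)).isRight := by
  obtain ⟨e, he⟩ := exists_inr_of_face hG d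
  obtain ⟨f, hf⟩ := exists_inl_of_face hG d
  obtain ⟨c, h1, h2, h3⟩ := exists_switch G.facePerm (fun c => c.isRight) (hf.symm.trans he)
    (by simp) (by simp)
  rcases c with c | c
  · exact ⟨c, hf.trans h1, h3⟩
  · simp at h2

/-- At every vertex that is neither the source nor the sink some outgoing edge follows an incoming
edge. -/
theorem exists_in_out (hG : G.IsPlanarST s t) {v : V} (hs : v ≠ s) (ht : v ≠ t) :
    ∃ x, G.tgt x = v ∧ (G.rot (inr x)).isLeft := by
  obtain ⟨x, hx⟩ := hG.exists_tgt hs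
  obtain ⟨y, hy⟩ := hG.exists_src ht
  have h : G.rot.SameCycle (inr x) (inl y) := by
    rw [G.rot_sameCycle]
    exact hx.trans hy.symm
  obtain ⟨c, h1, h2, h3⟩ := exists_switch G.rot (fun c => c.isLeft) h (by simp) (by simp)
  rcases c with c | c
  · simp at h2
  · refine ⟨c, ?_, h3⟩
    rw [G.rot_sameCycle] at h1
    exact h1.symm.trans hx

-- Sorting the corners by the directions of their two darts gives (out, out) + (in, out) = |E| =
-- (in, out) + (in, in). Surjections onto the faces, the inner vertices and the faces bound these
-- three numbers below by |F|, |V| - 2 and |F|. By Euler's formula all three bounds are attained, so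
-- the surjections are injective.
open Classical in
theorem corner_counts (hG : G.IsPlanarST s t) :
    (Function.Injective fun x : {x : E // (G.rot (inr x)).isLeft} => G.tgt x) ∧
    (Function.Injective fun e : {e : E // (G.rot (inl e)).isLeft} =>
      (Quotient.mk (Equiv.Perm.SameCycle.setoid G.facePerm) (inr e.1))) ∧
    (Function.Injective fun e : {e : E // (G.rot (inr e)).isRight} =>
      (Quotient.mk (Equiv.Perm.SameCycle.setoid G.facePerm) (inl e.1))) := by
  let F := Quotient (Equiv.Perm.SameCycle.setoid G.facePerm)
  have hF : G.numFaces = Nat.card F := rfl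
  -- Both families together are the darts that `rot` sends to an outgoing dart, and `rot` is a
  -- bijection.
  have e1 : Nat.card {e : E // (G.rot (inl e)).isLeft} +
      Nat.card {x : E // (G.rot (inr x)).isLeft} = Nat.card E := by
    rw [← Nat.card_sum, ← Nat.card_congr (Equiv.subtypeSum (p := fun d => (G.rot d).isLeft))]
    have : IsEmpty {b : E // (inr b : E ⊕ E).isLeft} := ⟨fun h => by simpa using h.2⟩
    refine Nat.card_congr ?_
    refine (G.rot.subtypeEquiv (q := fun d => d.isLeft) (fun _ => Iff.rfl)).trans ?_
    refine (Equiv.subtypeSum (p := fun d : E ⊕ E => d.isLeft)).trans ?_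
    exact (Equiv.sumEmpty _ _).trans (Equiv.subtypeUnivEquiv (by simp))
  have e2 : Nat.card {x : E // (G.rot (inr x)).isLeft} +
      Nat.card {e : E // (G.rot (inr e)).isRight} = Nat.card E := by
    rw [← Nat.card_sum]
    refine Nat.card_congr ?_
    refine Equiv.trans (Equiv.sumCongr (Equiv.refl _) (Equiv.subtypeEquivRight ?_))
      (Equiv.sumCompl fun x : E => (G.rot (inr x)).isLeft)
    intro x
    cases G.rot (inr x) <;> simp
  let W := {v : V // v ≠ s ∧ v ≠ t}
  have hW : Nat.card W + 2 = Nat.card V := by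
    have h1 : Nat.card W = ({s, t}ᶜ : Finset V).card := by
      rw [Nat.card_eq_fintype_card, Fintype.card_subtype]
      congr 1
      ext v
      simp
    have h2 := Finset.card_compl_add_card ({s, t} : Finset V)
    rw [Finset.card_pair hG.source_ne_sink] at h2
    rw [h1, h2, Nat.card_eq_fintype_card]
  let g : {x : E // (G.rot (inr x)).isLeft} → W := fun x => ⟨G.tgt x, hG.tgt_ne_source _, by
    obtain ⟨f, hf⟩ := Sum.isLeft_iff.1 x.2
    have := vert_rot (G := G) (inr x.1)
    rw [hf, vert_inl, vert_inr] at this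
    rw [← this]
    exact hG.src_ne_sink f⟩
  have hg : Function.Surjective g := by
    rintro ⟨v, h1, h2⟩
    obtain ⟨x, hx, hx'⟩ := exists_in_out hG h1 h2
    exact ⟨⟨x, hx'⟩, Subtype.ext hx⟩
  let a : {e : E // (G.rot (inl e)).isLeft} → F := fun e => Quotient.mk _ (inr e.1)
  have ha : Function.Surjective a := by
    intro q
    induction q using Quotient.inductionOn with
    | h d =>
      obtain ⟨e, h1, h2⟩ := exists_source_corner hG d
      exact ⟨⟨e, h2⟩, Quotient.sound h1.symm⟩
  let b : {e : E // (G.rot (inr e)).isRight} → F := fun e => Quotient.mk _ (inl e.1)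
  have hb : Function.Surjective b := by
    intro q
    induction q using Quotient.inductionOn with
    | h d =>
      obtain ⟨e, h1, h2⟩ := exists_sink_corner hG d
      exact ⟨⟨e, h2⟩, Quotient.sound h1.symm⟩
  have c1 := Nat.card_le_card_of_surjective g hg
  have c2 := Nat.card_le_card_of_surjective a ha
  have c3 := Nat.card_le_card_of_surjective b hb
  have hp := hG.planar
  rw [← Nat.card_eq_fintype_card, ← Nat.card_eq_fintype_card, hF] at hp
  refine ⟨?_, ?_, ?_⟩
  · have := (hg.bijective_of_nat_card_le (by omega)).1
    intro x y hxy
    exact this (Subtype.ext hxy)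
  · exact (ha.bijective_of_nat_card_le (by omega)).1
  · exact (hb.bijective_of_nat_card_le (by omega)).1

/-- Every vertex has at most one corner between an incoming edge and the next outgoing edge. -/
theorem in_out_unique (hG : G.IsPlanarST s t) {x y e f : E} (hx : G.rot (inr x) = inl e)
    (hy : G.rot (inr y) = inl f) (h : G.tgt x = G.tgt y) : x = y := by
  have := @(corner_counts hG).1 ⟨x, by simp [hx]⟩ ⟨y, by simp [hy]⟩ h
  simpa using this

/-- Every face has at most one source corner. -/
theorem source_corner_unique (hG : G.IsPlanarST s t) {x y e f : E} (hx : G.rot (inl x) = inl e)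
    (hy : G.rot (inl y) = inl f) (h : G.facePerm.SameCycle (inr x) (inr y)) : x = y := by
  have := @(corner_counts hG).2.1 ⟨x, by simp [hx]⟩ ⟨y, by simp [hy]⟩ (Quotient.sound h)
  simpa using this

/-- Every face has at most one sink corner. -/
theorem sink_corner_unique (hG : G.IsPlanarST s t) {x y e f : E} (hx : G.rot (inr x) = inr e)
    (hy : G.rot (inr y) = inr f) (h : G.facePerm.SameCycle (inl x) (inl y)) : x = y := by
  have := @(corner_counts hG).2.2 ⟨x, by simp [hx]⟩ ⟨y, by simp [hy]⟩ (Quotient.sound h)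
  simpa using this

end Planar

end EmbeddedDigraph

/-! ### Faces, and the duality between vertex potentials and face potentials -/

namespace EmbeddedDigraph

open Sum

section Face

variable {V E : Type*} {G : EmbeddedDigraph V E}

variable (G) in
/-- The faces. -/
abbrev Face : Type _ := Quotient (Equiv.Perm.SameCycle.setoid G.facePerm)

variable (G) in
/-- The face to the left of a dart. -/
def face (d : E ⊕ E) : G.Face := Quotient.mk (Equiv.Perm.SameCycle.setoid G.facePerm) d

theorem face_eq_iff {d d' : E ⊕ E} : G.face d = G.face d' ↔ G.facePerm.SameCycle d d' :=
  Quotient.eq (r := Equiv.Perm.SameCycle.setoid G.facePerm)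

theorem face_facePerm (d : E ⊕ E) : G.face (G.facePerm d) = G.face d :=
  face_eq_iff.2 (Equiv.Perm.sameCycle_apply_left.2 (Equiv.Perm.SameCycle.refl _ _))

end Face

section Homology

variable {V E : Type*} [Fintype V] [Fintype E] {G : EmbeddedDigraph V E} {s t : V}

theorem IsPlanarST.source_reach (hG : G.IsPlanarST s t) (v : V) :
    Relation.ReflTransGen G.Adj s v := by
  obtain ⟨τ, hτ⟩ := hG.exists_rank
  induction h : τ v using Nat.strong_induction_on generalizing v with
  | _ k ih =>
    by_cases hv : v = s
    · rw [hv]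
    · obtain ⟨e, he⟩ := hG.exists_tgt hv
      exact (ih _ (by rw [← h, ← he]; exact hτ e) (G.src e) rfl).tail ⟨e, rfl, he⟩

theorem IsPlanarST.reach_sink (hG : G.IsPlanarST s t) (v : V) :
    Relation.ReflTransGen G.Adj v t := by
  obtain ⟨τ, hτ⟩ := hG.exists_rank
  by_contra hv
  obtain ⟨w, hw, hmax⟩ := Set.exists_max_image {w | ¬ Relation.ReflTransGen G.Adj w t} τ
    (Set.toFinite _) ⟨v, hv⟩
  by_cases h : w = t
  · exact hw (h ▸ Relation.ReflTransGen.refl)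
  · obtain ⟨e, he⟩ := hG.exists_src h
    have h1 : ¬ Relation.ReflTransGen G.Adj (G.tgt e) t := fun h' => hw (h'.head ⟨e, he, rfl⟩)
    have h2 := hmax _ h1
    have h3 := hτ e
    rw [he] at h3
    omega

/-- Coboundaries of vertex potentials and of face potentials are orthogonal. -/
theorem sum_coboundary_mul {V E : Type*} [Fintype E] {G : EmbeddedDigraph V E} (ψ : V → ℝ)
    (φ : E ⊕ E → ℝ) (hφ : ∀ d, φ (G.facePerm d) = φ d) :
    ∑ e, (ψ (G.tgt e) - ψ (G.src e)) * (φ (inl e) - φ (inr e)) = 0 := by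
  -- Reindexing by `facePerm` preserves `φ` and moves a dart to the other end of its edge.
  have h1 : ∑ d, ψ (G.vert d.swap) * φ d = ∑ d, ψ (G.vert d) * φ d := by
    rw [← Equiv.sum_comp G.facePerm fun d => ψ (G.vert d) * φ d]
    exact Finset.sum_congr rfl fun d _ => by rw [vert_facePerm, hφ]
  rw [Fintype.sum_sum_type, Fintype.sum_sum_type] at h1
  simp only [swap_inl, swap_inr, vert_inl, vert_inr, ← Finset.sum_add_distrib] at h1
  rw [← sub_eq_zero, ← Finset.sum_sub_distrib] at h1
  rw [← h1]
  exact Finset.sum_congr rfl fun e _ => by ring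

variable (G) in
/-- The coboundary of a vertex potential. -/
noncomputable def vertexCoboundary : (V → ℝ) →ₗ[ℝ] EuclideanSpace ℝ E where
  toFun ψ := WithLp.toLp 2 fun e => ψ (G.tgt e) - ψ (G.src e)
  map_add' ψ χ := by ext e; simp; ring
  map_smul' r ψ := by ext e; simp; ring

variable (G) in
/-- The coboundary of a face potential. -/
noncomputable def faceCoboundary :
    (G.Face → ℝ) →ₗ[ℝ] EuclideanSpace ℝ E where
  toFun φ := WithLp.toLp 2 fun e => φ (G.face (inl e)) - φ (G.face (inr e))
  map_add' ψ χ := by ext e; simp; ring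
  map_smul' r ψ := by ext e; simp; ring

theorem eq_of_sameCycle {α β : Type*} [Finite α] {σ : Equiv.Perm α} {φ : α → β}
    (hφ : ∀ d, φ (σ d) = φ d) {a b : α} (h : σ.SameCycle a b) : φ a = φ b := by
  obtain ⟨n, rfl⟩ := h.exists_nat_pow_eq
  induction n with
  | zero => simp
  | succ n ih =>
    rw [pow_succ', Equiv.Perm.mul_apply, hφ]
    exact ih ⟨n, by simp⟩

/-- A potential with zero coboundary is constant along edges, and every vertex is reached from `s`.
-/
theorem finrank_ker_vertexCoboundary_le (hG : G.IsPlanarST s t) :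
    Module.finrank ℝ (LinearMap.ker G.vertexCoboundary) ≤ 1 := by
  refine finrank_le_one ⟨fun _ => 1, ?_⟩ ?_
  · ext e
    simp [vertexCoboundary]
  · rintro ⟨ψ, hψ⟩
    refine ⟨ψ s, Subtype.ext (funext fun v => ?_)⟩
    have h : ψ s = ψ v := by
      induction hG.source_reach v with
      | refl => rfl
      | tail _ h ih =>
        obtain ⟨e, rfl, rfl⟩ := h
        rw [ih]
        have := congrArg (fun x => x.ofLp e) (LinearMap.mem_ker.1 hψ)
        simp [vertexCoboundary] at this
        linarith
    simp [h]

/-- Equal values on both sides of every edge make the potential constant around each vertex; an edge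
passes the constant on to its head, and every vertex is reached from `s`. -/
theorem finrank_ker_faceCoboundary_le (hG : G.IsPlanarST s t) :
    Module.finrank ℝ (LinearMap.ker G.faceCoboundary) ≤ 1 := by
  refine finrank_le_one ⟨fun _ => 1, ?_⟩ ?_
  · ext e
    simp [faceCoboundary]
  · rintro ⟨φ, hφ⟩
    have h0 : ∀ e, φ (G.face (inl e)) = φ (G.face (inr e)) := fun e => by
      have := congrArg (fun x => x.ofLp e) (LinearMap.mem_ker.1 hφ)
      simp [faceCoboundary] at this
      linarith
    have h1 : ∀ d : E ⊕ E, φ (G.face (G.rot d)) = φ (G.face d) := by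
      intro d
      have h2 : φ (G.face (G.rot d)) = φ (G.face d.swap) := by
        congr 1
        have h3 : G.rot d = G.facePerm d.swap := by simp [facePerm]
        rw [h3, face_facePerm]
      rw [h2]
      rcases d with e | e
      · exact (h0 e).symm
      · exact h0 e
    have h4 : ∀ v, ∀ d, G.vert d = v → φ (G.face d) = φ (G.face (inl G.first)) := by
      intro v
      induction hG.source_reach v with
      | refl =>
        intro d hd
        exact eq_of_sameCycle (φ := fun d => φ (G.face d)) h1
          ((G.rot_sameCycle d _).2 (hd.trans hG.first_source.symm))
      | tail _ h ih =>
        obtain ⟨e, rfl, rfl⟩ := h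
        intro d hd
        have h5 := eq_of_sameCycle (φ := fun d => φ (G.face d)) h1
          ((G.rot_sameCycle d (inr e)).2 hd)
        rw [h5, ← ih (inl e) rfl, h0]
    refine ⟨φ (G.face (inl G.first)), Subtype.ext (funext fun q => ?_)⟩
    induction q using Quotient.inductionOn with
    | h d =>
      have := h4 _ d rfl
      simpa [face] using this.symm

-- The two ranges are orthogonal and have dimensions at least |V| - 1 and |F| - 1. By Euler's
-- formula these add up to |E|, so each range fills the orthogonal complement of the other.
open Classical in
theorem range_coboundary (hG : G.IsPlanarST s t) :
    LinearMap.range G.faceCoboundary = (LinearMap.range G.vertexCoboundary)ᗮ ∧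
    LinearMap.range G.vertexCoboundary = (LinearMap.range G.faceCoboundary)ᗮ := by
  have h1 := LinearMap.finrank_range_add_finrank_ker G.vertexCoboundary
  have h2 := LinearMap.finrank_range_add_finrank_ker G.faceCoboundary
  have h3 := finrank_ker_vertexCoboundary_le hG
  have h4 := finrank_ker_faceCoboundary_le hG
  have h5 := (LinearMap.range G.vertexCoboundary).finrank_add_finrank_orthogonal
  have h6 := (LinearMap.range G.faceCoboundary).finrank_add_finrank_orthogonal
  have hp : Fintype.card V + Fintype.card G.Face = Fintype.card E + 2 := by
    rw [← hG.planar, numFaces, ← Nat.card_eq_fintype_card (α := G.Face)]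
  rw [Module.finrank_fintype_fun_eq_card] at h1 h2
  rw [finrank_euclideanSpace] at h5 h6
  have horth : ∀ x ∈ LinearMap.range G.vertexCoboundary, ∀ y ∈ LinearMap.range G.faceCoboundary,
      inner ℝ x y = 0 := by
    rintro _ ⟨ψ, rfl⟩ _ ⟨φ, rfl⟩
    rw [real_inner_comm, PiLp.inner_apply,
      ← sum_coboundary_mul ψ (fun d => φ (G.face d)) fun d => congrArg φ (face_facePerm d)]
    rfl
  constructor
  · refine Submodule.eq_of_le_of_finrank_le (fun y hy => ?_) (by omega)
    rw [Submodule.mem_orthogonal]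
    exact fun x hx => horth x hx y hy
  · refine Submodule.eq_of_le_of_finrank_le (fun x hx => ?_) (by omega)
    rw [Submodule.mem_orthogonal]
    exact fun y hy => by rw [real_inner_comm]; exact horth x hx y hy

/-- A circulation is the coboundary of a face potential. -/
theorem exists_face_potential (hG : G.IsPlanarST s t) (c : E → ℝ)
    (hc : ∀ ψ : V → ℝ, ∑ e, c e * (ψ (G.tgt e) - ψ (G.src e)) = 0) :
    ∃ φ : E ⊕ E → ℝ, (∀ d, φ (G.facePerm d) = φ d) ∧ ∀ e, φ (inl e) - φ (inr e) = c e := by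
  have h : WithLp.toLp 2 c ∈ LinearMap.range G.faceCoboundary := by
    rw [(range_coboundary hG).1, Submodule.mem_orthogonal]
    rintro _ ⟨ψ, rfl⟩
    rw [PiLp.inner_apply, ← hc ψ]
    rfl
  obtain ⟨φ, hφ⟩ := h
  refine ⟨fun d => φ (G.face d), fun d => congrArg φ (face_facePerm d), fun e => ?_⟩
  exact congrArg (fun x => x.ofLp e) hφ

/-- A function on edges that is orthogonal to all coboundaries of face potentials is the
coboundary of a vertex potential. -/
theorem exists_vertex_potential (hG : G.IsPlanarST s t) (c : E → ℝ)
    (hc : ∀ φ : E ⊕ E → ℝ, (∀ d, φ (G.facePerm d) = φ d) →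
      ∑ e, c e * (φ (inl e) - φ (inr e)) = 0) :
    ∃ ψ : V → ℝ, ∀ e, ψ (G.tgt e) - ψ (G.src e) = c e := by
  have h : WithLp.toLp 2 c ∈ LinearMap.range G.vertexCoboundary := by
    rw [(range_coboundary hG).2, Submodule.mem_orthogonal]
    rintro _ ⟨φ, rfl⟩
    rw [PiLp.inner_apply, ← hc (fun d => φ (G.face d)) fun d => congrArg φ (face_facePerm d)]
    rfl
  obtain ⟨ψ, hψ⟩ := h
  exact ⟨ψ, fun e => congrArg (fun x => x.ofLp e) hψ⟩

end Homology

end EmbeddedDigraph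

namespace EmbeddedDigraph

open Sum

/-! ### Acyclicity of the dual graph without the outer face -/

section Dual

variable {V E : Type*} {G : EmbeddedDigraph V E}

variable (G) in
/-- The inner face `p` lies to the right and the inner face `q` to the left of a common edge. -/
def DualAdj (p q : G.Face) : Prop :=
  ∃ e, G.face (inr e) = p ∧ G.face (inl e) = q ∧ p ≠ G.face (inl G.first) ∧
    q ≠ G.face (inl G.first)

variable [Fintype E] {s t : V}

/-- The flow `d` counts how often the dual walk crosses each edge. It vanishes on the boundary of
the outer face because both sides of a crossed edge are inner faces. -/
theorem exists_flow_of_dualAdj {p q : G.Face} (h : Relation.TransGen G.DualAdj p q) :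
    ∃ d : E → ℝ, (∀ e, 0 ≤ d e) ∧ (∃ e, 0 < d e) ∧
      (∀ e, G.face (inl e) = G.face (inl G.first) ∨ G.face (inr e) = G.face (inl G.first) →
        d e = 0) ∧
      ∀ φ : G.Face → ℝ, ∑ e, d e * (φ (G.face (inl e)) - φ (G.face (inr e))) = φ q - φ p := by
  classical
  have key : ∀ {p q}, G.DualAdj p q → ∃ d : E → ℝ, (∀ e, 0 ≤ d e) ∧ (∃ e, 0 < d e) ∧
      (∀ e, G.face (inl e) = G.face (inl G.first) ∨ G.face (inr e) = G.face (inl G.first) →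
        d e = 0) ∧
      ∀ φ : G.Face → ℝ, ∑ e, d e * (φ (G.face (inl e)) - φ (G.face (inr e))) = φ q - φ p := by
    rintro _ _ ⟨e, rfl, rfl, h1, h2⟩
    refine ⟨fun x => if x = e then 1 else 0, fun x => ?_, ⟨e, by simp⟩, fun x hx => ?_, ?_⟩
    · dsimp only
      split_ifs <;> norm_num
    · have : x ≠ e := by
        rintro rfl
        exact hx.elim h2 h1
      simp [this]
    · intro φ
      simp
  induction h with
  | single h => exact key h
  | tail _ h ih =>
    obtain ⟨d, h1, ⟨e, h2⟩, h3, h4⟩ := ih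
    obtain ⟨d', h1', -, h3', h4'⟩ := key h
    refine ⟨fun e => d e + d' e, fun e => add_nonneg (h1 e) (h1' e), ⟨e, ?_⟩, fun e he => ?_,
      fun φ => ?_⟩
    · have := h1' e
      simp only
      linarith
    · simp [h3 e he, h3' e he]
    · simp only [add_mul, Finset.sum_add_distrib, h4, h4']
      ring

variable [Fintype V]

/-- The dual graph without the outer face is acyclic. -/
theorem dualAdj_acyclic (hG : G.IsPlanarST s t) (p : G.Face) :
    ¬ Relation.TransGen G.DualAdj p p := by
  intro h
  obtain ⟨d, h1, ⟨e, h2⟩, h3, h4⟩ := exists_flow_of_dualAdj h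
  -- A closed dual walk is orthogonal to all face coboundaries, hence a vertex coboundary. The
  -- potential `ψ` is nondecreasing along edges and increases strictly along `e`.
  obtain ⟨ψ, hψ⟩ := exists_vertex_potential hG d (by
    intro φ hφ
    have := h4 (Quotient.lift φ fun a b hab => eq_of_sameCycle hφ hab)
    rw [sub_self] at this
    exact this)
  have hle : ∀ {v w}, Relation.ReflTransGen G.Adj v w → ψ v ≤ ψ w := by
    intro v w h
    induction h with
    | refl => rfl
    | tail _ h ih =>
      obtain ⟨x, rfl, rfl⟩ := h
      have h5 := hψ x
      have h6 := h1 x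
      linarith
  -- As `d` vanishes on the outer boundary, `ψ` is constant there. Both `s` and `t` lie on it, which
  -- contradicts the increase on a path from `s` through `e` to `t`.
  have houter : ∀ d, G.facePerm.SameCycle (inl G.first) d → ψ (G.vert d) = ψ s := by
    intro d hd
    obtain ⟨n, rfl⟩ := hd.exists_nat_pow_eq
    clear hd
    induction n with
    | zero => simp [vert_inl, hG.first_source]
    | succ n ih =>
      rw [← ih, pow_succ', Equiv.Perm.mul_apply, vert_facePerm]
      have h5 : G.face ((G.facePerm ^ n) (inl G.first)) = G.face (inl G.first) :=
        (face_eq_iff.2 ⟨n, by simp⟩).symm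
      generalize (G.facePerm ^ n) (inl G.first) = y at h5 ⊢
      rcases y with x | x
      · have h6 := hψ x
        rw [h3 x (Or.inl h5)] at h6
        rw [swap_inl, vert_inl, vert_inr]
        linarith
      · have h6 := hψ x
        rw [h3 x (Or.inr h5)] at h6
        rw [swap_inr, vert_inl, vert_inr]
        linarith
  obtain ⟨x, hx, hxt⟩ := hG.sink_outer
  have h5 := houter x hx
  rw [hxt] at h5
  have h6 := hle (hG.source_reach (G.src e))
  have h7 := hle (hG.reach_sink (G.tgt e))
  have h8 := hψ e
  linarith

/-- A nonempty set of inner faces cannot be left-closed: walking to the left ends outside. -/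
theorem face_left_closed (hG : G.IsPlanarST s t) (S : Set G.Face)
    (hS : G.face (inl G.first) ∉ S)
    (h : ∀ p ∈ S, ∃ e, G.face (inr e) = p ∧ G.face (inl e) ∈ S) : S = ∅ := by
  by_contra hne
  obtain ⟨τ, hτ⟩ := EmbeddedDigraph.exists_rank (dualAdj_acyclic hG)
  obtain ⟨p, hp, hmax⟩ := Set.exists_max_image S τ (Set.toFinite _)
    (Set.nonempty_iff_ne_empty.2 hne)
  obtain ⟨e, h1, h2⟩ := h p hp
  have h3 := hτ p _ ⟨e, h1, rfl, fun h' => hS (h' ▸ hp), fun h' => hS (h' ▸ h2)⟩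
  exact absurd (hmax _ h2) (not_le.2 h3)

/-- A nonempty set of inner faces cannot be right-closed. -/
theorem face_right_closed (hG : G.IsPlanarST s t) (S : Set G.Face)
    (hS : G.face (inl G.first) ∉ S)
    (h : ∀ p ∈ S, ∃ e, G.face (inl e) = p ∧ G.face (inr e) ∈ S) : S = ∅ := by
  by_contra hne
  obtain ⟨τ, hτ⟩ := EmbeddedDigraph.exists_rank (dualAdj_acyclic hG)
  obtain ⟨p, hp, hmax⟩ := Set.exists_min_image S τ (Set.toFinite _)
    (Set.nonempty_iff_ne_empty.2 hne)
  obtain ⟨e, h1, h2⟩ := h p hp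
  have h3 := hτ _ p ⟨e, rfl, h1, fun h' => hS (h' ▸ h2), fun h' => hS (h' ▸ hp)⟩
  exact absurd (hmax _ h2) (not_le.2 h3)

end Dual

end EmbeddedDigraph

namespace EmbeddedDigraph

open Sum

/-! ### The augmented graph and its acyclicity -/

section Augment

variable {V E : Type*} (G : EmbeddedDigraph V E)

/-- The edges `e` and `f` leave the same vertex, `f` is the clockwise next edge after `e`, and the
face between them is not the outer face. -/
def Next (e f : E) : Prop := G.rot (inl e) = inl f ∧ f ≠ G.first

/-- The head of `f` is the sink of the face to the left of `f`, if `f` starts at its source. -/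
def ForcedUp (f : E) : Prop := ∃ g, G.rot (inr f) = inr g

/-- The head of `e` is the sink of the face to the right of `e`, if `e` starts at its source. -/
def ForcedDown (e : E) : Prop := ∃ g, G.rot (inr g) = inr e

/-- The edges of the graph together with one edge between the heads of any two consecutive edges
`e` and `f` leaving the same vertex; it goes from `f` to `e` if `down e` and from `e` to `f`
otherwise. -/
def AugAdj (down : E → Prop) (v w : V) : Prop :=
  G.Adj v w ∨ ∃ e f, G.Next e f ∧
    (¬ down e ∧ v = G.tgt e ∧ w = G.tgt f ∨ down e ∧ v = G.tgt f ∧ w = G.tgt e)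

variable {G}

theorem Next.src_eq {e f : E} (h : G.Next e f) : G.src e = G.src f := src_eq_of_rot h.1

theorem Next.left_unique {e e' f : E} (h : G.Next e f) (h' : G.Next e' f) : e = e' :=
  inl_injective (G.rot.injective (h.1.trans h'.1.symm))

theorem Next.facePerm {e f : E} (h : G.Next e f) : G.facePerm (inr e) = inl f := h.1

theorem Next.facePerm_symm {e f : E} (h : G.Next e f) : G.facePerm.symm (inl f) = inr e :=
  (Equiv.symm_apply_eq _).2 h.1.symm

variable (G) in
/-- The edge `e` is the first one in the successor list of its tail. -/
def IsStart (e : E) : Prop := e = G.first ∨ ∃ x, G.rot (inr x) = inl e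

theorem IsStart.not_next {e f : E} (hf : G.IsStart f) : ¬ G.Next e f := by
  intro h
  rcases hf with rfl | ⟨x, hx⟩
  · exact h.2 rfl
  · simpa using G.rot.injective (hx.trans h.1.symm)

/-- An added edge between the heads of `e` and `f` is replaced by the path through their common
tail: `e` and `f` are used with opposite signs. The signed number of uses is stored at the dart `inr
e`, whose successor on the face is `inl f`. For each `e` only one sign occurs, so nothing cancels
and the data of a nonempty walk are nonzero. -/
theorem exists_flow_of_augAdj [Fintype E] {down : E → Prop} {v w : V}
    (h : Relation.TransGen (G.AugAdj down) v w) :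
    ∃ (a : E → ℝ) (b : E ⊕ E → ℝ), (∀ e, 0 ≤ a e) ∧ (∀ e, down e → b (inr e) ≤ 0) ∧
      (∀ e, ¬ down e → 0 ≤ b (inr e)) ∧ (∀ e, b (inl e) = 0) ∧
      (∀ e, b (inr e) ≠ 0 → ∃ f, G.Next e f) ∧ ((∃ e, a e ≠ 0) ∨ ∃ e, b (inr e) ≠ 0) ∧
      ∀ ψ : V → ℝ, ∑ e, (a e + b (G.facePerm.symm (inl e)) - b (inr e)) *
        (ψ (G.tgt e) - ψ (G.src e)) = ψ w - ψ v := by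
  classical
  have key : ∀ {v w}, G.AugAdj down v w → ∃ (a : E → ℝ) (b : E ⊕ E → ℝ), (∀ e, 0 ≤ a e) ∧
      (∀ e, down e → b (inr e) ≤ 0) ∧
      (∀ e, ¬ down e → 0 ≤ b (inr e)) ∧ (∀ e, b (inl e) = 0) ∧
      (∀ e, b (inr e) ≠ 0 → ∃ f, G.Next e f) ∧ ((∃ e, a e ≠ 0) ∨ ∃ e, b (inr e) ≠ 0) ∧
      ∀ ψ : V → ℝ, ∑ e, (a e + b (G.facePerm.symm (inl e)) - b (inr e)) *
        (ψ (G.tgt e) - ψ (G.src e)) = ψ w - ψ v := by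
    rintro v w (⟨e, rfl, rfl⟩ | ⟨e, f, hef, h⟩)
    · refine ⟨fun x => if x = e then 1 else 0, 0, fun x => ?_, by simp, by simp, by simp, by simp,
        Or.inl ⟨e, by simp⟩, by simp⟩
      dsimp only
      split_ifs <;> norm_num
    · have hsum : ∀ (r : ℝ) (ψ : V → ℝ), ∑ x, ((0 : E → ℝ) x +
          (if G.facePerm.symm (inl x) = inr e then r else 0) -
          (if (inr x : E ⊕ E) = inr e then r else 0)) *
          (ψ (G.tgt x) - ψ (G.src x)) = r * (ψ (G.tgt f) - ψ (G.tgt e)) := by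
        intro r ψ
        have h1 : ∀ x, G.facePerm.symm (inl x) = inr e ↔ x = f := fun x => by
          rw [Equiv.symm_apply_eq, hef.facePerm, inl.injEq]
        simp only [h1, inr.injEq, Pi.zero_apply, zero_add, sub_mul, Finset.sum_sub_distrib,
          ite_mul, zero_mul, Finset.sum_ite_eq', Finset.mem_univ, if_true, hef.src_eq]
        ring
      rcases h with ⟨hd, rfl, rfl⟩ | ⟨hd, rfl, rfl⟩
      · refine ⟨0, fun d => if d = inr e then 1 else 0, by simp, fun x hx => ?_, fun x _ => ?_,
          by simp, fun x hx => ?_, Or.inr ⟨e, by simp⟩, fun ψ => ?_⟩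
        · have : x ≠ e := by
            rintro rfl
            exact hd hx
          simp [this]
        · dsimp only
          split_ifs <;> norm_num
        · have : x = e := by simpa using hx
          exact ⟨f, this ▸ hef⟩
        · rw [hsum 1 ψ, one_mul]
      · refine ⟨0, fun d => if d = inr e then -1 else 0, by simp, fun x _ => ?_, fun x hx => ?_,
          by simp, fun x hx => ?_, Or.inr ⟨e, by simp⟩, fun ψ => ?_⟩
        · dsimp only
          split_ifs <;> norm_num
        · have : x ≠ e := by
            rintro rfl
            exact hx hd
          simp [this]
        · have : x = e := by simpa using hx
          exact ⟨f, this ▸ hef⟩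
        · rw [hsum (-1) ψ]
          ring
  induction h with
  | single h => exact key h
  | tail _ h ih =>
    obtain ⟨a, b, h1, h2, h3, h4, h5, h6, h7⟩ := ih
    obtain ⟨a', b', h1', h2', h3', h4', h5', -, h7'⟩ := key h
    refine ⟨a + a', b + b', fun e => add_nonneg (h1 e) (h1' e),
      fun e he => add_nonpos (h2 e he) (h2' e he), fun e he => add_nonneg (h3 e he) (h3' e he),
      fun e => by simp [h4, h4'], fun e he => ?_, ?_, fun ψ => ?_⟩
    · by_cases h : b (inr e) = 0
      · refine h5' e fun h' => he ?_
        simp [h, h']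
      · exact h5 e h
    · rcases h6 with ⟨e, he⟩ | ⟨e, he⟩
      · refine Or.inl ⟨e, fun h' => he ?_⟩
        have h8 := h1 e
        have h9 := h1' e
        simp only [Pi.add_apply] at h'
        linarith
      · refine Or.inr ⟨e, fun h' => he ?_⟩
        simp only [Pi.add_apply] at h'
        by_cases hd : down e
        · have h8 := h2 e hd
          have h9 := h2' e hd
          linarith
        · have h8 := h3 e hd
          have h9 := h3' e hd
          linarith
    · rw [← sub_add_sub_cancel' _ _, ← h7 ψ, ← h7' ψ, ← Finset.sum_add_distrib]
      refine Finset.sum_congr rfl fun e _ => ?_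
      simp only [Pi.add_apply]
      ring

variable [Fintype V] [Fintype E] {s t : V}

/-- The outer face has no corner between consecutive outgoing edges apart from the one before
the first edge. -/
theorem face_ne_outer_of_next (hG : G.IsPlanarST s t) {x y : E} (h : G.Next x y) :
    G.face (inr x) ≠ G.face (inl G.first) := by
  intro h1
  -- The dart before `first` is outgoing, as nothing enters `s`; so the outer face already has its
  -- source corner there.
  rcases h2 : G.rot.symm (inl G.first) with e | e
  · have h3 : G.rot (inl e) = inl G.first := by rw [← h2, Equiv.apply_symm_apply]
    have h4 : x = e := source_corner_unique hG h.1 h3 (by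
      rw [← face_eq_iff, h1, ← h3]
      exact face_facePerm (inr e))
    subst h4
    exact h.2 (inl_injective (h.1.symm.trans h3))
  · have h3 : G.rot (inr e) = inl G.first := by rw [← h2, Equiv.apply_symm_apply]
    have h4 := vert_rot (G := G) (inr e)
    rw [h3, vert_inl, vert_inr, hG.first_source] at h4
    exact hG.tgt_ne_source e h4.symm

/-- If no added edge goes against a path, the augmented graph is acyclic. -/
theorem augAdj_acyclic (hG : G.IsPlanarST s t) {down : E → Prop}
    (hup : ∀ e f, G.Next e f → ¬ down e → ¬ G.ForcedDown e)
    (hdown : ∀ e f, G.Next e f → down e → ¬ G.ForcedUp f) (v : V) :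
    ¬ Relation.TransGen (G.AugAdj down) v v := by
  intro hcyc
  obtain ⟨a, b, h1, h2, h3, h4, h5, h6, h7⟩ := exists_flow_of_augAdj hcyc
  obtain ⟨φ, hφ, hφc⟩ := exists_face_potential hG _ fun ψ => (h7 ψ).trans (sub_self _)
  have hφf : ∀ {d d'}, G.face d = G.face d' → φ d = φ d' := fun h =>
    eq_of_sameCycle hφ (face_eq_iff.1 h)
  have hsymm : ∀ d, G.face (G.facePerm.symm d) = G.face d := fun d => by
    rw [← face_facePerm, Equiv.apply_symm_apply]
  set Φ : E ⊕ E → ℝ := fun d => φ d - b d - b (G.facePerm.symm d) with hΦ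
  have hb : ∀ d, b d ≠ 0 → ∃ x y, d = inr x ∧ G.Next x y := by
    intro d hd
    rcases d with x | x
    · exact absurd (h4 x) hd
    · obtain ⟨y, hy⟩ := h5 x hd
      exact ⟨x, y, rfl, hy⟩
  have hb' : ∀ d, b (G.facePerm.symm d) ≠ 0 → ∃ x y, d = inl y ∧ G.Next x y := by
    intro d hd
    obtain ⟨x, y, h, hxy⟩ := hb _ hd
    rw [Equiv.symm_apply_eq, hxy.facePerm] at h
    exact ⟨x, y, h, hxy⟩
  -- The corrections cancel the rerouted flow, so the difference of the two sides is `a x`.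
  have hstep : ∀ x, Φ (inr x) ≤ Φ (inl x) := by
    intro x
    have h8 : b (G.facePerm.symm (inr x)) = 0 := by
      by_contra h
      obtain ⟨_, _, h, _⟩ := hb' _ h
      simp at h
    have h9 := hφc x
    have h10 := h1 x
    simp only [hΦ, h8, h4]
    linarith
  have houter : ∀ d, G.face d = G.face (inl G.first) → Φ d = φ (inl G.first) := by
    intro d hd
    have h8 : b d = 0 := by
      by_contra h
      obtain ⟨x, y, rfl, hxy⟩ := hb _ h
      exact face_ne_outer_of_next hG hxy hd
    have h9 : b (G.facePerm.symm d) = 0 := by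
      by_contra h
      obtain ⟨x, y, h', hxy⟩ := hb _ h
      refine face_ne_outer_of_next hG hxy ?_
      rw [← h', hsymm, hd]
    simp only [hΦ, h8, h9, hφf hd, sub_zero]
  -- On an inner face the maximum of `Φ` is attained at a dart from which the face can be left to
  -- the left, and the minimum at one from which it can be left to the right. Only here do the
  -- forced directions matter.
  have hinner : ∀ p, p ≠ G.face (inl G.first) → ∃ x y, G.face (inr x) = p ∧ G.face (inl y) = p ∧
      (∀ d, G.face d = p → Φ (inl y) ≤ Φ d ∧ Φ d ≤ Φ (inr x)) ∧
      ∀ z, G.face (inr z) = p → |b (inr z)| ≤ Φ (inr x) - Φ (inl y) := by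
    intro p hp
    induction p using Quotient.inductionOn with
    | h d₀ =>
    change G.face d₀ ≠ _ at hp
    obtain ⟨e, he, he'⟩ := exists_source_corner hG d₀
    obtain ⟨f, hf⟩ := Sum.isLeft_iff.1 he'
    have hep : G.face (inr e) = G.face d₀ := (face_eq_iff.2 he).symm
    have hfp : G.face (inl f) = G.face d₀ := by
      rw [← hep, ← hf]
      exact face_facePerm (inr e)
    have hef : G.Next e f := ⟨hf, by
      rintro rfl
      exact hp hfp.symm⟩
    change ∃ x y, G.face (inr x) = G.face d₀ ∧ G.face (inl y) = G.face d₀ ∧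
      (∀ d, G.face d = G.face d₀ → _) ∧
      ∀ z, G.face (inr z) = G.face d₀ → _
    have hb1 : ∀ d, G.face d = G.face d₀ → d ≠ inr e → b d = 0 := by
      intro d hd hne
      by_contra h
      obtain ⟨x, y, rfl, hxy⟩ := hb _ h
      rw [source_corner_unique hG hxy.1 hef.1 (face_eq_iff.1 (hd.trans hep.symm))] at hne
      exact hne rfl
    have hb2 : ∀ d, G.face d = G.face d₀ → d ≠ inl f → b (G.facePerm.symm d) = 0 := by
      intro d hd hne
      refine hb1 _ ((hsymm d).trans hd) fun h => hne ?_
      rw [Equiv.symm_apply_eq, hef.facePerm] at h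
      exact h
    have hΦe : Φ (inr e) = φ d₀ - b (inr e) := by
      simp only [hΦ, hb2 _ hep (by simp), hφf hep, sub_zero]
    have hΦf : Φ (inl f) = φ d₀ - b (inr e) := by
      simp only [hΦ, hb1 _ hfp (by simp), hφf hfp, sub_zero, hef.facePerm_symm]
    have hΦd : ∀ d, G.face d = G.face d₀ → d ≠ inr e → d ≠ inl f → Φ d = φ d₀ := by
      intro d hd h8 h9
      simp only [hΦ, hb1 _ hd h8, hb2 _ hd h9, hφf hd, sub_zero]
    by_cases hde : down e
    · have h8 : b (inr e) ≤ 0 := h2 e hde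
      -- Now the triangle carries the larger value, attained at `inr e`. The minimum needs a tail
      -- end outside the triangle; the dart after `inl f` is one, unless the head of `f` is the sink
      -- of the face.
      rcases h9 : G.rot (inr f) with g | g
      · have hgp : G.face (inl g) = G.face d₀ := by
          rw [← hfp, ← h9]
          exact face_facePerm (inl f)
        have h10 : Φ (inl g) = φ d₀ := by
          refine hΦd _ hgp (by simp) fun h => ?_
          have : G.facePerm (inl f) = G.facePerm (inr e) := by
            rw [hef.facePerm, facePerm_inl, h9, h]
          simpa using G.facePerm.injective this
        refine ⟨e, g, hep, hgp, fun d hd => ?_, fun z hz => ?_⟩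
        · rw [hΦe, h10]
          by_cases h11 : d = inr e
          · rw [h11, hΦe]
            constructor <;> linarith
          · by_cases h12 : d = inl f
            · rw [h12, hΦf]
              constructor <;> linarith
            · rw [hΦd d hd h11 h12]
              constructor <;> linarith
        · rw [hΦe, h10]
          by_cases h11 : inr z = (inr e : E ⊕ E)
          · rw [h11, abs_of_nonpos h8]
            linarith
          · rw [hb1 _ hz h11, abs_zero]
            linarith
      · exact absurd ⟨g, h9⟩ (hdown e f hef hde)
    · have h8 : 0 ≤ b (inr e) := h3 e hde
      -- Mirror case: the triangle carries the smaller value, attained at `inl f`, and the dart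
      -- before `inr e` is a head end outside it, unless the head of `e` is the sink of the face.
      rcases h9 : G.rot.symm (inr e) with g | g
      · rw [Equiv.symm_apply_eq] at h9
        have hgp : G.face (inr g) = G.face d₀ := by
          rw [← hep, h9]
          exact (face_facePerm (inr g)).symm
        have h10 : Φ (inr g) = φ d₀ := by
          refine hΦd _ hgp (fun h => ?_) (by simp)
          rw [inr.injEq] at h
          rw [h, hef.1] at h9
          simp at h9
        refine ⟨g, f, hgp, hfp, fun d hd => ?_, fun z hz => ?_⟩
        · rw [hΦf, h10]
          by_cases h11 : d = inr e
          · rw [h11, hΦe]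
            constructor <;> linarith
          · by_cases h12 : d = inl f
            · rw [h12, hΦf]
              constructor <;> linarith
            · rw [hΦd d hd h11 h12]
              constructor <;> linarith
        · rw [hΦf, h10]
          by_cases h11 : inr z = (inr e : E ⊕ E)
          · rw [h11, abs_of_nonneg h8]
            linarith
          · rw [hb1 _ hz h11, abs_zero]
            linarith
      · rw [Equiv.symm_apply_eq] at h9
        exact absurd ⟨g, h9.symm⟩ (hup e f hef hde)
  -- Maximum principle: if the maximum exceeded the outer value, the faces attaining it would be
  -- inner, and crossing the edge `x` to the left would never leave this set.
  have hle : ∀ d, Φ d ≤ φ (inl G.first) := by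
    obtain ⟨dm, hdm⟩ := @Finite.exists_max _ _ _ ⟨(inl G.first : E ⊕ E)⟩ _ Φ
    intro d
    refine (hdm d).trans (not_lt.1 fun hlt => ?_)
    have hne : ∀ d, Φ d = Φ dm → G.face d ≠ G.face (inl G.first) := fun d h h' =>
      (ne_of_gt hlt) (h ▸ houter d h')
    have h8 := face_left_closed hG {p | ∃ d, G.face d = p ∧ Φ d = Φ dm}
      (fun ⟨d, hd, hd'⟩ => hne d hd' hd) (by
        rintro _ ⟨d, rfl, hd⟩
        obtain ⟨x, y, hx, -, hxy, -⟩ := hinner _ (hne d hd)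
        refine ⟨x, hx, inl x, rfl, le_antisymm (hdm _) ?_⟩
        rw [← hd]
        exact (hxy d rfl).2.trans (hstep x))
    exact (Set.eq_empty_iff_forall_notMem.1 h8 _) ⟨dm, rfl, rfl⟩
  have hge : ∀ d, φ (inl G.first) ≤ Φ d := by
    obtain ⟨dm, hdm⟩ := @Finite.exists_min _ _ _ ⟨(inl G.first : E ⊕ E)⟩ _ Φ
    intro d
    refine le_trans (not_lt.1 fun hlt => ?_) (hdm d)
    have hne : ∀ d, Φ d = Φ dm → G.face d ≠ G.face (inl G.first) := fun d h h' =>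
      (ne_of_lt hlt) (h ▸ houter d h')
    have h8 := face_right_closed hG {p | ∃ d, G.face d = p ∧ Φ d = Φ dm}
      (fun ⟨d, hd, hd'⟩ => hne d hd' hd) (by
        rintro _ ⟨d, rfl, hd⟩
        obtain ⟨x, y, -, hy, hxy, -⟩ := hinner _ (hne d hd)
        refine ⟨y, hy, inr y, rfl, le_antisymm ?_ (hdm _)⟩
        rw [← hd]
        exact (hstep y).trans (hxy d rfl).1)
    exact (Set.eq_empty_iff_forall_notMem.1 h8 _) ⟨dm, rfl, rfl⟩
  -- Constancy of `Φ` forces `b = 0` by the last clause of `hinner` and then `a = 0` by `hφc`,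
  -- against `h6`.
  have hconst : ∀ d, Φ d = φ (inl G.first) := fun d => le_antisymm (hle d) (hge d)
  have hb0 : ∀ e, b (inr e) = 0 := by
    intro e
    by_contra h
    obtain ⟨_, f, h8, hef⟩ := hb _ h
    rw [inr.injEq] at h8
    subst h8
    obtain ⟨x, y, -, -, -, h9⟩ := hinner _ (face_ne_outer_of_next hG hef)
    have h10 := h9 e rfl
    rw [hconst, hconst, sub_self] at h10
    exact h (abs_nonpos_iff.1 h10)
  rcases h6 with ⟨e, he⟩ | ⟨e, he⟩
  · have h8 : b (G.facePerm.symm (inl e)) = 0 := by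
      by_contra h
      obtain ⟨x, y, h', _⟩ := hb _ h
      rw [h'] at h
      exact h (hb0 x)
    have h8' : b (G.facePerm.symm (inr e)) = 0 := by
      by_contra h
      obtain ⟨x, y, h', _⟩ := hb _ h
      rw [h'] at h
      exact h (hb0 x)
    have h9 := hφc e
    have h10 := hconst (inl e)
    have h11 := hconst (inr e)
    simp only [hΦ, h8, h8', hb0, h4] at h9 h10 h11
    exact he (by linarith)
  · exact he (hb0 e)

end Augment

end EmbeddedDigraph

namespace EmbeddedDigraph

open Sum

/-! ### Forced directions, successor lists and bitonic orderings -/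

section Bitonic

variable {V E : Type*} [Fintype V] [Fintype E] {G : EmbeddedDigraph V E} {s t : V}

/-- If `rot` fixed the dart of `e`, this would be the only dart at its tail. A tail other than `s`
also has an incoming dart, and at `s` the edge would be `first`. -/
theorem Next.ne (hG : G.IsPlanarST s t) {e f : E} (h : G.Next e f) : e ≠ f := by
  rintro rfl
  have h1 : ∀ d, G.vert d = G.src e → d = inl e := by
    intro d hd
    have := (G.rot_sameCycle (inl e) d).2 hd.symm
    exact this.eq_of_left h.1 |>.symm
  by_cases hs : G.src e = s
  · exact h.2 (inl_injective (h1 (inl G.first) (hG.first_source.trans hs.symm))).symm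
  · obtain ⟨x, hx⟩ := hG.exists_tgt hs
    simpa using h1 (inr x) hx

theorem Next.tgt_ne (hG : G.IsPlanarST s t) {e f : E} (h : G.Next e f) : G.tgt e ≠ G.tgt f :=
  fun h' => h.ne hG (hG.no_parallel _ _ h.src_eq h')

/-- From the sink corner at the head of `f` the boundary of the face runs against the edges until it
meets a source corner. The only one is at `e`, so ranks do not increase from the head of `f` to the
head of `e`. -/
theorem Next.lt_of_forcedUp (hG : G.IsPlanarST s t) {e f : E} (h : G.Next e f)
    (hf : G.ForcedUp f) {π : V → ℕ} (hinj : Function.Injective π)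
    (hπ : ∀ e, π (G.src e) < π (G.tgt e)) : π (G.tgt e) < π (G.tgt f) := by
  refine lt_of_le_of_ne ?_ fun h' => h.tgt_ne hG (hinj h')
  obtain ⟨g, hg⟩ := hf
  have hc : G.facePerm.SameCycle (inr g) (inr e) := by
    rw [← face_eq_iff, ← hg, ← facePerm_inl, face_facePerm, ← h.facePerm, face_facePerm]
  by_contra hlt
  have key : ∀ k : ℕ, ∃ x, (G.facePerm ^ k) (inr g) = inr x ∧ π (G.tgt x) ≤ π (G.tgt f) := by
    intro k
    induction k with
    | zero => exact ⟨g, by simp, by rw [tgt_eq_of_rot hg]⟩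
    | succ k ih =>
      obtain ⟨x, hx, hx'⟩ := ih
      rw [pow_succ', Equiv.Perm.mul_apply, hx, facePerm_inr]
      rcases hr : G.rot (inl x) with y | y
      · have h1 : G.facePerm.SameCycle (inr x) (inr e) :=
          Equiv.Perm.SameCycle.trans (Equiv.Perm.SameCycle.symm ⟨k, by rw [zpow_natCast, hx]⟩) hc
        rw [source_corner_unique hG hr h.1 h1] at hx'
        exact absurd hx' hlt
      · refine ⟨y, rfl, ?_⟩
        have h2 := vert_rot (G := G) (inl x)
        rw [hr, vert_inr, vert_inl] at h2
        rw [h2]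
        exact (hπ x).le.trans hx'
  obtain ⟨k, hk⟩ := hc.exists_nat_pow_eq
  obtain ⟨x, hx, hx'⟩ := key k
  rw [hk, inr.injEq] at hx
  exact hlt (hx ▸ hx')

/-- From `f` the boundary of the face follows the edges until it meets a sink corner. The only one
is at the head of `e`, so ranks do not decrease from the head of `f` to the head of `e`. -/
theorem Next.lt_of_forcedDown (hG : G.IsPlanarST s t) {e f : E} (h : G.Next e f)
    (he : G.ForcedDown e) {π : V → ℕ} (hinj : Function.Injective π)
    (hπ : ∀ e, π (G.src e) < π (G.tgt e)) : π (G.tgt f) < π (G.tgt e) := by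
  refine lt_of_le_of_ne ?_ fun h' => h.tgt_ne hG (hinj h').symm
  obtain ⟨g, hg⟩ := he
  have hc : G.facePerm.SameCycle (inl f) (inl g) := by
    rw [← face_eq_iff, ← h.facePerm, face_facePerm, ← hg, ← facePerm_inl, face_facePerm]
  by_contra hlt
  rw [← tgt_eq_of_rot hg] at hlt
  have key : ∀ k : ℕ, ∃ x, (G.facePerm ^ k) (inl f) = inl x ∧ π (G.tgt f) ≤ π (G.tgt x) := by
    intro k
    induction k with
    | zero => exact ⟨f, by simp, le_rfl⟩
    | succ k ih =>
      obtain ⟨x, hx, hx'⟩ := ih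
      rw [pow_succ', Equiv.Perm.mul_apply, hx, facePerm_inl]
      rcases hr : G.rot (inr x) with y | y
      · refine ⟨y, rfl, ?_⟩
        have h2 := vert_rot (G := G) (inr x)
        rw [hr, vert_inr, vert_inl] at h2
        rw [← h2] at hx'
        exact hx'.trans (hπ y).le
      · have h1 : G.facePerm.SameCycle (inl x) (inl g) :=
          Equiv.Perm.SameCycle.trans (Equiv.Perm.SameCycle.symm ⟨k, by rw [zpow_natCast, hx]⟩) hc
        rw [sink_corner_unique hG hr hg h1] at hx'
        exact absurd hx' hlt
  obtain ⟨k, hk⟩ := hc.exists_nat_pow_eq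
  obtain ⟨x, hx, hx'⟩ := key k
  rw [hk, inl.injEq] at hx
  exact hlt (hx ▸ hx')

theorem exists_isStart (hG : G.IsPlanarST s t) {u : V} (hu : u ≠ t) :
    ∃ e, G.src e = u ∧ (u = s → e = G.first) ∧ (u ≠ s → ∃ x, G.rot (inr x) = inl e) := by
  by_cases hs : u = s
  · exact ⟨G.first, hG.first_source.trans hs.symm, fun _ => rfl, fun h => absurd hs h⟩
  · obtain ⟨x, hx, hx'⟩ := exists_in_out hG hs hu
    obtain ⟨e, he⟩ := Sum.isLeft_iff.1 hx'
    refine ⟨e, ?_, fun h => absurd h hs, fun _ => ⟨x, he⟩⟩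
    rw [← hx, ← vert_inl, ← he, vert_rot, vert_inr]

/-- The list follows the rotation from the starting edge until the next dart is incoming or the
start again. It misses no outgoing edge, because a vertex has only one corner from an incoming to an
outgoing edge. -/
theorem exists_isSuccList (hG : G.IsPlanarST s t) (u : V) : ∃ l, G.IsSuccList s u l := by
  classical
  by_cases hu : u = t
  · exact ⟨[], by simp, fun e => by simp [hu, hG.src_ne_sink e], by simp, by simp, by simp⟩
  obtain ⟨e₀, hsrc, hs, hns⟩ := exists_isStart hG hu
  set d : ℕ → E ⊕ E := fun k => (G.rot ^ k) (inl e₀) with hd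
  have hd0 : d 0 = inl e₀ := by simp [hd]
  have hdS : ∀ k, d (k + 1) = G.rot (d k) := fun k => by
    simp only [hd, pow_succ', Equiv.Perm.mul_apply]
  have hdv : ∀ k, G.vert (d k) = u := by
    intro k
    induction k with
    | zero => rw [hd0]; exact hsrc
    | succ k ih => rw [hdS, vert_rot, ih]
  have hex : ∃ k, d (k + 1) = inl e₀ ∨ (d (k + 1)).isRight := by
    refine ⟨orderOf G.rot - 1, Or.inl ?_⟩
    rw [hd]
    simp only
    rw [Nat.sub_add_cancel (orderOf_pos G.rot), pow_orderOf_eq_one, Equiv.Perm.one_apply]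
  obtain ⟨hr, hmin⟩ := And.intro (Nat.find_spec hex) (fun k => @Nat.find_min _ _ hex k)
  set r := Nat.find hex
  have hleft : ∀ k ≤ r, ∃ e, d k = inl e := by
    intro k hk
    rcases k with _ | k
    · exact ⟨e₀, hd0⟩
    · have := hmin k hk
      rcases h : d (k + 1) with e | e
      · exact ⟨e, rfl⟩
      · simp [h] at this
  set w : ℕ → E := fun k => (d k).elim id id with hw
  have hdw : ∀ k ≤ r, d k = inl (w k) := by
    intro k hk
    obtain ⟨e, he⟩ := hleft k hk
    simp [hw, he]
  have hadd : ∀ i k, d (i + k) = (G.rot ^ i) (d k) := fun i k => by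
    simp only [hd, pow_add, Equiv.Perm.mul_apply]
  have hinj : ∀ i j, i < j → j ≤ r → w i ≠ w j := by
    intro i j hij hj h
    obtain ⟨k, rfl⟩ := Nat.exists_eq_add_of_lt hij
    refine hmin k (by omega) (Or.inl ((G.rot ^ i).injective ?_))
    rw [← hadd, ← add_assoc, hdw _ hj, ← h, ← hdw _ (by omega)]
  refine ⟨(List.range (r + 1)).map w, ?_, ?_, ?_, ?_, ?_⟩
  · refine List.Nodup.map_on (fun i hi j hj h => ?_) List.nodup_range
    rw [List.mem_range] at hi hj
    by_contra hne
    rcases Nat.lt_or_gt_of_ne hne with h' | h'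
    · exact hinj i j h' (by omega) h
    · exact hinj j i h' (by omega) h.symm
  · intro e
    constructor
    · intro he
      obtain ⟨k, hk, rfl⟩ := List.mem_map.1 he
      rw [List.mem_range] at hk
      rw [← hdv k, hdw k (by omega), vert_inl]
    · intro he
      have h1 : ∃ k, d k = inl e := by
        have : G.rot.SameCycle (inl e₀) (inl e) := (G.rot_sameCycle _ _).2 (hsrc.trans he.symm)
        exact this.exists_nat_pow_eq
      obtain ⟨hk, hkmin⟩ := And.intro (Nat.find_spec h1) (fun j => @Nat.find_min _ _ h1 j)
      set k := Nat.find h1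
      have hkr : k ≤ r := by
        by_contra hlt
        -- Past `r` the rotation returns to `e₀` no later than to any outgoing dart: the only corner
        -- out of the incoming darts leads to `e₀`. Dropping this full turn contradicts the
        -- minimality of `k`.
        have h2 : ∃ i, i < k ∧ d (i + 1) = inl e₀ := by
          rcases hr with hr | hr
          · exact ⟨r, by omega, hr⟩
          · by_contra! h3
            have h4 : ∀ i, r + 1 + i ≤ k → (d (r + 1 + i)).isRight := by
              intro i
              induction i with
              | zero => exact fun _ => hr
              | succ i ih =>
                intro hi
                obtain ⟨x, hx⟩ := Sum.isRight_iff.1 (ih (by omega))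
                rcases hy : d (r + 1 + (i + 1)) with y | y
                · have h5 : G.rot (inr x) = inl y := by
                    rw [← hx, ← hy, ← hdS]
                    rfl
                  have hxu : G.tgt x = u := by rw [← hdv (r + 1 + i), hx, vert_inr]
                  have hus : u ≠ s := fun h => hG.tgt_ne_source x (hxu.trans h)
                  obtain ⟨x', hx'⟩ := hns hus
                  have h6 := vert_rot (G := G) (inr x')
                  rw [hx', vert_inl, vert_inr, hsrc] at h6
                  have h7 := in_out_unique hG h5 hx' (hxu.trans h6)
                  rw [h7, hx'] at h5
                  refine absurd ?_ (h3 (r + 1 + i) (by omega))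
                  rw [h5]
                  exact hy
                · simp
            have := h4 (k - (r + 1)) (by omega)
            rw [Nat.add_sub_cancel' (by omega), hk] at this
            simp at this
        obtain ⟨i, hi, hi'⟩ := h2
        refine hkmin (k - (i + 1)) (by omega) ?_
        have h3 := hadd (k - (i + 1)) (i + 1)
        rw [Nat.sub_add_cancel (by omega), hi', hk] at h3
        exact h3.symm
      refine List.mem_map.2 ⟨k, List.mem_range.2 (by omega), ?_⟩
      simp [hw, hk]
  · rw [List.isChain_iff_getElem]
    intro i hi
    simp only [List.length_map, List.length_range] at hi
    simp only [List.getElem_map, List.getElem_range]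
    rw [← hdw _ (by omega), ← hdw _ (by omega), hdS]
  · intro h e he
    simp [List.range_succ_eq_map, hw, hd0] at he
    rw [← he]
    exact hs h
  · intro h e he
    simp [List.range_succ_eq_map, hw, hd0] at he
    rw [← he]
    exact hns h

theorem IsSuccList.next (hG : G.IsPlanarST s t) {u : V} {l : List E} (hl : G.IsSuccList s u l)
    {i : ℕ} (hi : i + 1 < l.length) : G.Next l[i] l[i + 1] := by
  refine ⟨(List.isChain_iff_getElem.1 hl.clockwise) i hi, fun h => ?_⟩
  have h1 : u = s := by
    rw [← (hl.mem_iff _).1 (List.getElem_mem hi), h, hG.first_source]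
  have h2 := hl.head_source h1 l[0] (by simp [List.head?_eq_getElem?])
  have h3 := (hl.nodup.getElem_inj_iff).1 (h2.trans h.symm)
  omega

theorem IsSuccList.getElem_of_next (hG : G.IsPlanarST s t) {u : V} {l : List E}
    (hl : G.IsSuccList s u l) {i : ℕ} (hi : i < l.length) {f : E} (h : G.Next l[i] f) :
    ∃ hi' : i + 1 < l.length, l[i + 1] = f := by
  have hf : f ∈ l := by
    rw [hl.mem_iff, ← h.src_eq, ← hl.mem_iff]
    exact List.getElem_mem hi
  obtain ⟨j, hj, hjf⟩ := List.getElem_of_mem hf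
  rcases j with _ | j
  · exfalso
    have h1 : f ∈ l.head? := by simp [List.head?_eq_getElem?, ← hjf]
    refine IsStart.not_next ?_ h
    by_cases hu : u = s
    · exact Or.inl (hl.head_source hu f h1)
    · exact Or.inr (hl.head_other hu f h1)
  · have h1 := hl.next hG hj
    rw [hjf] at h1
    have h2 := (hl.nodup.getElem_inj_iff).1 (h1.left_unique h)
    subst h2
    exact ⟨hj, hjf⟩

theorem IsSuccList.getElem_of_reflTransGen (hG : G.IsPlanarST s t) {u : V} {l : List E}
    (hl : G.IsSuccList s u l) {i : ℕ} (hi : i < l.length) {f : E}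
    (h : Relation.ReflTransGen G.Next l[i] f) : ∃ j, ∃ hj : j < l.length, i ≤ j ∧ l[j] = f := by
  induction h with
  | refl => exact ⟨i, hi, le_rfl, rfl⟩
  | tail _ h ih =>
    obtain ⟨j, hj, hij, rfl⟩ := ih
    obtain ⟨hj', h'⟩ := hl.getElem_of_next hG hj h
    exact ⟨j + 1, hj', by omega, h'⟩

/-- Every edge is reached from the start of the successor list. -/
theorem exists_isStart_reach (hG : G.IsPlanarST s t) (e : E) :
    ∃ e₀, G.IsStart e₀ ∧ Relation.ReflTransGen G.Next e₀ e := by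
  obtain ⟨l, hl⟩ := exists_isSuccList hG (G.src e)
  obtain ⟨j, hj, hje⟩ := List.getElem_of_mem ((hl.mem_iff e).2 rfl)
  have h0 : 0 < l.length := by omega
  refine ⟨l[0], ?_, ?_⟩
  · have h1 : l[0] ∈ l.head? := by simp [List.head?_eq_getElem?]
    by_cases hu : G.src e = s
    · exact Or.inl (hl.head_source hu _ h1)
    · exact Or.inr (hl.head_other hu _ h1)
  · rw [← hje]
    clear hje
    induction j with
    | zero => exact Relation.ReflTransGen.refl
    | succ j ih => exact (ih (by omega)).tail (hl.next hG hj)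

/-- In the presence of a bitonic st-ordering no forced descent precedes a forced ascent. -/
theorem IsBitonicSTOrdering.not_forced (hG : G.IsPlanarST s t) {π : V → ℕ}
    (hπ : G.IsBitonicSTOrdering s t π) {e₀ f₀ e f : E} (h₀ : G.Next e₀ f₀)
    (hdown : G.ForcedDown e₀) (hr : Relation.ReflTransGen G.Next e₀ e) (h : G.Next e f) :
    ¬ G.ForcedUp f := by
  intro hup
  have hinj : Function.Injective π := fun a b hab =>
    hπ.1.bijOn.injOn (Set.mem_univ a) (Set.mem_univ b) hab
  obtain ⟨l, hl, hb⟩ := hπ.2 (G.src e₀)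
  obtain ⟨i, hi, rfl⟩ := List.getElem_of_mem ((hl.mem_iff e₀).2 rfl)
  obtain ⟨j, hj, hij, rfl⟩ := hl.getElem_of_reflTransGen hG hi hr
  obtain ⟨hi', rfl⟩ := hl.getElem_of_next hG hi h₀
  obtain ⟨hj', rfl⟩ := hl.getElem_of_next hG hj h
  have h1 := h₀.lt_of_forcedDown hG hdown hinj hπ.1.lt
  have h2 := h.lt_of_forcedUp hG hup hinj hπ.1.lt
  obtain ⟨k, hk, hk'⟩ := hb (by
    intro h
    rw [List.map_eq_nil_iff] at h
    simp [h] at hi)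
  have h3 := hk' i (by simpa using hi')
  have h4 := hk' j (by simpa using hj')
  simp only [List.getElem_map] at h3 h4
  -- A peak after `i` contradicts the descent at `i`; a peak at or before `i` contradicts the ascent
  -- at `j ≥ i`.
  rcases Nat.lt_or_ge i k with h5 | h5
  · exact absurd (h3.1 h5) (by omega)
  · exact absurd (h4.2 (by omega)) (by simp; omega)

/-- An st-ordering that follows the added edges is bitonic. -/
theorem isBitonicSTOrdering_of_down (hG : G.IsPlanarST s t) {π : V → ℕ}
    (hπ : G.IsSTOrdering s t π) (down : E → Prop)
    (hmono : ∀ e f, G.Next e f → down e → down f)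
    (h1 : ∀ e f, G.Next e f → ¬ down e → π (G.tgt e) < π (G.tgt f))
    (h2 : ∀ e f, G.Next e f → down e → π (G.tgt f) < π (G.tgt e)) :
    G.IsBitonicSTOrdering s t π := by
  classical
  refine ⟨hπ, fun u => ?_⟩
  obtain ⟨l, hl⟩ := exists_isSuccList hG u
  refine ⟨l, hl, fun hne => ?_⟩
  have hpos : 0 < l.length := List.length_pos_of_ne_nil (by simpa using hne)
  -- The peak is the first edge marked `down`, or the last edge of the list if none is marked.
  have hex : ∃ k, k + 1 = l.length ∨ ∃ hk : k < l.length, down l[k] :=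
    ⟨l.length - 1, Or.inl (by omega)⟩
  obtain ⟨hk, hmin⟩ := And.intro (Nat.find_spec hex) (fun k => @Nat.find_min _ _ hex k)
  set k := Nat.find hex
  have hkl : k < l.length := by
    rcases hk with hk | ⟨hk, -⟩
    · omega
    · exact hk
  refine ⟨k, by simpa using hkl, fun i hi => ?_⟩
  simp only [List.length_map] at hi
  simp only [List.getElem_map]
  refine ⟨fun hik => h1 _ _ (hl.next hG hi) fun hd => hmin i hik (Or.inr ⟨by omega, hd⟩),
    fun hki => h2 _ _ (hl.next hG hi) ?_⟩
  obtain ⟨_, hd⟩ := hk.resolve_left (by omega)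
  have key : ∀ j (hj : k + j < l.length), down l[k + j] := by
    intro j
    induction j with
    | zero => exact fun _ => hd
    | succ j ih => exact fun hj => hmono _ _ (hl.next hG hj) (ih (by omega))
  obtain ⟨j, rfl⟩ := Nat.exists_eq_add_of_le hki
  exact key j (by omega)

end Bitonic

end EmbeddedDigraph

/-! ### Reasoning about programs without overflow -/

namespace RAM

/-- The value of an expression, without overflow. -/
def Expr.val (σ : State) : Expr → ℕ
  | .const k => k
  | .reg r => σ.reg r
  | .add e f => e.val σ + f.val σ
  | .sub e f => e.val σ - f.val σ
  | .load a e => σ.mem a (e.val σ)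

/-- If all registers and memory cells hold numbers at most `B`, all intermediate values of the
expression are at most `e.wt * B`. -/
def Expr.wt : Expr → ℕ
  | .const k => k
  | .reg _ => 1
  | .add e f => e.wt + f.wt
  | .sub e f => max e.wt f.wt
  | .load _ e => max 1 e.wt

/-- The value of a test, without overflow. -/
def Test.val (σ : State) : Test → Bool
  | .lt e f => decide (e.val σ < f.val σ)
  | .eq e f => decide (e.val σ = f.val σ)

def Test.wt : Test → ℕ
  | .lt e f => max e.wt f.wt
  | .eq e f => max e.wt f.wt

namespace Prog

/-- The effect of a program without loops. -/
def run : Prog → State → State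
  | skip, σ => σ
  | assign r e, σ => σ.setReg r (e.val σ)
  | store a i e, σ => σ.setMem a (i.val σ) (e.val σ)
  | seq p q, σ => q.run (p.run σ)
  | ite b p q, σ => if b.val σ = true then p.run σ else q.run σ
  | loop _ _, σ => σ

/-- The program has no loops, and only writes numbers at most `B`. -/
def Safe (B : ℕ) : Prog → State → Prop
  | skip, _ => True
  | assign _ e, σ => e.val σ ≤ B
  | store _ _ e, σ => e.val σ ≤ B
  | seq p q, σ => p.Safe B σ ∧ q.Safe B (p.run σ)
  | ite b p q, σ => if b.val σ = true then p.Safe B σ else q.Safe B σ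
  | loop _ _, _ => False

def wt : Prog → ℕ
  | skip => 0
  | assign _ e => e.wt
  | store _ i e => max i.wt e.wt
  | seq p q => max p.wt q.wt
  | ite b p q => max b.wt (max p.wt q.wt)
  | loop b p => max b.wt p.wt

/-- The worst-case number of steps of a program without loops. -/
def time : Prog → ℕ
  | skip => 1
  | assign _ e => e.cost + 1
  | store _ i e => i.cost + e.cost + 1
  | seq p q => p.time + q.time
  | ite b p q => b.cost + max p.time q.time
  | loop _ _ => 0

end Prog

/-- All registers and memory cells hold numbers at most `B`. -/
def Bounded (B : ℕ) (σ : State) : Prop := (∀ r, σ.reg r ≤ B) ∧ ∀ a i, σ.mem a i ≤ B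

@[simp]
theorem State.reg_setReg (σ : State) (r x r' : ℕ) :
    (σ.setReg r x).reg r' = if r' = r then x else σ.reg r' := by
  simp [State.setReg, Function.update_apply]

@[simp]
theorem State.mem_setReg (σ : State) (r x : ℕ) : (σ.setReg r x).mem = σ.mem := rfl

@[simp]
theorem State.reg_setMem (σ : State) (a i x : ℕ) : (σ.setMem a i x).reg = σ.reg := rfl

@[simp]
theorem State.mem_setMem (σ : State) (a i x a' : ℕ) :
    (σ.setMem a i x).mem a' = if a' = a then Function.update (σ.mem a) i x else σ.mem a' := by
  simp only [State.setMem, Function.update_apply]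

attribute [simp] Expr.val Test.val Prog.run Prog.Safe

theorem Bounded.setReg {B : ℕ} {σ : State} (h : Bounded B σ) {r x : ℕ} (hx : x ≤ B) :
    Bounded B (σ.setReg r x) := by
  refine ⟨fun r' => ?_, h.2⟩
  rw [State.reg_setReg]
  split_ifs
  exacts [hx, h.1 r']

theorem Bounded.setMem {B : ℕ} {σ : State} (h : Bounded B σ) {a i x : ℕ} (hx : x ≤ B) :
    Bounded B (σ.setMem a i x) := by
  refine ⟨h.1, fun a' i' => ?_⟩
  rw [State.mem_setMem]
  split_ifs
  · rw [Function.update_apply]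
    split_ifs
    exacts [hx, h.2 a i']
  · exact h.2 a' i'

section Exec

variable {W B : ℕ} {σ : State}

theorem Expr.val_le (hB : 1 ≤ B) (h : Bounded B σ) (e : Expr) : e.val σ ≤ e.wt * B := by
  induction e with
  | const k => exact Nat.le_mul_of_pos_right k hB
  | reg r => simpa [val, wt] using h.1 r
  | add e f he hf =>
    rw [val, wt, add_mul]
    exact add_le_add he hf
  | sub e f he hf =>
    rw [val, wt]
    exact (Nat.sub_le _ _).trans (he.trans (Nat.mul_le_mul_right B (le_max_left _ _)))
  | load a e he =>
    rw [val, wt]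
    exact (h.2 a _).trans (Nat.le_mul_of_pos_left B (by omega))

theorem Expr.eval_eq (hB : 1 ≤ B) (h : Bounded B σ) (e : Expr) (he : e.wt * B < W) :
    e.eval W σ = some (e.val σ) := by
  have hval := fun f => (Expr.val_le hB h f)
  induction e with
  | const k => exact if_pos ((hval (.const k)).trans_lt he)
  | reg r => exact if_pos ((hval (.reg r)).trans_lt he)
  | add e f he' hf' =>
    have h1 : e.wt * B < W := lt_of_le_of_lt (Nat.mul_le_mul_right B (by simp [wt])) he
    have h2 : f.wt * B < W := lt_of_le_of_lt (Nat.mul_le_mul_right B (by simp [wt])) he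
    rw [eval, he' h1, hf' h2]
    exact if_pos ((hval (.add e f)).trans_lt he)
  | sub e f he' hf' =>
    have h1 : e.wt * B < W := lt_of_le_of_lt (Nat.mul_le_mul_right B (by simp [wt])) he
    have h2 : f.wt * B < W := lt_of_le_of_lt (Nat.mul_le_mul_right B (by simp [wt])) he
    rw [eval, he' h1, hf' h2]
    exact if_pos ((hval (.sub e f)).trans_lt he)
  | load a e he' =>
    have h1 : e.wt * B < W := lt_of_le_of_lt (Nat.mul_le_mul_right B (by simp [wt])) he
    rw [eval, he' h1]
    exact if_pos ((hval (.load a e)).trans_lt he)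

theorem Test.eval_eq (hB : 1 ≤ B) (h : Bounded B σ) (b : Test) (hb : b.wt * B < W) :
    b.eval W σ = some (b.val σ) := by
  rcases b with ⟨e, f⟩ | ⟨e, f⟩ <;>
  · have h1 : e.wt * B < W := lt_of_le_of_lt (Nat.mul_le_mul_right B (by simp [wt])) hb
    have h2 : f.wt * B < W := lt_of_le_of_lt (Nat.mul_le_mul_right B (by simp [wt])) hb
    rw [eval, e.eval_eq hB h h1, f.eval_eq hB h h2]
    rfl

/-- The single inequality `wt * B < W` covers every intermediate value, so verifying a loop body
reduces to evaluating `run` and bounding the values that are written. -/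
theorem Prog.exec_run (hB : 1 ≤ B) (h : Bounded B σ) (p : Prog) (hp : p.wt * B < W)
    (hs : p.Safe B σ) :
    Bounded B (p.run σ) ∧ ∃ T ≤ p.time, Exec W p σ (p.run σ) T := by
  induction p generalizing σ with
  | skip => exact ⟨h, 1, le_rfl, .skip σ⟩
  | assign r e => exact ⟨h.setReg hs, _, le_rfl, .assign (e.eval_eq hB h hp)⟩
  | store a i e =>
    have h1 : i.wt * B < W := lt_of_le_of_lt (Nat.mul_le_mul_right B (by simp [wt])) hp
    have h2 : e.wt * B < W := lt_of_le_of_lt (Nat.mul_le_mul_right B (by simp [wt])) hp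
    exact ⟨h.setMem hs, _, le_rfl, .store (i.eval_eq hB h h1) (e.eval_eq hB h h2)⟩
  | seq p q hp' hq' =>
    have h1 : p.wt * B < W := lt_of_le_of_lt (Nat.mul_le_mul_right B (by simp [wt])) hp
    have h2 : q.wt * B < W := lt_of_le_of_lt (Nat.mul_le_mul_right B (by simp [wt])) hp
    obtain ⟨h3, T, hT, h4⟩ := hp' h h1 hs.1
    obtain ⟨h5, U, hU, h6⟩ := hq' h3 h2 hs.2
    exact ⟨h5, _, add_le_add hT hU, h4.seq h6⟩
  | ite b p q hp' hq' =>
    have h1 : p.wt * B < W := lt_of_le_of_lt (Nat.mul_le_mul_right B (by simp [wt])) hp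
    have h2 : q.wt * B < W := lt_of_le_of_lt (Nat.mul_le_mul_right B (by simp [wt])) hp
    have h0 : b.wt * B < W := lt_of_le_of_lt (Nat.mul_le_mul_right B (by simp [wt])) hp
    have hb := b.eval_eq hB h h0
    rw [Safe] at hs
    rw [run, time]
    by_cases hc : b.val σ = true
    · rw [if_pos hc] at hs ⊢
      rw [hc] at hb
      obtain ⟨h3, T, hT, h4⟩ := hp' h h1 hs
      exact ⟨h3, _, Nat.add_le_add_left (hT.trans (le_max_left _ _)) _, .ite_true hb h4⟩
    · rw [if_neg hc] at hs ⊢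
      rw [Bool.not_eq_true] at hc
      rw [hc] at hb
      obtain ⟨h3, T, hT, h4⟩ := hq' h h2 hs
      exact ⟨h3, _, Nat.add_le_add_left (hT.trans (le_max_right _ _)) _, .ite_false hb h4⟩
  | loop b p => exact hs.elim

/-- On words holding the numbers less than `W`, the program leads from states with `P` to states
with `Q` in at most `t` steps; all cells hold numbers at most `B` before and after. -/
def Computes (W B : ℕ) (p : Prog) (P Q : State → Prop) (t : ℕ) : Prop :=
  ∀ σ, Bounded B σ → P σ → ∃ τ T, Exec W p σ τ T ∧ T ≤ t ∧ Bounded B τ ∧ Q τ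

/-- A loop whose body has no loops, with an invariant `I` and a measure `μ` that decreases in
every round. -/
theorem Computes.loop (hB : 1 ≤ B) {b : Test} {p : Prog} (hp : (Prog.loop b p).wt * B < W)
    {P Q : State → Prop} (I : State → Prop) (μ : State → ℕ) (N : ℕ)
    (hI : ∀ σ, Bounded B σ → P σ → I σ ∧ μ σ ≤ N)
    (h : ∀ σ, Bounded B σ → I σ → b.val σ = true →
      p.Safe B σ ∧ I (p.run σ) ∧ μ (p.run σ) < μ σ)
    (hQ : ∀ σ, Bounded B σ → I σ → b.val σ = false → Q σ) :
    Computes W B (.loop b p) P Q (N * (b.cost + p.time) + b.cost) := by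
  have h1 : p.wt * B < W := lt_of_le_of_lt (Nat.mul_le_mul_right B (by simp [Prog.wt])) hp
  have h0 : b.wt * B < W := lt_of_le_of_lt (Nat.mul_le_mul_right B (by simp [Prog.wt])) hp
  have key : ∀ k σ, Bounded B σ → I σ → μ σ ≤ k → ∃ τ T, Exec W (.loop b p) σ τ T ∧
      T ≤ k * (b.cost + p.time) + b.cost ∧ Bounded B τ ∧ Q τ := by
    intro k
    induction k with
    | zero =>
      intro σ hσ hi hk
      have hb := b.eval_eq hB hσ h0
      rcases hc : b.val σ with _ | _
      · rw [hc] at hb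
        exact ⟨σ, _, .loop_false hb, by simp, hσ, hQ σ hσ hi hc⟩
      · have := (h σ hσ hi hc).2.2
        omega
    | succ k ih =>
      intro σ hσ hi hk
      have hb := b.eval_eq hB hσ h0
      rcases hc : b.val σ with _ | _
      · rw [hc] at hb
        exact ⟨σ, _, .loop_false hb, by simp, hσ, hQ σ hσ hi hc⟩
      · rw [hc] at hb
        obtain ⟨hs, hi', hμ⟩ := h σ hσ hi hc
        obtain ⟨h2, T, hT, h3⟩ := p.exec_run hB hσ h1 hs
        obtain ⟨τ, U, h4, h5, h6, h7⟩ := ih _ h2 hi' (by omega)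
        refine ⟨τ, _, .loop_true hb h3 h4, ?_, h6, h7⟩
        rw [add_mul, one_mul]
        omega
  intro σ hσ hP
  obtain ⟨hi, hN⟩ := hI σ hσ hP
  exact key N σ hσ hi hN

end Exec

end RAM

/-! ### Kahn's algorithm on linked edge lists -/

namespace TopSort

/-- For every vertex, `headp` points to its last outgoing edge, and `link` points from every edge
to the previous one with the same tail. A pointer to the edge `k` is the number `k + 1`. -/
structure IsLinked (K : ℕ) (TL link headp : ℕ → ℕ) : Prop where
  head_le : ∀ v, headp v ≤ K
  head_tail : ∀ v, headp v ≠ 0 → TL (headp v - 1) = v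
  lt_head : ∀ k < K, k < headp (TL k)
  link_le : ∀ k < K, link k ≤ k
  link_tail : ∀ k < K, link k ≠ 0 → TL (link k - 1) = TL k
  lt_link : ∀ k < K, ∀ j < k, TL j = TL k → j < link k

theorem IsLinked.zero (TL link : ℕ → ℕ) : IsLinked 0 TL link fun _ => 0 := by
  constructor <;> simp

/-- Edges are inserted in increasing order, so a new edge becomes the head of its list. The bounds
from both sides say that `link` leads to the largest smaller edge with the same tail: following it
skips no edge. -/
theorem IsLinked.succ {K : ℕ} {TL link headp : ℕ → ℕ} (h : IsLinked K TL link headp) :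
    IsLinked (K + 1) TL (Function.update link K (headp (TL K)))
      (Function.update headp (TL K) (K + 1)) where
  head_le v := by
    rw [Function.update_apply]
    split_ifs
    · exact le_rfl
    · exact (h.head_le v).trans (Nat.le_succ K)
  head_tail v hv := by
    rw [Function.update_apply] at hv ⊢
    split_ifs at hv ⊢ with h1
    · exact h1.symm
    · exact h.head_tail v hv
  lt_head k hk := by
    rw [Function.update_apply]
    split_ifs with h1
    · exact hk
    · exact h.lt_head k (lt_of_le_of_ne (Nat.lt_succ_iff.1 hk) fun h2 => h1 (h2 ▸ rfl))
  link_le k hk := by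
    rw [Function.update_apply]
    split_ifs with h1
    · subst h1
      exact h.head_le _
    · exact h.link_le k (by omega)
  link_tail k hk hv := by
    rw [Function.update_apply] at hv ⊢
    split_ifs at hv ⊢ with h1
    · subst h1
      exact h.head_tail _ hv
    · exact h.link_tail k (by omega) hv
  lt_link k hk j hj hjk := by
    rw [Function.update_apply]
    split_ifs with h1
    · subst h1
      rw [← hjk]
      exact h.lt_head j hj
    · exact h.lt_link k (by omega) j hj hjk

/-- The edge `k` has been processed: its tail precedes the current vertex, the one of rank `qh`, in
the queue, or it is the current vertex and the edge does not lie ahead of the pointer `p`. -/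
def Done (TL P : ℕ → ℕ) (qh p k : ℕ) : Prop :=
  P (TL k) ≠ 0 ∧ (P (TL k) < qh ∨ P (TL k) = qh ∧ p ≤ k)

open Classical in
/-- The number of unprocessed edges with head `v`. -/
noncomputable def indeg (K : ℕ) (TL HD P : ℕ → ℕ) (qh p v : ℕ) : ℕ :=
  ((Finset.range K).filter fun k => HD k = v ∧ ¬ Done TL P qh p k).card

/-- The invariant of Kahn's algorithm. -/
structure Inv (n K : ℕ) (TL HD : ℕ → ℕ) (qh qt p : ℕ) (deg P Q : ℕ → ℕ) : Prop where
  qh_le : qh ≤ qt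
  qt_le : qt ≤ n
  queue : ∀ i < qt, Q i < n ∧ P (Q i) = i + 1
  rank : ∀ v < n, P v ≠ 0 → P v ≤ qt ∧ Q (P v - 1) = v
  deg_eq : ∀ v < n, deg v = indeg K TL HD P qh p v
  rank_iff : ∀ v < n, P v ≠ 0 ↔ deg v = 0
  lt : ∀ k < K, P (HD k) ≠ 0 → P (TL k) ≠ 0 ∧ P (TL k) < P (HD k)
  ptr : p ≠ 0 → p ≤ K ∧ 0 < qh ∧ P (TL (p - 1)) = qh

/-- The invariant of the loop that fills the queue with the vertices without incoming edges. -/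
structure InitInv (v qt : ℕ) (deg P Q : ℕ → ℕ) : Prop where
  qt_le : qt ≤ v
  queue : ∀ i < qt, Q i < v ∧ P (Q i) = i + 1
  rank : ∀ u, P u ≠ 0 → u < v ∧ P u ≤ qt ∧ Q (P u - 1) = u
  rank_iff : ∀ u < v, P u ≠ 0 ↔ deg u = 0

theorem InitInv.zero (deg Q : ℕ → ℕ) : InitInv 0 0 deg (fun _ => 0) Q := by
  constructor <;> simp

theorem InitInv.skip {v qt : ℕ} {deg P Q : ℕ → ℕ} (h : InitInv v qt deg P Q) (hd : deg v ≠ 0) :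
    InitInv (v + 1) qt deg P Q where
  qt_le := h.qt_le.trans (Nat.le_succ v)
  queue i hi := ⟨(h.queue i hi).1.trans (Nat.lt_succ_self v), (h.queue i hi).2⟩
  rank u hu := ⟨(h.rank u hu).1.trans (Nat.lt_succ_self v), (h.rank u hu).2⟩
  rank_iff u hu := by
    rcases Nat.lt_succ_iff_lt_or_eq.1 hu with h1 | rfl
    · exact h.rank_iff u h1
    · exact ⟨fun h1 => absurd (h.rank u h1).1 (lt_irrefl u), fun h1 => absurd h1 hd⟩

theorem InitInv.push {v qt : ℕ} {deg P Q : ℕ → ℕ} (h : InitInv v qt deg P Q) (hd : deg v = 0) :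
    InitInv (v + 1) (qt + 1) deg (Function.update P v (qt + 1)) (Function.update Q qt v) where
  qt_le := Nat.succ_le_succ h.qt_le
  queue i hi := by
    rcases Nat.lt_succ_iff_lt_or_eq.1 hi with h1 | rfl
    · have h2 := h.queue i h1
      rw [Function.update_of_ne h1.ne, Function.update_of_ne h2.1.ne]
      exact ⟨h2.1.trans (Nat.lt_succ_self v), h2.2⟩
    · simp
  rank u hu := by
    by_cases h1 : u = v
    · subst h1
      simp
    · rw [Function.update_of_ne h1] at hu ⊢
      have h2 := h.rank u hu
      rw [Function.update_of_ne (by omega)]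
      exact ⟨by omega, by omega, h2.2.2⟩
  rank_iff u hu := by
    by_cases h1 : u = v
    · subst h1
      simp [hd]
    · rw [Function.update_of_ne h1]
      exact h.rank_iff u (by omega)

section

variable {n K : ℕ} {TL HD : ℕ → ℕ}

/-- No edge is done at `qh = 0`, since `Done` asks for a nonzero rank of at most `qh`. Ranked
vertices have no incoming edges yet, so the condition on edges into them is vacuous. -/
theorem InitInv.inv {qt : ℕ} {deg P Q : ℕ → ℕ} (h : InitInv n qt deg P Q)
    (hHD : ∀ k < K, HD k < n)
    (hdeg : ∀ v < n, deg v = ((Finset.range K).filter fun k => HD k = v).card) :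
    Inv n K TL HD 0 qt 0 deg P Q where
  qh_le := Nat.zero_le _
  qt_le := h.qt_le
  queue := h.queue
  rank v _ hv := (h.rank v hv).2
  deg_eq v hv := by
    classical
    rw [hdeg v hv, indeg]
    congr 1
    refine Finset.filter_congr fun k _ => (and_iff_left ?_).symm
    rintro ⟨h1, h2 | h2⟩
    · exact absurd h2 (Nat.not_lt_zero _)
    · exact h1 h2.1
  rank_iff := h.rank_iff
  lt k hk hP := by
    exfalso
    have h1 := (h.rank_iff _ (hHD k hk)).1 hP
    rw [hdeg _ (hHD k hk), Finset.card_eq_zero] at h1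
    exact (Finset.eq_empty_iff_forall_notMem.1 h1) k (by simp [hk])
  ptr h1 := absurd rfl h1

variable {qh qt p : ℕ} {deg P Q link headp : ℕ → ℕ}

theorem Inv.rank_inj (h : Inv n K TL HD qh qt p deg P Q) {u v : ℕ} (hu : u < n) (hv : v < n)
    (hP : P u ≠ 0) (huv : P u = P v) : u = v := by
  rw [← (h.rank u hu hP).2, huv, (h.rank v hv (huv ▸ hP)).2]

theorem indeg_congr {P' : ℕ → ℕ} {qh' p' v : ℕ}
    (h : ∀ k < K, HD k = v → (Done TL P qh p k ↔ Done TL P' qh' p' k)) :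
    indeg K TL HD P qh p v = indeg K TL HD P' qh' p' v := by
  classical
  rw [indeg, indeg]
  congr 1
  refine Finset.filter_congr fun k hk => ?_
  by_cases h1 : HD k = v
  · rw [h k (Finset.mem_range.1 hk) h1]
  · simp [h1]

/-- The pointer `0` means that all edges leaving the vertex of rank `qh` are done. The next vertex
has rank `qh + 1`, the queue being indexed from `0`, and all its edges lie before `headp`, so none
of them counts as done. -/
theorem Inv.pop (h : Inv n K TL HD qh qt 0 deg P Q) (hL : IsLinked K TL link headp)
    (hTL : ∀ k < K, TL k < n) (hq : qh < qt) :
    Inv n K TL HD (qh + 1) qt (headp (Q qh)) deg P Q where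
  qh_le := hq
  qt_le := h.qt_le
  queue := h.queue
  rank := h.rank
  deg_eq v hv := by
    rw [h.deg_eq v hv]
    refine indeg_congr fun k hk _ => and_congr_right fun h1 => ?_
    have h2 := h.queue qh hq
    constructor
    · rintro (h3 | ⟨h3, -⟩)
      · exact Or.inl (by omega)
      · exact Or.inl (by omega)
    · rintro (h3 | ⟨h3, h4⟩)
      · rcases Nat.lt_succ_iff_lt_or_eq.1 h3 with h5 | h5
        · exact Or.inl h5
        · exact Or.inr ⟨h5, Nat.zero_le _⟩
      · have h5 := h.rank_inj (hTL k hk) h2.1 h1 (h3.trans h2.2.symm)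
        have h6 := hL.lt_head k hk
        rw [h5] at h6
        omega
  rank_iff := h.rank_iff
  lt := h.lt
  ptr hp := ⟨hL.head_le _, Nat.succ_pos _, by
    rw [hL.head_tail _ hp, (h.queue qh hq).2]⟩

/-- No edge leaving the current vertex lies strictly between the target of the link and `p - 1`, so
one move of the pointer finishes exactly one edge. -/
theorem done_link (h : Inv n K TL HD qh qt p deg P Q) (hL : IsLinked K TL link headp)
    (hTL : ∀ k < K, TL k < n) (hp : p ≠ 0) {j : ℕ} (hj : j < K) :
    Done TL P qh (link (p - 1)) j ↔ Done TL P qh p j ∨ j = p - 1 := by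
  obtain ⟨h1, h2, h3⟩ := h.ptr hp
  have hk : p - 1 < K := by omega
  constructor
  · rintro ⟨h4, h5 | ⟨h5, h6⟩⟩
    · exact Or.inl ⟨h4, Or.inl h5⟩
    · by_cases h7 : p ≤ j
      · exact Or.inl ⟨h4, Or.inr ⟨h5, h7⟩⟩
      · refine Or.inr (le_antisymm (by omega) (not_lt.1 fun h8 => ?_))
        have h9 := h.rank_inj (hTL j hj) (hTL _ hk) h4 (h5.trans h3.symm)
        have := hL.lt_link _ hk j h8 h9
        omega
  · have h10 := hL.link_le _ hk
    rintro (⟨h4, h5 | ⟨h5, h6⟩⟩ | rfl)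
    · exact ⟨h4, Or.inl h5⟩
    · exact ⟨h4, Or.inr ⟨h5, by omega⟩⟩
    · exact ⟨by omega, Or.inr ⟨h3, h10⟩⟩

theorem not_done (h : Inv n K TL HD qh qt p deg P Q) (hp : p ≠ 0) :
    ¬ Done TL P qh p (p - 1) := by
  obtain ⟨h1, h2, h3⟩ := h.ptr hp
  rintro ⟨h4, h5 | ⟨h5, h6⟩⟩ <;> omega

theorem indeg_link (h : Inv n K TL HD qh qt p deg P Q) (hL : IsLinked K TL link headp)
    (hTL : ∀ k < K, TL k < n) (hHD : ∀ k < K, HD k < n) (hp : p ≠ 0) :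
    deg (HD (p - 1)) ≠ 0 ∧ ∀ v < n, Function.update deg (HD (p - 1)) (deg (HD (p - 1)) - 1) v =
      indeg K TL HD P qh (link (p - 1)) v := by
  classical
  have hk : p - 1 < K := by
    have := (h.ptr hp).1
    omega
  have hmem : p - 1 ∈ (Finset.range K).filter fun k => HD k = HD (p - 1) ∧ ¬ Done TL P qh p k := by
    simp [hk, not_done h hp]
  have hw := h.deg_eq _ (hHD _ hk)
  refine ⟨?_, fun v hv => ?_⟩
  · rw [hw, indeg]
    exact Finset.card_ne_zero_of_mem hmem
  · by_cases h1 : v = HD (p - 1)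
    · subst h1
      rw [Function.update_self, hw, indeg, indeg, ← Finset.card_erase_of_mem hmem]
      congr 1
      ext j
      simp only [Finset.mem_erase, Finset.mem_filter, Finset.mem_range]
      constructor
      · rintro ⟨h2, h3, h4, h5⟩
        exact ⟨h3, h4, fun h6 => ((done_link h hL hTL hp h3).1 h6).elim h5 h2⟩
      · rintro ⟨h3, h4, h5⟩
        rw [done_link h hL hTL hp h3, not_or] at h5
        exact ⟨h5.2, h3, h4, h5.1⟩
    · rw [Function.update_of_ne h1, h.deg_eq v hv]
      refine indeg_congr fun j hj hjv => ?_
      rw [done_link h hL hTL hp hj]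
      refine (or_iff_left ?_).symm
      rintro rfl
      exact h1 hjv.symm

theorem Inv.ptr_link (h : Inv n K TL HD qh qt p deg P Q) (hL : IsLinked K TL link headp)
    (hp : p ≠ 0) (hl : link (p - 1) ≠ 0) :
    link (p - 1) ≤ K ∧ 0 < qh ∧ P (TL (link (p - 1) - 1)) = qh := by
  obtain ⟨h1, h2, h3⟩ := h.ptr hp
  have hk : p - 1 < K := by omega
  refine ⟨(hL.link_le _ hk).trans hk.le, h2, ?_⟩
  rw [hL.link_tail _ hk hl, h3]

theorem Inv.relax (h : Inv n K TL HD qh qt p deg P Q) (hL : IsLinked K TL link headp)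
    (hTL : ∀ k < K, TL k < n) (hHD : ∀ k < K, HD k < n) (hp : p ≠ 0)
    (hd : deg (HD (p - 1)) - 1 ≠ 0) :
    Inv n K TL HD qh qt (link (p - 1))
      (Function.update deg (HD (p - 1)) (deg (HD (p - 1)) - 1)) P Q where
  qh_le := h.qh_le
  qt_le := h.qt_le
  queue := h.queue
  rank := h.rank
  deg_eq := (indeg_link h hL hTL hHD hp).2
  rank_iff v hv := by
    by_cases h1 : v = HD (p - 1)
    · subst h1
      rw [Function.update_self, h.rank_iff _ hv]
      omega
    · rw [Function.update_of_ne h1]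
      exact h.rank_iff v hv
  lt := h.lt
  ptr := h.ptr_link hL hp

/-- The queue lists distinct ranked vertices, and `w` is not among them. -/
theorem Inv.qt_lt (h : Inv n K TL HD qh qt p deg P Q) {w : ℕ} (hw : w < n) (hPw : P w = 0) :
    qt < n := by
  have h1 : ((Finset.range qt).image Q).card = qt := by
    rw [Finset.card_image_of_injOn, Finset.card_range]
    intro i hi j hj hij
    have h2 := (h.queue i (by simpa using hi)).2
    have h3 := (h.queue j (by simpa using hj)).2
    rw [hij] at h2
    omega
  have h2 : (Finset.range qt).image Q ⊂ Finset.range n := by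
    rw [Finset.ssubset_iff_of_subset]
    · refine ⟨w, by simpa using hw, fun h3 => ?_⟩
      obtain ⟨i, hi, rfl⟩ := Finset.mem_image.1 h3
      have := (h.queue i (by simpa using hi)).2
      omega
    · intro x hx
      obtain ⟨i, hi, rfl⟩ := Finset.mem_image.1 hx
      simpa using (h.queue i (by simpa using hi)).1
  have h3 := Finset.card_lt_card h2
  rwa [h1, Finset.card_range] at h3

/-- When the counter of `w` reaches `0`, all edges into `w` are done, so their tails have rank at
most `qh`, below the new rank `qt + 1` of `w`. Edges leaving `w` stay undone, as `qt + 1` exceeds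
`qh`. -/
theorem Inv.relax_push (h : Inv n K TL HD qh qt p deg P Q) (hL : IsLinked K TL link headp)
    (hTL : ∀ k < K, TL k < n) (hHD : ∀ k < K, HD k < n) (hp : p ≠ 0)
    (hd : deg (HD (p - 1)) - 1 = 0) :
    qt < n ∧ Inv n K TL HD qh (qt + 1) (link (p - 1))
      (Function.update deg (HD (p - 1)) (deg (HD (p - 1)) - 1))
      (Function.update P (HD (p - 1)) (qt + 1)) (Function.update Q qt (HD (p - 1))) := by
  have hk : p - 1 < K := by
    have := (h.ptr hp).1
    omega
  have hw := hHD _ hk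
  obtain ⟨hd0, hdeg⟩ := indeg_link h hL hTL hHD hp
  have hptr := h.ptr_link hL hp
  set w := HD (p - 1)
  have hPw : P w = 0 := by
    by_contra h1
    exact hd0 ((h.rank_iff w hw).1 h1)
  have hqt := h.qt_lt hw hPw
  have hne : ∀ {v}, P v ≠ 0 → v ≠ w := fun h1 h2 => h1 (h2 ▸ hPw)
  have hup : ∀ {v}, P v ≠ 0 → Function.update P w (qt + 1) v = P v := fun h1 =>
    Function.update_of_ne (hne h1) _ _
  refine ⟨hqt, ?_, hqt, fun i hi => ?_, fun v hv hP => ?_, fun v hv => ?_, fun v hv => ?_,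
    fun k hk' hP => ?_, fun hl => ?_⟩
  · exact h.qh_le.trans (Nat.le_succ _)
  · rcases Nat.lt_succ_iff_lt_or_eq.1 hi with h1 | rfl
    · have h2 := h.queue i h1
      rw [Function.update_of_ne h1.ne, hup (by omega)]
      exact h2
    · simp [hw]
  · by_cases h1 : v = w
    · subst h1
      simp
    · rw [Function.update_of_ne h1] at hP ⊢
      have h2 := h.rank v hv hP
      rw [Function.update_of_ne (by omega)]
      exact ⟨by omega, h2.2⟩
  · rw [hdeg v hv]
    refine indeg_congr fun j hj _ => ?_
    by_cases h1 : TL j = w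
    · simp only [Done, h1, hPw, Function.update_self]
      have := h.qh_le
      constructor
      · rintro ⟨h2, -⟩
        exact absurd rfl h2
      · rintro ⟨-, h2 | ⟨h2, -⟩⟩ <;> omega
    · simp only [Done, Function.update_of_ne h1]
  · by_cases h1 : v = w
    · subst h1
      simp [hd]
    · rw [Function.update_of_ne h1, Function.update_of_ne h1]
      exact h.rank_iff v hv
  · by_cases h1 : HD k = w
    · have h2 := hdeg w hw
      rw [Function.update_self, hd, indeg, eq_comm, Finset.card_eq_zero] at h2
      have h3 := (Finset.eq_empty_iff_forall_notMem.1 h2) k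
      simp only [Finset.mem_filter, Finset.mem_range, hk', h1, true_and, not_not] at h3
      obtain ⟨h4, h5⟩ := h3
      have := h.qh_le
      rw [h1, hup h4, Function.update_self]
      exact ⟨h4, by omega⟩
    · rw [Function.update_of_ne h1] at hP ⊢
      obtain ⟨h2, h3⟩ := h.lt k hk' hP
      rw [hup h2]
      exact ⟨h2, h3⟩
  · obtain ⟨h1, h2, h3⟩ := hptr hl
    refine ⟨h1, h2, ?_⟩
    rw [hup (by omega), h3]

theorem sum_update_pred {w : ℕ} (hw : w < n) (hd : deg w ≠ 0) :
    ∑ v ∈ Finset.range n, Function.update deg w (deg w - 1) v < ∑ v ∈ Finset.range n, deg v := by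
  refine Finset.sum_lt_sum (fun v _ => ?_) ⟨w, by simpa using hw, ?_⟩
  · rw [Function.update_apply]
    split_ifs with h
    · rw [h]
      omega
    · exact le_rfl
  · rw [Function.update_self]
    omega

theorem sum_indeg_le (hHD : ∀ k < K, HD k < n)
    (hdeg : ∀ v < n, deg v = ((Finset.range K).filter fun k => HD k = v).card) :
    ∑ v ∈ Finset.range n, deg v = K := by
  rw [Finset.sum_congr rfl fun v hv => hdeg v (by simpa using hv),
    ← Finset.card_eq_sum_card_fiberwise (fun k hk => by simpa using hHD k (by simpa using hk)),
    Finset.card_range]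

/-- When Kahn's algorithm stops and the graph is acyclic, the ranks form a topological order. -/
theorem Inv.final (h : Inv n K TL HD qh qt 0 deg P Q) (hq : qt ≤ qh) (hTL : ∀ k < K, TL k < n)
    (hac : ∀ v, ¬ Relation.TransGen (fun a b => ∃ k < K, TL k = a ∧ HD k = b) v v) :
    Set.BijOn P (Set.Iio n) (Set.Icc 1 n) ∧ ∀ k < K, HD k < n → P (TL k) < P (HD k) := by
  have hall : ∀ v < n, P v ≠ 0 := by
    by_contra! hex
    obtain ⟨v, hv, hPv⟩ := hex
    let r : Fin n → Fin n → Prop := fun a b => ∃ k < K, TL k = a ∧ HD k = b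
    obtain ⟨τ, hτ⟩ := EmbeddedDigraph.exists_rank (r := r) fun a ha =>
      hac a (Relation.TransGen.lift (fun b : Fin n => (b : ℕ)) (fun _ _ h => h) _ _ ha)
    -- A lowest unranked vertex has an unprocessed incoming edge. As the queue is exhausted, the
    -- tail of that edge is unranked too, although it is lower.
    obtain ⟨w, hw, hmin⟩ := Set.exists_min_image {w : Fin n | P w = 0} τ (Set.toFinite _)
      ⟨⟨v, hv⟩, hPv⟩
    have h1 : deg w ≠ 0 := fun h1 => ((h.rank_iff w w.2).2 h1) hw
    rw [h.deg_eq w w.2, indeg, Finset.card_ne_zero] at h1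
    obtain ⟨k, hk⟩ := h1
    simp only [Finset.mem_filter, Finset.mem_range] at hk
    obtain ⟨hkK, hkw, hkd⟩ := hk
    have h2 : P (TL k) = 0 := by
      by_contra h2
      have h3 := (h.rank _ (hTL k hkK) h2).1
      refine hkd ⟨h2, ?_⟩
      rcases lt_or_eq_of_le (h3.trans hq) with h4 | h4
      · exact Or.inl h4
      · exact Or.inr ⟨h4, Nat.zero_le _⟩
    have h3 := hmin ⟨TL k, hTL k hkK⟩ h2
    have h4 := hτ ⟨TL k, hTL k hkK⟩ w ⟨k, hkK, rfl, hkw⟩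
    omega
  have hinj : Set.InjOn P (Set.Iio n) := fun u hu v hv huv => h.rank_inj hu hv (hall u hu) huv
  have hqt : n ≤ qt := by
    have h1 : ((Finset.range n).image P).card = n := by
      rw [Finset.card_image_of_injOn, Finset.card_range]
      simpa using hinj
    have h2 : (Finset.range n).image P ⊆ Finset.Icc 1 qt := by
      intro x hx
      obtain ⟨v, hv, rfl⟩ := Finset.mem_image.1 hx
      rw [Finset.mem_range] at hv
      rw [Finset.mem_Icc]
      exact ⟨Nat.pos_of_ne_zero (hall v hv), (h.rank v hv (hall v hv)).1⟩
    have h3 := Finset.card_le_card h2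
    rw [h1, Nat.card_Icc] at h3
    omega
  refine ⟨⟨fun v hv => ?_, hinj, fun i hi => ?_⟩, fun k hk hkn => (h.lt k hk (hall _ hkn)).2⟩
  · exact ⟨Nat.pos_of_ne_zero (hall v hv), (h.rank v hv (hall v hv)).1.trans h.qt_le⟩
  · obtain ⟨h1, h2⟩ := hi
    have h3 := h.queue (i - 1) (by omega)
    exact ⟨Q (i - 1), h3.1, by rw [h3.2]; omega⟩

end

end TopSort

/-! ### The walk along the successor lists -/

namespace Walk

/-- The invariant of the loop that walks along the successor lists, where `N` relates consecutive
edges, `St` marks the first edges of the lists, `Dn` the edges followed by a forced descent and `U`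
the edges preceded by a forced ascent. The array `D` holds `1` or `2` for the visited edges
followed by an ascent or a descent. The list heads before `i` have been treated, the next edge is
`cur - 1`, the flag `fl` is `2` after a forced descent, and `rej` is set once a forced ascent
follows. -/
structure Inv (m : ℕ) (N : ℕ → ℕ → Prop) (St Dn : ℕ → ℕ) (U : ℕ → Prop) (i cur fl rej : ℕ)
    (D : ℕ → ℕ) : Prop where
  i_le : i ≤ m
  cur_le : cur ≤ m
  rej_le : rej ≤ 1
  flag : fl = 1 ∨ fl = 2 ∨ cur = 0
  unvisited : cur ≠ 0 → D (cur - 1) = 0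
  pred : cur ≠ 0 → ∀ e, N e (cur - 1) → D e ≠ 0
  flag_two : cur ≠ 0 → fl = 2 → ∃ e₀, Dn e₀ ≠ 0 ∧ Relation.ReflTransGen N e₀ (cur - 1)
  values : ∀ e, D e ≤ 2
  start : ∀ j < i, St j ≠ 0 → D j ≠ 0 ∨ cur = j + 1
  start_fresh : ∀ j, i ≤ j → St j ≠ 0 → D j = 0 ∧ cur ≠ j + 1
  closed : ∀ e f, N e f → D f ≠ 0 → D e ≠ 0
  next : ∀ e f, N e f → D e ≠ 0 →
    (D f ≠ 0 ∧ (D e = 2 → D f = 2)) ∨ (cur = f + 1 ∧ (D e = 2 → fl = 2))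
  forced : ∀ e, Dn e ≠ 0 → D e ≠ 0 → D e = 2
  descent : ∀ e, D e = 2 → ∃ e₀, Dn e₀ ≠ 0 ∧ Relation.ReflTransGen N e₀ e
  accept : rej = 0 → ∀ e f, N e f → D e = 2 → ¬ U f
  reject : rej ≠ 0 → ∃ e₀ e f, Dn e₀ ≠ 0 ∧ Relation.ReflTransGen N e₀ e ∧ N e f ∧ U f

variable {m : ℕ} {N : ℕ → ℕ → Prop} {St Dn : ℕ → ℕ} {U : ℕ → Prop} {i cur fl rej : ℕ} {D : ℕ → ℕ}

theorem Inv.zero (m : ℕ) (N : ℕ → ℕ → Prop) (St Dn : ℕ → ℕ) (U : ℕ → Prop) :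
    Inv m N St Dn U 0 0 0 0 fun _ => 0 := by
  constructor <;> simp

theorem Inv.skip (h : Inv m N St Dn U i 0 fl rej D) (hi : i < m) (hS : St i = 0) :
    Inv m N St Dn U (i + 1) 0 fl rej D :=
  { h with
    i_le := hi
    start := fun j hj hSj => by
      rcases Nat.lt_succ_iff_lt_or_eq.1 hj with h1 | rfl
      · exact h.start j h1 hSj
      · exact absurd hS hSj
    start_fresh := fun j hj => h.start_fresh j (by omega) }

theorem Inv.begin (h : Inv m N St Dn U i 0 fl rej D) (hi : i < m) (hS : St i ≠ 0)
    (hN : ∀ e, ¬ N e i) : Inv m N St Dn U (i + 1) (i + 1) 1 rej D :=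
  { h with
    i_le := hi
    cur_le := hi
    flag := Or.inl rfl
    unvisited := fun _ => (h.start_fresh i le_rfl hS).1
    pred := fun _ e he => absurd he (hN e)
    flag_two := fun _ h1 => by omega
    start := fun j hj hSj => by
      rcases Nat.lt_succ_iff_lt_or_eq.1 hj with h1 | rfl
      · rcases h.start j h1 hSj with h2 | h2
        · exact Or.inl h2
        · omega
      · exact Or.inr rfl
    start_fresh := fun j hj hSj => ⟨(h.start_fresh j (by omega) hSj).1, by omega⟩
    next := fun e f hef hD => by
      rcases h.next e f hef hD with h1 | h1
      · exact Or.inl h1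
      · omega }

/-- The three disjunctions describe all branches of the program at once: the flag is raised or kept,
the list ends or goes on, and a forced ascent after a forced descent is reported or not. -/
theorem Inv.visit (h : Inv m N St Dn U i cur fl rej D) (hc : cur ≠ 0) {fl' cur' rej' : ℕ}
    (hN : ∀ {e e' f}, N e f → N e' f → e = e') (hne : ∀ {e f}, N e f → e ≠ f)
    (hst : ∀ {e f}, N e f → St f = 0)
    (hfl : Dn (cur - 1) ≠ 0 ∧ fl' = 2 ∨ Dn (cur - 1) = 0 ∧ fl' = fl)
    (hcur : (∀ f, ¬ N (cur - 1) f) ∧ cur' = 0 ∨ N (cur - 1) (cur' - 1) ∧ cur' ≠ 0 ∧ cur' ≤ m ∧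
      ∀ f, N (cur - 1) f → f = cur' - 1)
    (hrej : (∃ f, N (cur - 1) f ∧ U f ∧ fl' = 2) ∧ rej' = 1 ∨
      (∀ f, N (cur - 1) f → fl' = 2 → ¬ U f) ∧ rej' = rej) :
    Inv m N St Dn U i cur' fl' rej' (Function.update D (cur - 1) fl') := by
  have hfl12 : fl' = 1 ∨ fl' = 2 := by
    have := h.flag
    omega
  obtain ⟨c, rfl⟩ := Nat.exists_eq_succ_of_ne_zero hc
  simp only [Nat.succ_eq_add_one, Nat.add_sub_cancel] at *
  have hDc := h.unvisited hc
  simp only [Nat.add_sub_cancel] at hDc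
  have hpred := h.pred hc
  simp only [Nat.add_sub_cancel] at hpred
  have hfl0 : fl' ≠ 0 := by omega
  have hfl2 : fl' ≤ 2 := by omega
  have hup : ∀ e, Function.update D c fl' e = if e = c then fl' else D e := fun e =>
    Function.update_apply _ _ _ _
  have hdesc : fl' = 2 → ∃ e₀, Dn e₀ ≠ 0 ∧ Relation.ReflTransGen N e₀ c := by
    intro h1
    rcases hfl with ⟨h2, -⟩ | ⟨-, h2⟩
    · exact ⟨c, h2, Relation.ReflTransGen.refl⟩
    · simpa using h.flag_two hc (h2 ▸ h1)
  -- Visited edges are closed under predecessors and `c` is unvisited.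
  have hDnext : ∀ {f}, N c f → D f = 0 := fun {f} hf => by
    by_contra h1
    exact h.closed _ _ hf h1 hDc
  refine ⟨h.i_le, ?_, ?_, ?_, ?_, ?_, ?_, ?_, ?_, ?_, ?_, ?_, ?_, ?_, ?_, ?_⟩
  · rcases hcur with h1 | h1
    · omega
    · exact h1.2.2.1
  · rcases hrej with ⟨-, h1⟩ | ⟨-, h1⟩
    · exact h1.le
    · exact h1 ▸ h.rej_le
  · exact hfl12.imp_right Or.inl
  · intro h1
    obtain ⟨h2, -, -, -⟩ := hcur.resolve_left fun h2 => h1 h2.2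
    rw [hup, if_neg fun h3 => hne h2 h3.symm]
    exact hDnext h2
  · intro h1 e he
    obtain ⟨h2, -, -, -⟩ := hcur.resolve_left fun h2 => h1 h2.2
    rw [hup, if_pos (hN he h2)]
    exact hfl0
  · intro h1 h2
    obtain ⟨h3, -, -, -⟩ := hcur.resolve_left fun h2 => h1 h2.2
    obtain ⟨e₀, h4, h5⟩ := hdesc h2
    exact ⟨e₀, h4, h5.tail h3⟩
  · intro e
    rw [hup]
    split_ifs
    · exact hfl2
    · exact h.values e
  · intro j hj hS
    refine Or.inl ?_
    rw [hup]
    split_ifs with h1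
    · exact hfl0
    · exact (h.start j hj hS).resolve_right fun h2 => h1 (by omega)
  · intro j hj hS
    have h1 := h.start_fresh j hj hS
    have h2 : j ≠ c := fun h3 => h1.2 (by omega)
    rw [hup, if_neg h2]
    refine ⟨h1.1, fun h3 => ?_⟩
    obtain ⟨h4, -, -, -⟩ := hcur.resolve_left fun h2 => by omega
    rw [h3, Nat.add_sub_cancel] at h4
    exact hS (hst h4)
  · intro e f hef hD
    rw [hup] at hD ⊢
    split_ifs with h1
    · exact hfl0
    · split_ifs at hD with h2
      · exact hpred e (h2 ▸ hef)
      · exact h.closed e f hef hD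
  · intro e f hef hD
    rw [hup e] at hD ⊢
    by_cases h1 : e = c
    · subst h1
      rw [if_pos rfl]
      right
      rcases hcur with h2 | h2
      · exact absurd hef (h2.1 f)
      · have := h2.2.2.2 f hef
        omega
    · rw [if_neg h1] at hD ⊢
      left
      rw [hup]
      rcases h.next e f hef hD with h2 | h2
      · rw [if_neg fun h3 => h2.1 (by rw [h3, hDc])]
        exact h2
      · rw [if_pos (by omega)]
        refine ⟨hfl0, fun h3 => ?_⟩
        rcases hfl with h4 | h4
        · exact h4.2
        · exact h4.2.trans (h2.2 h3)
  · intro e he hD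
    rw [hup] at hD ⊢
    split_ifs at hD ⊢ with h1
    · subst h1
      exact (hfl.resolve_right fun h1 => he h1.1).2
    · exact h.forced e he hD
  · intro e hD
    rw [hup] at hD
    split_ifs at hD with h1
    · subst h1
      exact hdesc hD
    · exact h.descent e hD
  · intro h1 e f hef hD
    obtain ⟨h2, h3⟩ := hrej.resolve_left fun h2 => by omega
    rw [hup] at hD
    split_ifs at hD with h4
    · subst h4
      exact h2 f hef hD
    · exact h.accept (h3 ▸ h1) e f hef hD
  · intro h1
    rcases hrej with ⟨⟨f, h2, h3, h4⟩, -⟩ | ⟨-, h2⟩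
    · obtain ⟨e₀, h5, h6⟩ := hdesc h4
      exact ⟨e₀, c, f, h5, h6, h2, h3⟩
    · exact h.reject (h2 ▸ h1)

/-- With no edge pending, the visited edges contain all list heads and are closed under successors.
-/
theorem Inv.final (h : Inv m N St Dn U i 0 fl rej D) (hi : m ≤ i)
    (hNm : ∀ {e f}, N e f → e < m)
    (hcov : ∀ f < m, ∃ j < m, St j ≠ 0 ∧ Relation.ReflTransGen N j f) : ∀ f < m, D f ≠ 0 := by
  intro f hf
  obtain ⟨j, hj, hS, hr⟩ := hcov f hf
  clear hcov
  induction hr with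
  | refl => exact (h.start j (by omega) hS).resolve_right (by omega)
  | tail _ hef ih =>
    rcases h.next _ _ hef (ih (hNm hef)) with h1 | h1
    · exact h1.1
    · omega

end Walk

/-! ### The loops of the program and their correctness -/

namespace BitonicST

open RAM RAM.Expr RAM.Test RAM.Prog

/-- The registers and arrays that hold the input: numbers of vertices and edges, the first edge,
the vertices and the clockwise next darts of all darts. -/
structure Holds (n m F : ℕ) (V R : ℕ → ℕ) (σ : State) : Prop where
  reg_zero : σ.reg 0 = n
  reg_one : σ.reg 1 = m
  reg_two : σ.reg 2 = F
  mem_zero : σ.mem 0 = V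
  mem_one : σ.mem 1 = R

/-- Mark in array `4` the edges followed by a forced descent, and in array `5` the edges that
follow an incoming edge. -/
def markBody : Prog :=
  seq (assign 13 (load 1 (add (reg 1) (reg 3))))
    (seq (ite (lt (reg 13) (reg 1)) (store 5 (reg 13) (const 1))
        (store 4 (sub (reg 13) (reg 1)) (const 1)))
      (assign 3 (add (reg 3) (const 1))))

def markTest : Test := lt (reg 3) (reg 1)

/-- Walk along the successor lists and compute the directions of the added edges in array `6`;
register `7` becomes `1` if a forced ascent follows a forced descent. -/
def visit : Prog :=
  seq (ite (eq (load 4 (sub (reg 5) (const 1))) (const 0)) skip (assign 6 (const 2)))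
    (seq (store 6 (sub (reg 5) (const 1)) (reg 6))
      (seq (assign 8 (load 1 (sub (reg 5) (const 1))))
        (ite (lt (reg 8) (reg 1))
          (ite (eq (reg 8) (reg 2)) (assign 5 (const 0))
            (seq (ite (eq (reg 6) (const 2))
                (ite (lt (load 1 (add (reg 1) (reg 8))) (reg 1)) skip (assign 7 (const 1))) skip)
              (assign 5 (add (reg 8) (const 1)))))
          (assign 5 (const 0)))))

/-- Register `5` holds the pending edge plus one. The value `0` means that the current list is
exhausted; then the next list head is looked for, and the flag in register `6` starts again at `1`.
-/
def walkBody : Prog :=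
  ite (eq (reg 5) (const 0))
    (seq (ite (eq (load 5 (reg 4)) (const 0)) skip
        (seq (assign 5 (add (reg 4) (const 1))) (assign 6 (const 1))))
      (assign 4 (add (reg 4) (const 1))))
    visit

/-- Positivity of the sum expresses a disjunction: an edge is pending or a possible list head is
untreated. -/
def walkTest : Test := lt (const 0) (add (reg 5) (sub (reg 1) (reg 4)))

/-- Write the tails and heads of the edges and of the added edges to arrays `7` and `8`. -/
def edgeBody : Prog :=
  seq (store 7 (reg 9) (load 0 (reg 9)))
    (seq (store 8 (reg 9) (load 0 (add (reg 1) (reg 9))))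
      (seq (store 7 (add (reg 1) (reg 9)) (load 0 (reg 9)))
        (seq (store 8 (add (reg 1) (reg 9)) (load 0 (add (reg 1) (reg 9))))
          (seq (assign 10 (load 1 (reg 9)))
            (seq (ite (lt (reg 10) (reg 1))
                (ite (eq (reg 10) (reg 2)) skip
                  (ite (eq (load 6 (reg 9)) (const 1))
                    (seq (store 7 (add (reg 1) (reg 9)) (load 0 (add (reg 1) (reg 9))))
                      (store 8 (add (reg 1) (reg 9)) (load 0 (add (reg 1) (reg 10)))))
                    (seq (store 7 (add (reg 1) (reg 9)) (load 0 (add (reg 1) (reg 10))))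
                      (store 8 (add (reg 1) (reg 9)) (load 0 (add (reg 1) (reg 9)))))))
                skip)
              (assign 9 (add (reg 9) (const 1))))))))

def edgeTest : Test := lt (reg 9) (reg 1)

/-- Link the edges with the same tail and count the edges with the same head. -/
def linkBody : Prog :=
  seq (store 9 (reg 11) (load 10 (load 7 (reg 11))))
    (seq (store 10 (load 7 (reg 11)) (add (reg 11) (const 1)))
      (seq (store 11 (load 8 (reg 11)) (add (load 11 (load 8 (reg 11))) (const 1)))
        (assign 11 (add (reg 11) (const 1)))))

def linkTest : Test := lt (reg 11) (add (reg 1) (reg 1))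

/-- Fill the queue in array `12` with the vertices without incoming edges. -/
def queueBody : Prog :=
  seq (ite (eq (load 11 (reg 12)) (const 0))
      (seq (store 12 (reg 14) (reg 12))
        (seq (assign 14 (add (reg 14) (const 1))) (store 2 (reg 12) (reg 14))))
      skip)
    (assign 12 (add (reg 12) (const 1)))

def queueTest : Test := lt (reg 12) (reg 0)

/-- Take the next vertex from the queue, or follow the next edge leaving the current vertex. -/
def sortBody : Prog :=
  ite (eq (reg 16) (const 0))
    (seq (assign 16 (load 10 (load 12 (reg 15)))) (assign 15 (add (reg 15) (const 1))))
    (seq (assign 17 (load 8 (sub (reg 16) (const 1))))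
      (seq (store 11 (reg 17) (sub (load 11 (reg 17)) (const 1)))
        (seq (assign 16 (load 9 (sub (reg 16) (const 1))))
          (ite (eq (load 11 (reg 17)) (const 0))
            (seq (store 12 (reg 14) (reg 17))
              (seq (assign 14 (add (reg 14) (const 1))) (store 2 (reg 17) (reg 14))))
            skip))))

/-- An edge of the current vertex is left or the queue is not exhausted. -/
def sortTest : Test := lt (const 0) (add (reg 16) (sub (reg 14) (reg 15)))

/-- The invariant of the loop that fills the arrays `4` and `5`. -/
structure MarkInv (m F : ℕ) (R : ℕ → ℕ) (k : ℕ) (Dn St : ℕ → ℕ) : Prop where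
  down : ∀ i, Dn i ≠ 0 ↔ ∃ x < k, R (m + x) = m + i
  start : ∀ i, St i ≠ 0 ↔ i = F ∨ ∃ x < k, R (m + x) = i ∧ i < m

theorem MarkInv.out {m F k : ℕ} {R Dn St : ℕ → ℕ} (h : MarkInv m F R k Dn St)
    (hk : R (m + k) < m) :
    MarkInv m F R (k + 1) Dn (Function.update St (R (m + k)) 1) where
  down i := by
    rw [h.down, Nat.exists_lt_succ_right, or_iff_left]
    omega
  start i := by
    rw [Nat.exists_lt_succ_right, Function.update_apply, ← or_assoc, ← h.start]
    split_ifs with hi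
    · simp [hi, hk]
    · exact (or_iff_left fun h1 => hi h1.1.symm).symm

theorem MarkInv.into {m F k : ℕ} {R Dn St : ℕ → ℕ} (h : MarkInv m F R k Dn St)
    (hk : ¬ R (m + k) < m) :
    MarkInv m F R (k + 1) (Function.update Dn (R (m + k) - m) 1) St where
  down i := by
    rw [Nat.exists_lt_succ_right, Function.update_apply, ← h.down]
    split_ifs with hi
    · simp only [ne_eq, one_ne_zero, not_false_eq_true, true_iff]
      right
      omega
    · refine (or_iff_left ?_).symm
      omega
  start i := by
    rw [Nat.exists_lt_succ_right, ← or_assoc, ← h.start, or_iff_left]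
    omega

section

variable {W B n m F : ℕ} {V R : ℕ → ℕ}

theorem mark_computes (hB : n + 2 * m + 2 ≤ B) (hW : 2 * B < W) :
    Computes W B (loop markTest markBody)
      (fun σ => Holds n m F V R σ ∧ σ.reg 3 = 0 ∧ MarkInv m F R 0 (σ.mem 4) (σ.mem 5))
      (fun σ => MarkInv m F R m (σ.mem 4) (σ.mem 5))
      (m * (markTest.cost + markBody.time) + markTest.cost) := by
  refine Computes.loop (by omega) (by exact hW)
    (fun σ => Holds n m F V R σ ∧ σ.reg 3 ≤ m ∧
      MarkInv m F R (σ.reg 3) (σ.mem 4) (σ.mem 5)) (fun σ => m - σ.reg 3) m ?_ ?_ ?_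
  · rintro σ - ⟨h, h3, h4⟩
    exact ⟨⟨h, by omega, by rwa [h3]⟩, by omega⟩
  · rintro σ hσ ⟨⟨h0, h1, h2, hV, hR⟩, h3, h4⟩ hb
    have hlt : σ.reg 3 < m := by simpa [markTest, h1] using hb
    have hRB : R (m + σ.reg 3) ≤ B := hR ▸ hσ.2 1 _
    by_cases hc : R (m + σ.reg 3) < m
    · refine ⟨?_, ⟨⟨?_, ?_, ?_, ?_, ?_⟩, ?_, ?_⟩, ?_⟩ <;>
        simp [markBody, h0, h1, h2, hV, hR, hc]
      · omega
      · omega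
      · exact h4.out hc
      · omega
    · refine ⟨?_, ⟨⟨?_, ?_, ?_, ?_, ?_⟩, ?_, ?_⟩, ?_⟩ <;>
        simp [markBody, h0, h1, h2, hV, hR, hc]
      · omega
      · omega
      · exact h4.into hc
      · omega
  · rintro σ - ⟨⟨h0, h1, h2, hV, hR⟩, h3, h4⟩ hb
    have hge : m ≤ σ.reg 3 := by simpa [markTest, h1] using hb
    rwa [le_antisymm h3 hge] at h4

end

end BitonicST

namespace BitonicST

open RAM RAM.Expr RAM.Test RAM.Prog

/-- Consecutive edges of a successor list, in terms of the clockwise next darts `R`. -/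
def NextCode (m F : ℕ) (R : ℕ → ℕ) (e f : ℕ) : Prop := e < m ∧ f < m ∧ f ≠ F ∧ R e = f

section

variable {W B n m F : ℕ} {V R : ℕ → ℕ}

theorem card_update_lt {D : ℕ → ℕ} {c x : ℕ} (hc : c < m) (hD : D c = 0) (hx : x ≠ 0) :
    ((Finset.range m).filter fun e => Function.update D c x e = 0).card <
      ((Finset.range m).filter fun e => D e = 0).card := by
  refine Finset.card_lt_card ⟨fun e he => ?_, fun hs => ?_⟩
  · rw [Finset.mem_filter, Function.update_apply] at he
    rw [Finset.mem_filter]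
    refine ⟨he.1, ?_⟩
    by_cases h : e = c
    · rwa [h]
    · simpa [h] using he.2
  · have := hs (by simpa using ⟨hc, hD⟩ : c ∈ _)
    simp [hx] at this

/-- Each round either advances the counter of list heads or visits a fresh edge, which gives at most
`2 * m` rounds. -/
theorem walk_computes (hB : n + 2 * m + 2 ≤ B) (hW : 2 * B < W) {St Dn : ℕ → ℕ}
    (hN : ∀ {e e' f}, NextCode m F R e f → NextCode m F R e' f → e = e')
    (hne : ∀ {e f}, NextCode m F R e f → e ≠ f)
    (hst : ∀ {e f}, NextCode m F R e f → St f = 0) :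
    Computes W B (loop walkTest walkBody)
      (fun σ => Holds n m F V R σ ∧ σ.mem 4 = Dn ∧ σ.mem 5 = St ∧ σ.reg 4 = 0 ∧
        σ.reg 5 = 0 ∧ σ.reg 6 = 0 ∧ σ.reg 7 = 0 ∧ σ.mem 6 = fun _ => 0)
      (fun σ => ∃ i fl, m ≤ i ∧ Walk.Inv m (NextCode m F R) St Dn (fun f => m ≤ R (m + f)) i 0 fl
        (σ.reg 7) (σ.mem 6))
      ((2 * m) * (walkTest.cost + walkBody.time) + walkTest.cost) := by
  refine Computes.loop (by omega) (by exact hW)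
    (fun σ => Holds n m F V R σ ∧ σ.mem 4 = Dn ∧ σ.mem 5 = St ∧
      Walk.Inv m (NextCode m F R) St Dn (fun f => m ≤ R (m + f)) (σ.reg 4) (σ.reg 5) (σ.reg 6)
        (σ.reg 7) (σ.mem 6))
    (fun σ => m - σ.reg 4 + ((Finset.range m).filter fun e => σ.mem 6 e = 0).card)
    (2 * m) ?_ ?_ ?_
  · rintro σ - ⟨h, h4, h5, hr4, hr5, hr6, hr7, h6⟩
    refine ⟨⟨h, h4, h5, ?_⟩, ?_⟩
    · rw [hr4, hr5, hr6, hr7, h6]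
      exact Walk.Inv.zero _ _ _ _ _
    · have := Finset.card_filter_le (Finset.range m) fun e => σ.mem 6 e = 0
      rw [Finset.card_range] at this
      omega
  · rintro σ hσ ⟨⟨h0, h1, h2, hV, hR⟩, h4, h5, h⟩ hb
    have hlt : 0 < σ.reg 5 + (m - σ.reg 4) := by simpa [walkTest, h1] using hb
    by_cases hc : σ.reg 5 = 0
    · have hi : σ.reg 4 < m := by omega
      by_cases hS : St (σ.reg 4) = 0
      · refine ⟨?_, ⟨⟨?_, ?_, ?_, ?_, ?_⟩, ?_, ?_, ?_⟩, ?_⟩ <;>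
          simp [walkBody, h0, h1, h2, hV, hR, hc, h4, h5, hS]
        · omega
        · rw [hc] at h
          exact h.skip hi hS
        · omega
      · refine ⟨?_, ⟨⟨?_, ?_, ?_, ?_, ?_⟩, ?_, ?_, ?_⟩, ?_⟩ <;>
          simp [walkBody, h0, h1, h2, hV, hR, hc, h4, h5, hS]
        · omega
        · rw [hc] at h
          exact h.begin hi hS fun e he => hS (hst he)
        · omega
    · have hcm : σ.reg 5 - 1 < m := by
        have := h.cur_le
        omega
      -- Every branch of `visit` is reduced to its new flag, pending edge and rejection bit; the
      -- invariant and the measure are treated once for all of them.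
      have key : ∀ fl' cur' rej', fl' ≠ 0 →
          (Dn (σ.reg 5 - 1) ≠ 0 ∧ fl' = 2 ∨ Dn (σ.reg 5 - 1) = 0 ∧ fl' = σ.reg 6) →
          ((∀ f, ¬ NextCode m F R (σ.reg 5 - 1) f) ∧ cur' = 0 ∨
            NextCode m F R (σ.reg 5 - 1) (cur' - 1) ∧ cur' ≠ 0 ∧ cur' ≤ m ∧
              ∀ f, NextCode m F R (σ.reg 5 - 1) f → f = cur' - 1) →
          ((∃ f, NextCode m F R (σ.reg 5 - 1) f ∧ m ≤ R (m + f) ∧ fl' = 2) ∧ rej' = 1 ∨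
            (∀ f, NextCode m F R (σ.reg 5 - 1) f → fl' = 2 → ¬ m ≤ R (m + f)) ∧
              rej' = σ.reg 7) →
          (walkBody.Safe B σ ∧ (walkBody.run σ).reg 0 = n ∧ (walkBody.run σ).reg 1 = m ∧
            (walkBody.run σ).reg 2 = F ∧ (walkBody.run σ).mem 0 = V ∧ (walkBody.run σ).mem 1 = R ∧
            (walkBody.run σ).mem 4 = Dn ∧ (walkBody.run σ).mem 5 = St ∧
            (walkBody.run σ).reg 4 = σ.reg 4 ∧ (walkBody.run σ).reg 5 = cur' ∧
            (walkBody.run σ).reg 6 = fl' ∧ (walkBody.run σ).reg 7 = rej' ∧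
            (walkBody.run σ).mem 6 = Function.update (σ.mem 6) (σ.reg 5 - 1) fl') →
          walkBody.Safe B σ ∧ (Holds n m F V R (walkBody.run σ) ∧ (walkBody.run σ).mem 4 = Dn ∧
            (walkBody.run σ).mem 5 = St ∧ Walk.Inv m (NextCode m F R) St Dn
              (fun f => m ≤ R (m + f)) ((walkBody.run σ).reg 4) ((walkBody.run σ).reg 5)
              ((walkBody.run σ).reg 6) ((walkBody.run σ).reg 7) ((walkBody.run σ).mem 6)) ∧
            m - (walkBody.run σ).reg 4 +
              ((Finset.range m).filter fun e => (walkBody.run σ).mem 6 e = 0).card <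
            m - σ.reg 4 + ((Finset.range m).filter fun e => σ.mem 6 e = 0).card := by
        rintro fl' cur' rej' hfl0 hfl hcur hrej
          ⟨hs, e0, e1, e2, e3, e4, e5, e6, e7, e8, e9, e10, e11⟩
        refine ⟨hs, ⟨⟨e0, e1, e2, e3, e4⟩, e5, e6, ?_⟩, ?_⟩
        · rw [e7, e8, e9, e10, e11]
          exact h.visit hc hN hne hst hfl hcur hrej
        · rw [e7, e11]
          exact Nat.add_lt_add_left (card_update_lt hcm (h.unvisited hc) hfl0) _
      have hflag : σ.reg 6 ≠ 0 := by
        have := h.flag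
        omega
      have hRB : R (σ.reg 5 - 1) ≤ B := hR ▸ hσ.2 1 _
      have h6B : σ.reg 6 ≤ B := hσ.1 6
      by_cases hcN : R (σ.reg 5 - 1) < m ∧ R (σ.reg 5 - 1) ≠ F
      · have hcN' : NextCode m F R (σ.reg 5 - 1) (R (σ.reg 5 - 1)) := ⟨hcm, hcN.1, hcN.2, rfl⟩
        have hcur : NextCode m F R (σ.reg 5 - 1) (R (σ.reg 5 - 1) + 1 - 1) ∧
            R (σ.reg 5 - 1) + 1 ≠ 0 ∧ R (σ.reg 5 - 1) + 1 ≤ m ∧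
              ∀ f, NextCode m F R (σ.reg 5 - 1) f → f = R (σ.reg 5 - 1) + 1 - 1 := by
          refine ⟨by simpa using hcN', by omega, by omega, fun f hf => ?_⟩
          simpa using hf.2.2.2.symm
        obtain ⟨hcN1, hcN2⟩ := hcN
        by_cases hd : Dn (σ.reg 5 - 1) = 0
        · by_cases hf2 : σ.reg 6 = 2
          · by_cases hU : R (m + R (σ.reg 5 - 1)) < m
            · refine key (σ.reg 6) _ (σ.reg 7) hflag (Or.inr ⟨hd, rfl⟩) (Or.inr hcur)
                (Or.inr ⟨fun f hf _ => ?_, rfl⟩) ?_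
              · rw [← hf.2.2.2, not_le]
                exact hU
              · simp [walkBody, visit, h0, h1, h2, hV, hR, hc, h4, h5, hd, hcN1, hcN2, hf2, hU]
                omega
            · refine key (σ.reg 6) _ 1 hflag (Or.inr ⟨hd, rfl⟩) (Or.inr hcur)
                (Or.inl ⟨⟨_, hcN', not_lt.1 hU, hf2⟩, rfl⟩) ?_
              simp [walkBody, visit, h0, h1, h2, hV, hR, hc, h4, h5, hd, hcN1, hcN2, hf2, hU]
              omega
          · refine key (σ.reg 6) _ (σ.reg 7) hflag (Or.inr ⟨hd, rfl⟩) (Or.inr hcur)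
              (Or.inr ⟨fun f hf h' => absurd h' hf2, rfl⟩) ?_
            simp [walkBody, visit, h0, h1, h2, hV, hR, hc, h4, h5, hd, hcN1, hcN2, hf2]
            omega
        · by_cases hU : R (m + R (σ.reg 5 - 1)) < m
          · refine key 2 _ (σ.reg 7) (by omega) (Or.inl ⟨hd, rfl⟩) (Or.inr hcur)
              (Or.inr ⟨fun f hf _ => ?_, rfl⟩) ?_
            · rw [← hf.2.2.2, not_le]
              exact hU
            · simp [walkBody, visit, h0, h1, h2, hV, hR, hc, h4, h5, hd, hcN1, hcN2, hU]
              omega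
          · refine key 2 _ 1 (by omega) (Or.inl ⟨hd, rfl⟩) (Or.inr hcur)
              (Or.inl ⟨⟨_, hcN', not_lt.1 hU, rfl⟩, rfl⟩) ?_
            simp [walkBody, visit, h0, h1, h2, hV, hR, hc, h4, h5, hd, hcN1, hcN2, hU]
            omega
      · have hcur : ∀ f, ¬ NextCode m F R (σ.reg 5 - 1) f := by
          rintro f ⟨-, h6, h7, rfl⟩
          exact hcN ⟨h6, h7⟩
        have hrej : ∀ fl', ∀ f, NextCode m F R (σ.reg 5 - 1) f → fl' = 2 → ¬ m ≤ R (m + f) :=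
          fun _ f hf => absurd hf (hcur f)
        by_cases hd : Dn (σ.reg 5 - 1) = 0
        · refine key (σ.reg 6) 0 (σ.reg 7) hflag (Or.inr ⟨hd, rfl⟩) (Or.inl ⟨hcur, rfl⟩)
            (Or.inr ⟨hrej _, rfl⟩) ?_
          by_cases h8 : R (σ.reg 5 - 1) < m
          · have h9 : R (σ.reg 5 - 1) = F := by
              by_contra h9
              exact hcN ⟨h8, h9⟩
            rw [h9] at h8
            simp [walkBody, visit, h0, h1, h2, hV, hR, hc, h4, h5, hd, h8, h9]
            omega
          · simp [walkBody, visit, h0, h1, h2, hV, hR, hc, h4, h5, hd, h8]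
            omega
        · refine key 2 0 (σ.reg 7) (by omega) (Or.inl ⟨hd, rfl⟩) (Or.inl ⟨hcur, rfl⟩)
            (Or.inr ⟨hrej _, rfl⟩) ?_
          by_cases h8 : R (σ.reg 5 - 1) < m
          · have h9 : R (σ.reg 5 - 1) = F := by
              by_contra h9
              exact hcN ⟨h8, h9⟩
            rw [h9] at h8
            simp [walkBody, visit, h0, h1, h2, hV, hR, hc, h4, h5, hd, h8, h9]
            omega
          · simp [walkBody, visit, h0, h1, h2, hV, hR, hc, h4, h5, hd, h8]
            omega
  · rintro σ - ⟨⟨h0, h1, h2, hV, hR⟩, h4, h5, h⟩ hb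
    have hge : σ.reg 5 = 0 ∧ m ≤ σ.reg 4 := by simpa [walkTest, h1] using hb
    rw [hge.1] at h
    exact ⟨_, _, hge.2, h⟩

end

end BitonicST

namespace BitonicST

open RAM RAM.Expr RAM.Test RAM.Prog

/-- The tail `a` and the head `b` of the edge that is added after the edge `e`; if there is none,
they are the ends of `e`. -/
def AddedEnds (m F : ℕ) (V R D : ℕ → ℕ) (e a b : ℕ) : Prop :=
  ¬ (R e < m ∧ R e ≠ F) ∧ a = V e ∧ b = V (m + e) ∨
    (R e < m ∧ R e ≠ F) ∧ (D e = 1 ∧ a = V (m + e) ∧ b = V (m + R e) ∨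
      D e ≠ 1 ∧ a = V (m + R e) ∧ b = V (m + e))

/-- The invariant of the loop that lists the edges and the added edges. -/
def EdgeInv (m F : ℕ) (V R D : ℕ → ℕ) (i : ℕ) (TL HD : ℕ → ℕ) : Prop :=
  ∀ e < i, TL e = V e ∧ HD e = V (m + e) ∧ AddedEnds m F V R D e (TL (m + e)) (HD (m + e))

theorem EdgeInv.succ {m F i a b : ℕ} {V R D TL HD : ℕ → ℕ} (h : EdgeInv m F V R D i TL HD)
    (hi : i < m) (hab : AddedEnds m F V R D i a b) :
    EdgeInv m F V R D (i + 1) (Function.update (Function.update TL i (V i)) (m + i) a)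
      (Function.update (Function.update HD i (V (m + i))) (m + i) b) := by
  intro e he
  rcases Nat.lt_succ_iff_lt_or_eq.1 he with h1 | rfl
  · have h2 : e ≠ m + i := by omega
    have h3 : e ≠ i := by omega
    have h4 : m + e ≠ m + i := by omega
    have h5 : m + e ≠ i := by omega
    simp only [ne_eq, h2, h3, h4, h5, not_false_eq_true, Function.update_of_ne]
    exact h e h1
  · have h2 : e ≠ m + e := by omega
    simp only [ne_eq, h2, not_false_eq_true, Function.update_of_ne, Function.update_self, true_and]
    exact hab

section

variable {W B n m F : ℕ} {V R : ℕ → ℕ}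

/-- The slot `m + e` is first filled with a copy of `e`, so exactly `m + m` edges are listed; a
repeated edge imposes no new condition on the order. -/
theorem edge_computes (hB : n + 2 * m + 2 ≤ B) (hW : 2 * B < W) {D : ℕ → ℕ} :
    Computes W B (loop edgeTest edgeBody)
      (fun σ => Holds n m F V R σ ∧ σ.mem 6 = D ∧ σ.reg 9 = 0)
      (fun σ => EdgeInv m F V R D m (σ.mem 7) (σ.mem 8))
      (m * (edgeTest.cost + edgeBody.time) + edgeTest.cost) := by
  refine Computes.loop (by omega) (by exact hW)
    (fun σ => Holds n m F V R σ ∧ σ.mem 6 = D ∧ σ.reg 9 ≤ m ∧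
      EdgeInv m F V R D (σ.reg 9) (σ.mem 7) (σ.mem 8)) (fun σ => m - σ.reg 9) m ?_ ?_ ?_
  · rintro σ - ⟨h, h6, h9⟩
    refine ⟨⟨h, h6, by omega, ?_⟩, by omega⟩
    rw [h9]
    exact fun e he => absurd he (Nat.not_lt_zero e)
  · rintro σ hσ ⟨⟨h0, h1, h2, hV, hR⟩, h6, h9, h⟩ hb
    have hlt : σ.reg 9 < m := by simpa [edgeTest, h1] using hb
    have hVB : ∀ i, V i ≤ B := hV ▸ hσ.2 0
    have hRB : ∀ i, R i ≤ B := hR ▸ hσ.2 1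
    have hlt' : σ.reg 9 + 1 ≤ B := by omega
    have hadd : σ.reg 9 ≠ m + σ.reg 9 := by omega
    by_cases hc1 : R (σ.reg 9) < m
    · by_cases hc2 : R (σ.reg 9) = F
      · have hFm : F < m := hc2 ▸ hc1
        have hFB : F ≤ B := by omega
        refine ⟨?_, ⟨⟨?_, ?_, ?_, ?_, ?_⟩, ?_, ?_, ?_⟩, ?_⟩ <;>
          simp [edgeBody, h0, h1, h2, hV, hR, h6, hc2, hVB, hFm, hFB, hlt']
        · omega
        · exact h.succ hlt (Or.inl ⟨fun h' => h'.2 hc2, rfl, rfl⟩)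
        · omega
      · by_cases hc3 : D (σ.reg 9) = 1
        · refine ⟨?_, ⟨⟨?_, ?_, ?_, ?_, ?_⟩, ?_, ?_, ?_⟩, ?_⟩ <;>
            simp [edgeBody, h0, h1, h2, hV, hR, h6, hc1, hc2, hc3, hVB, hRB, hlt']
          · omega
          · exact h.succ hlt (Or.inr ⟨⟨hc1, hc2⟩, Or.inl ⟨hc3, rfl, rfl⟩⟩)
          · omega
        · refine ⟨?_, ⟨⟨?_, ?_, ?_, ?_, ?_⟩, ?_, ?_, ?_⟩, ?_⟩ <;>
            simp [edgeBody, h0, h1, h2, hV, hR, h6, hc1, hc2, hc3, hVB, hRB, hlt']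
          · omega
          · exact h.succ hlt (Or.inr ⟨⟨hc1, hc2⟩, Or.inr ⟨hc3, rfl, rfl⟩⟩)
          · omega
    · refine ⟨?_, ⟨⟨?_, ?_, ?_, ?_, ?_⟩, ?_, ?_, ?_⟩, ?_⟩ <;>
        simp [edgeBody, h0, h1, h2, hV, hR, h6, hc1, hVB, hRB, hlt']
      · omega
      · exact h.succ hlt (Or.inl ⟨fun h' => hc1 h'.1, rfl, rfl⟩)
      · omega
  · rintro σ - ⟨⟨h0, h1, h2, hV, hR⟩, h6, h9, h⟩ hb
    have hge : m ≤ σ.reg 9 := by simpa [edgeTest, h1] using hb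
    rwa [le_antisymm h9 hge] at h

/-- The number of edges with head `v` among the first `k` edges. -/
def countHeads (HD : ℕ → ℕ) (k v : ℕ) : ℕ := ((Finset.range k).filter fun j => HD j = v).card

theorem countHeads_le (HD : ℕ → ℕ) (k v : ℕ) : countHeads HD k v ≤ k :=
  (Finset.card_filter_le _ _).trans (Finset.card_range k).le

theorem countHeads_succ (HD : ℕ → ℕ) (k : ℕ) :
    countHeads HD (k + 1) =
      Function.update (countHeads HD k) (HD k) (countHeads HD k (HD k) + 1) := by
  funext v
  rw [Function.update_apply, countHeads, Finset.range_add_one, Finset.filter_insert]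
  split_ifs with h1 h2 h2
  · rw [Finset.card_insert_of_notMem (by simp), h2]
    rfl
  · exact absurd h1.symm h2
  · exact absurd h2.symm h1
  · rfl

theorem link_computes (hB : n + 2 * m + 2 ≤ B) (hW : 2 * B < W) {TL HD : ℕ → ℕ} :
    Computes W B (loop linkTest linkBody)
      (fun σ => σ.reg 1 = m ∧ σ.mem 7 = TL ∧ σ.mem 8 = HD ∧ σ.reg 11 = 0 ∧
        (σ.mem 10 = fun _ => 0) ∧ σ.mem 11 = fun _ => 0)
      (fun σ => TopSort.IsLinked (m + m) TL (σ.mem 9) (σ.mem 10) ∧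
        σ.mem 11 = countHeads HD (m + m))
      ((m + m) * (linkTest.cost + linkBody.time) + linkTest.cost) := by
  refine Computes.loop (by omega) (by exact hW)
    (fun σ => σ.reg 1 = m ∧ σ.mem 7 = TL ∧ σ.mem 8 = HD ∧ σ.reg 11 ≤ m + m ∧
      TopSort.IsLinked (σ.reg 11) TL (σ.mem 9) (σ.mem 10) ∧
      σ.mem 11 = countHeads HD (σ.reg 11)) (fun σ => m + m - σ.reg 11) (m + m) ?_ ?_ ?_
  · rintro σ - ⟨h1, h7, h8, h11, h10, hd⟩
    refine ⟨⟨h1, h7, h8, by omega, ?_, ?_⟩, by omega⟩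
    · rw [h10, h11]
      exact TopSort.IsLinked.zero _ _
    · rw [hd, h11]
      rfl
  · rintro σ hσ ⟨h1, h7, h8, h11, hL, hd⟩ hb
    have hlt : σ.reg 11 < m + m := by simpa [linkTest, h1] using hb
    have hmB : ∀ a i, σ.mem a i ≤ B := hσ.2
    have hcount := countHeads_le HD (σ.reg 11) (HD (σ.reg 11))
    refine ⟨?_, ⟨?_, ?_, ?_, ?_, ?_, ?_⟩, ?_⟩ <;> simp [linkBody, h1, h7, h8, hd, hmB]
    · omega
    · omega
    · exact hL.succ
    · exact (countHeads_succ HD _).symm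
    · omega
  · rintro σ - ⟨h1, h7, h8, h11, hL, hd⟩ hb
    have hge : m + m ≤ σ.reg 11 := by simpa [linkTest, h1] using hb
    rw [le_antisymm h11 hge] at hL hd
    exact ⟨hL, hd⟩

theorem queue_computes (hB : n + 2 * m + 2 ≤ B) (hW : 2 * B < W) {deg : ℕ → ℕ} :
    Computes W B (loop queueTest queueBody)
      (fun σ => σ.reg 0 = n ∧ σ.mem 11 = deg ∧ σ.reg 12 = 0 ∧ σ.reg 14 = 0 ∧ σ.mem 2 = fun _ => 0)
      (fun σ => TopSort.InitInv n (σ.reg 14) deg (σ.mem 2) (σ.mem 12))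
      (n * (queueTest.cost + queueBody.time) + queueTest.cost) := by
  refine Computes.loop (by omega) (by exact hW)
    (fun σ => σ.reg 0 = n ∧ σ.mem 11 = deg ∧ σ.reg 12 ≤ n ∧
      TopSort.InitInv (σ.reg 12) (σ.reg 14) deg (σ.mem 2) (σ.mem 12))
    (fun σ => n - σ.reg 12) n ?_ ?_ ?_
  · rintro σ - ⟨h0, h11, h12, h14, h2⟩
    refine ⟨⟨h0, h11, by omega, ?_⟩, by omega⟩
    rw [h2, h12, h14]
    exact TopSort.InitInv.zero _ _
  · rintro σ hσ ⟨h0, h11, h12, h⟩ hb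
    have hlt : σ.reg 12 < n := by simpa [queueTest, h0] using hb
    have hqt := h.qt_le
    have hB1 : σ.reg 12 + 1 ≤ B := by omega
    have hB2 : σ.reg 14 + 1 ≤ B := by omega
    have hB3 : σ.reg 12 ≤ B := by omega
    by_cases hc : deg (σ.reg 12) = 0
    · refine ⟨?_, ⟨?_, ?_, ?_, ?_⟩, ?_⟩ <;> simp [queueBody, h0, h11, hc, hB1, hB2, hB3]
      · omega
      · exact h.push hc
      · omega
    · refine ⟨?_, ⟨?_, ?_, ?_, ?_⟩, ?_⟩ <;> simp [queueBody, h0, h11, hc, hB1]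
      · omega
      · exact h.skip hc
      · omega
  · rintro σ - ⟨h0, h11, h12, h⟩ hb
    have hge : n ≤ σ.reg 12 := by simpa [queueTest, h0] using hb
    rwa [le_antisymm h12 hge] at h

/-- Each round either takes a vertex from the queue or lowers one of the counters, whose initial sum
is `K`. -/
theorem sort_computes (hB : n + 2 * m + 2 ≤ B) (hW : 2 * B < W) {K : ℕ}
    {TL HD link headp : ℕ → ℕ}
    (hL : TopSort.IsLinked K TL link headp) (hTL : ∀ k < K, TL k < n) (hHD : ∀ k < K, HD k < n) :
    Computes W B (loop sortTest sortBody)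
      (fun σ => σ.mem 8 = HD ∧ σ.mem 9 = link ∧ σ.mem 10 = headp ∧ σ.reg 15 = 0 ∧ σ.reg 16 = 0 ∧
        σ.mem 11 = countHeads HD K ∧ TopSort.InitInv n (σ.reg 14) (σ.mem 11) (σ.mem 2) (σ.mem 12))
      (fun σ => ∃ qh qt deg Q, qt ≤ qh ∧ TopSort.Inv n K TL HD qh qt 0 deg (σ.mem 2) Q)
      ((n + K) * (sortTest.cost + sortBody.time) + sortTest.cost) := by
  refine Computes.loop (by omega) (by exact hW)
    (fun σ => σ.mem 8 = HD ∧ σ.mem 9 = link ∧ σ.mem 10 = headp ∧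
      TopSort.Inv n K TL HD (σ.reg 15) (σ.reg 14) (σ.reg 16) (σ.mem 11) (σ.mem 2) (σ.mem 12))
    (fun σ => n - σ.reg 15 + ∑ v ∈ Finset.range n, σ.mem 11 v) (n + K) ?_ ?_ ?_
  · rintro σ - ⟨h8, h9, h10, h15, h16, h11, h⟩
    have hd : ∀ v < n, σ.mem 11 v = ((Finset.range K).filter fun k => HD k = v).card :=
        fun v _ => by
      rw [h11]
      rfl
    refine ⟨⟨h8, h9, h10, ?_⟩, ?_⟩
    · rw [h15, h16]
      exact h.inv hHD hd
    · have := TopSort.sum_indeg_le hHD hd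
      omega
  · rintro σ hσ ⟨h8, h9, h10, h⟩ hb
    have hlt : 0 < σ.reg 16 + (σ.reg 14 - σ.reg 15) := by simpa [sortTest] using hb
    have hmB : ∀ a i, σ.mem a i ≤ B := hσ.2
    have hqt := h.qt_le
    by_cases hc : σ.reg 16 = 0
    · have hq : σ.reg 15 < σ.reg 14 := by omega
      have hpB : headp (σ.mem 12 (σ.reg 15)) ≤ B := h10 ▸ hmB 10 _
      refine ⟨?_, ⟨?_, ?_, ?_, ?_⟩, ?_⟩ <;> simp [sortBody, h8, h9, h10, hc, hpB]
      · omega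
      · rw [hc] at h
        exact h.pop hL hTL hq
      · omega
    · have hp := h.ptr hc
      have hw := hHD (σ.reg 16 - 1) (by omega)
      have hd0 := (TopSort.indeg_link h hL hTL hHD hc).1
      have hsum := TopSort.sum_update_pred (deg := σ.mem 11) hw hd0
      have hdB : σ.mem 11 (HD (σ.reg 16 - 1)) - 1 ≤ B := (Nat.sub_le _ _).trans (hmB _ _)
      have hlB : link (σ.reg 16 - 1) ≤ B := h9 ▸ hmB 9 _
      have hwB : HD (σ.reg 16 - 1) ≤ B := by omega
      by_cases hd : σ.mem 11 (HD (σ.reg 16 - 1)) - 1 = 0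
      · obtain ⟨hlt', h'⟩ := h.relax_push hL hTL hHD hc hd
        have hqB : σ.reg 14 + 1 ≤ B := by omega
        rw [hd] at h' hsum
        refine ⟨?_, ⟨?_, ?_, ?_, ?_⟩, ?_⟩ <;>
          simp [sortBody, h8, h9, h10, hc, hd, hlB, hwB, hqB]
        · exact h'
        · exact hsum
      · have h' := h.relax hL hTL hHD hc hd
        refine ⟨?_, ⟨?_, ?_, ?_, ?_⟩, ?_⟩ <;>
          simp [sortBody, h8, h9, h10, hc, hd, hdB, hlB, hwB]
        · exact h'
        · exact hsum
  · rintro σ - ⟨h8, h9, h10, h⟩ hb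
    have hge : σ.reg 16 = 0 ∧ σ.reg 14 ≤ σ.reg 15 := by simpa [sortTest] using hb
    rw [hge.1] at h
    exact ⟨_, _, _, _, hge.2, h⟩

end

end BitonicST

/-! ### Frame rules for registers and arrays -/

namespace RAM

/-- The program may write to the register. -/
def Prog.writesReg : Prog → ℕ → Bool
  | skip, _ => false
  | assign r' _, r => r == r'
  | store _ _ _, _ => false
  | seq p q, r => p.writesReg r || q.writesReg r
  | ite _ p q, r => p.writesReg r || q.writesReg r
  | loop _ p, r => p.writesReg r

/-- The program may write to the array. -/
def Prog.writesMem : Prog → ℕ → Bool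
  | skip, _ => false
  | assign _ _, _ => false
  | store a' _ _, a => a == a'
  | seq p q, a => p.writesMem a || q.writesMem a
  | ite _ p q, a => p.writesMem a || q.writesMem a
  | loop _ p, a => p.writesMem a

/-- Since `writesReg` is computed from the syntax, `rfl` shows that a register survives a stage, and
each stage need only speak of the cells that it uses. -/
theorem Exec.reg_eq {W T r : ℕ} {p : Prog} {σ τ : State} (h : Exec W p σ τ T)
    (hr : p.writesReg r = false) : τ.reg r = σ.reg r := by
  induction h with
  | skip => rfl
  | assign hx =>
    rw [State.reg_setReg, if_neg]
    simpa [Prog.writesReg] using hr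
  | store hj hx => rfl
  | seq _ _ ihp ihq =>
    rw [Prog.writesReg, Bool.or_eq_false_iff] at hr
    rw [ihq hr.2, ihp hr.1]
  | ite_true _ _ ih =>
    rw [Prog.writesReg, Bool.or_eq_false_iff] at hr
    exact ih hr.1
  | ite_false _ _ ih =>
    rw [Prog.writesReg, Bool.or_eq_false_iff] at hr
    exact ih hr.2
  | loop_true _ _ _ ihp ihl => rw [ihl hr, ihp hr]
  | loop_false => rfl

theorem Exec.mem_eq {W T a : ℕ} {p : Prog} {σ τ : State} (h : Exec W p σ τ T)
    (ha : p.writesMem a = false) : τ.mem a = σ.mem a := by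
  induction h with
  | skip => rfl
  | assign hx => rfl
  | store hj hx =>
    rw [State.mem_setMem, if_neg]
    simpa [Prog.writesMem] using ha
  | seq _ _ ihp ihq =>
    rw [Prog.writesMem, Bool.or_eq_false_iff] at ha
    rw [ihq ha.2, ihp ha.1]
  | ite_true _ _ ih =>
    rw [Prog.writesMem, Bool.or_eq_false_iff] at ha
    exact ih ha.1
  | ite_false _ _ ih =>
    rw [Prog.writesMem, Bool.or_eq_false_iff] at ha
    exact ih ha.2
  | loop_true _ _ _ ihp ihl => rw [ihl ha, ihp ha]
  | loop_false => rfl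

end RAM

/-! ### From topological orders to st-orderings, and the encoding of darts -/

namespace EmbeddedDigraph

/-- The vertex of rank `1` has no incoming edge and the vertex of maximal rank no outgoing one, so
they are `s` and `t`. -/
theorem isSTOrdering_of_lt {V E : Type*} [Fintype V] [Fintype E] {G : EmbeddedDigraph V E}
    {s t : V} (hG : G.IsPlanarST s t) {π : V → ℕ}
    (hπ : Set.BijOn π Set.univ (Set.Icc 1 (Fintype.card V)))
    (hlt : ∀ e, π (G.src e) < π (G.tgt e)) : G.IsSTOrdering s t π := by
  have hcard : 1 ≤ Fintype.card V := Fintype.card_pos_iff.2 ⟨s⟩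
  refine ⟨hπ, ?_, ?_, hlt⟩
  · obtain ⟨v, -, hv⟩ := hπ.surjOn ⟨le_rfl, hcard⟩
    by_cases h : v = s
    · rw [← h, hv]
    · obtain ⟨e, rfl⟩ := hG.exists_tgt h
      have h1 := (hπ.mapsTo (Set.mem_univ (G.src e))).1
      have h2 := hlt e
      omega
  · obtain ⟨v, -, hv⟩ := hπ.surjOn ⟨hcard, le_rfl⟩
    by_cases h : v = t
    · rw [← h, hv]
    · obtain ⟨e, rfl⟩ := hG.exists_src h
      have h1 := (hπ.mapsTo (Set.mem_univ (G.tgt e))).2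
      have h2 := hlt e
      omega

section Code

variable {n m : ℕ} (G : EmbeddedDigraph (Fin n) (Fin m))

theorem dartCode_inl (e : Fin m) : dartCode (Sum.inl e : Fin m ⊕ Fin m) = e := by
  simp [dartCode]

theorem dartCode_inr (e : Fin m) : dartCode (Sum.inr e : Fin m ⊕ Fin m) = m + e := by
  simp [dartCode, add_comm]

theorem dartCode_lt (d : Fin m ⊕ Fin m) : dartCode d < m + m := (finSumFinEquiv d).2

theorem dartCode_injective : Function.Injective (dartCode (m := m)) := fun _ _ h =>
  finSumFinEquiv.injective (Fin.ext h)

theorem input_mem_zero (d : Fin m ⊕ Fin m) : G.input.mem 0 (dartCode d) = G.vert d := by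
  simp [input, dartCode]

theorem input_mem_one (d : Fin m ⊕ Fin m) : G.input.mem 1 (dartCode d) = dartCode (G.rot d) := by
  simp [input, dartCode]

theorem input_vert_inl (e : Fin m) : G.input.mem 0 e = G.src e := by
  rw [← dartCode_inl, input_mem_zero, vert_inl]

theorem input_vert_inr (e : Fin m) : G.input.mem 0 (m + e) = G.tgt e := by
  rw [← dartCode_inr, input_mem_zero, vert_inr]

theorem input_rot_inl (e : Fin m) : G.input.mem 1 e = dartCode (G.rot (Sum.inl e)) := by
  rw [← dartCode_inl, input_mem_one]

theorem input_rot_inr (e : Fin m) : G.input.mem 1 (m + e) = dartCode (G.rot (Sum.inr e)) := by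
  rw [← dartCode_inr, input_mem_one]

theorem dartCode_eq_inl {d : Fin m ⊕ Fin m} {f : Fin m} : dartCode d = f ↔ d = Sum.inl f := by
  rw [← dartCode_inl, dartCode_injective.eq_iff]

theorem dartCode_eq_inr {d : Fin m ⊕ Fin m} {f : Fin m} :
    dartCode d = m + f ↔ d = Sum.inr f := by
  rw [← dartCode_inr, dartCode_injective.eq_iff]

theorem le_dartCode {d : Fin m ⊕ Fin m} : m ≤ dartCode d ↔ ∃ f, d = Sum.inr f := by
  rcases d with e | e
  · simp [dartCode_inl]
  · simp [dartCode_inr]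

theorem input_vert_lt {i : ℕ} (hi : i < m + m) : G.input.mem 0 i < n := by
  simp [input, hi]

theorem bounded_input : RAM.Bounded (n + 2 * m + 2) G.input := by
  have hF := G.first.2
  constructor
  · intro r
    simp only [input]
    split_ifs <;> omega
  · intro a i
    simp only [input]
    split_ifs with h1 h2 h3
    · have := (G.vert (finSumFinEquiv.symm ⟨i, h1⟩)).2
      omega
    · have := dartCode_lt (G.rot (finSumFinEquiv.symm ⟨i, h1⟩))
      omega
    · omega
    · omega

end Code

end EmbeddedDigraph

/-! ### The program and its correctness -/

namespace BitonicST

open RAM RAM.Expr RAM.Test RAM.Prog EmbeddedDigraph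

/-- The program that decides whether there is a bitonic st-ordering and computes one. -/
def program : Prog :=
  seq (seq (seq (seq (seq (seq (seq (store 5 (reg 2) (const 1))
    (loop markTest markBody))
    (loop walkTest walkBody))
    (loop edgeTest edgeBody))
    (loop linkTest linkBody))
    (loop queueTest queueBody))
    (loop sortTest sortBody))
    (assign 0 (sub (const 1) (reg 7)))

theorem holds_of_exec {n m W T : ℕ} {G : EmbeddedDigraph (Fin n) (Fin m)} {p : Prog} {σ : State}
    (h : Exec W p G.input σ T) (h0 : p.writesReg 0 = false) (h1 : p.writesReg 1 = false)
    (h2 : p.writesReg 2 = false) (hV : p.writesMem 0 = false) (hR : p.writesMem 1 = false) :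
    Holds n m G.first (G.input.mem 0) (G.input.mem 1) σ where
  reg_zero := h.reg_eq h0
  reg_one := h.reg_eq h1
  reg_two := h.reg_eq h2
  mem_zero := h.mem_eq hV
  mem_one := h.mem_eq hR

section Graph

variable {n m : ℕ} {G : EmbeddedDigraph (Fin n) (Fin m)} {s t : Fin n}

theorem nextCode_iff {e f : Fin m} :
    NextCode m G.first (G.input.mem 1) e f ↔ G.Next e f := by
  rw [NextCode, Next, input_rot_inl, dartCode_eq_inl]
  simp [Fin.ext_iff, and_comm]

theorem exists_next_of_nextCode {e f : ℕ} (h : NextCode m G.first (G.input.mem 1) e f) :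
    ∃ e' f' : Fin m, e = e' ∧ f = f' ∧ G.Next e' f' :=
  ⟨⟨e, h.1⟩, ⟨f, h.2.1⟩, rfl, rfl, nextCode_iff.1 h⟩

theorem reach_of_nextCode {e f : ℕ} (he : e < m)
    (h : Relation.ReflTransGen (NextCode m G.first (G.input.mem 1)) e f) :
    ∃ hf : f < m, Relation.ReflTransGen G.Next ⟨e, he⟩ ⟨f, hf⟩ := by
  induction h with
  | refl => exact ⟨he, .refl⟩
  | tail _ h ih =>
    obtain ⟨hb, ih⟩ := ih
    exact ⟨h.2.1, ih.tail (nextCode_iff.1 h)⟩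

variable {Dn St : ℕ → ℕ}

theorem mark_down (h : MarkInv m G.first (G.input.mem 1) m Dn St) (e : Fin m) :
    Dn e ≠ 0 ↔ G.ForcedDown e := by
  rw [h.down]
  constructor
  · rintro ⟨x, hx, h1⟩
    exact ⟨⟨x, hx⟩, dartCode_eq_inr.1 (by rw [← input_rot_inr]; exact h1)⟩
  · rintro ⟨x, hx⟩
    exact ⟨x, x.2, by rw [input_rot_inr, hx, dartCode_inr]⟩

theorem mark_start (h : MarkInv m G.first (G.input.mem 1) m Dn St) (e : Fin m) :
    St e ≠ 0 ↔ G.IsStart e := by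
  rw [h.start, IsStart]
  refine or_congr Fin.ext_iff.symm ?_
  constructor
  · rintro ⟨x, hx, h1, -⟩
    exact ⟨⟨x, hx⟩, dartCode_eq_inl.1 (by rw [← input_rot_inr]; exact h1)⟩
  · rintro ⟨x, hx⟩
    exact ⟨x, x.2, by rw [input_rot_inr, hx, dartCode_inl], e.2⟩

theorem forcedUp_iff (f : Fin m) : m ≤ G.input.mem 1 (m + f) ↔ G.ForcedUp f := by
  rw [input_rot_inr, le_dartCode]
  rfl

variable {i fl rej : ℕ} {D TL HD : ℕ → ℕ}

theorem walk_reject (hG : G.IsPlanarST s t) (hM : MarkInv m G.first (G.input.mem 1) m Dn St)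
    (h : Walk.Inv m (NextCode m G.first (G.input.mem 1)) St Dn
      (fun f => m ≤ G.input.mem 1 (m + f)) i 0 fl rej D) (hrej : rej ≠ 0) :
    ¬ ∃ π : Fin n → ℕ, G.IsBitonicSTOrdering s t π := by
  rintro ⟨π, hπ⟩
  obtain ⟨e₀, e, f, h1, h2, h3, h4⟩ := h.reject hrej
  -- `ForcedDown` means a descent only if another edge of the list follows; one does, because `f`
  -- comes later.
  obtain ⟨f₀, h5⟩ : ∃ f₀, NextCode m G.first (G.input.mem 1) e₀ f₀ := by
    rcases h2.cases_head with rfl | ⟨f₀, h5, -⟩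
    exacts [⟨f, h3⟩, ⟨f₀, h5⟩]
  obtain ⟨he, h6⟩ := reach_of_nextCode h5.1 h2
  exact hπ.not_forced hG (nextCode_iff.1 h5 : G.Next ⟨e₀, h5.1⟩ ⟨f₀, h5.2.1⟩)
    ((mark_down hM ⟨e₀, h5.1⟩).1 h1) h6 (nextCode_iff.1 h3 : G.Next ⟨e, he⟩ ⟨f, h3.2.1⟩)
    ((forcedUp_iff ⟨f, h3.2.1⟩).1 h4)

theorem edge_lt (h : EdgeInv m G.first (G.input.mem 0) (G.input.mem 1) D m TL HD) :
    (∀ k < m + m, TL k < n) ∧ ∀ k < m + m, HD k < n := by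
  have key : ∀ k < m + m, TL k < n ∧ HD k < n := by
    intro k hk
    rcases Nat.lt_or_ge k m with h1 | h1
    · obtain ⟨h2, h3, -⟩ := h k h1
      rw [h2, h3]
      exact ⟨input_vert_lt G hk, input_vert_lt G (by omega)⟩
    · obtain ⟨e, rfl⟩ := Nat.exists_eq_add_of_le h1
      obtain ⟨-, -, h2⟩ := h e (by omega)
      rcases h2 with ⟨-, h3, h4⟩ | ⟨h5, ⟨-, h3, h4⟩ | ⟨-, h3, h4⟩⟩ <;> rw [h3, h4] <;>
        exact ⟨input_vert_lt G (by omega), input_vert_lt G (by omega)⟩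
  exact ⟨fun k hk => (key k hk).1, fun k hk => (key k hk).2⟩

theorem augAdj_of_edge (h : EdgeInv m G.first (G.input.mem 0) (G.input.mem 1) D m TL HD)
    (hD : ∀ e < m, D e = 1 ∨ D e = 2) {k : ℕ} (hk : k < m + m) :
    ∃ a b : Fin n, TL k = a ∧ HD k = b ∧ G.AugAdj (fun e => D e = 2) a b := by
  rcases Nat.lt_or_ge k m with h1 | h1
  · obtain ⟨h2, h3, -⟩ := h k h1
    refine ⟨G.src ⟨k, h1⟩, G.tgt ⟨k, h1⟩, ?_, ?_, Or.inl ⟨⟨k, h1⟩, rfl, rfl⟩⟩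
    · rw [h2, ← input_vert_inl]
    · rw [h3, ← input_vert_inr]
  · obtain ⟨e, rfl⟩ := Nat.exists_eq_add_of_le h1
    have he : e < m := by omega
    obtain ⟨-, -, h2⟩ := h e he
    rcases h2 with ⟨-, h3, h4⟩ | ⟨⟨h5, h5'⟩, h6⟩
    · refine ⟨G.src ⟨e, he⟩, G.tgt ⟨e, he⟩, ?_, ?_, Or.inl ⟨⟨e, he⟩, rfl, rfl⟩⟩
      · rw [h3, ← input_vert_inl]
      · rw [h4, ← input_vert_inr]
    · have hN : G.Next ⟨e, he⟩ ⟨_, h5⟩ := nextCode_iff.1 ⟨he, h5, h5', rfl⟩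
      rcases h6 with ⟨h7, h3, h4⟩ | ⟨h7, h3, h4⟩
      · refine ⟨G.tgt ⟨e, he⟩, G.tgt ⟨_, h5⟩, ?_, ?_, Or.inr ⟨_, _, hN, Or.inl ⟨?_, rfl, rfl⟩⟩⟩
        · rw [h3, ← input_vert_inr]
        · rw [h4, ← input_vert_inr]
        · simp [h7]
      · refine ⟨G.tgt ⟨_, h5⟩, G.tgt ⟨e, he⟩, ?_, ?_, Or.inr ⟨_, _, hN, Or.inr ⟨?_, rfl, rfl⟩⟩⟩
        · rw [h3, ← input_vert_inr]
        · rw [h4, ← input_vert_inr]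
        · exact (hD e he).resolve_left h7

/-- The clauses `forced` and `accept` of the walk say that no added edge goes against a forced
direction, so the augmented graph is acyclic and Kahn's ranks increase along all of its edges. -/
theorem walk_accept (hG : G.IsPlanarST s t) (hM : MarkInv m G.first (G.input.mem 1) m Dn St)
    (h : Walk.Inv m (NextCode m G.first (G.input.mem 1)) St Dn
      (fun f => m ≤ G.input.mem 1 (m + f)) i 0 fl 0 D) (hi : m ≤ i)
    (hE : EdgeInv m G.first (G.input.mem 0) (G.input.mem 1) D m TL HD) {qh qt : ℕ}
    {deg P Q : ℕ → ℕ} (hT : TopSort.Inv n (m + m) TL HD qh qt 0 deg P Q) (hq : qt ≤ qh) :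
    G.IsBitonicSTOrdering s t fun v => P v := by
  have hvis := h.final hi (fun h => h.1) fun f hf => by
    obtain ⟨e₀, h1, h2⟩ := exists_isStart_reach hG ⟨f, hf⟩
    exact ⟨e₀, e₀.2, (mark_start hM e₀).2 h1,
      Relation.ReflTransGen.lift (fun e : Fin m => (e : ℕ)) (fun _ _ h => nextCode_iff.2 h) _ _ h2⟩
  have hD : ∀ e < m, D e = 1 ∨ D e = 2 := by
    intro e he
    have h1 := hvis e he
    have h2 := h.values e
    omega
  have hac := augAdj_acyclic hG (down := fun e => D e = 2)
    (fun e f hef hd hf => hd (h.forced e ((mark_down hM e).2 hf) (hvis e e.2)))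
    (fun e f hef hd hf => h.accept rfl e f (nextCode_iff.2 hef) hd ((forcedUp_iff f).2 hf))
  have hlift : ∀ v w, Relation.TransGen (fun a b => ∃ k < m + m, TL k = a ∧ HD k = b) v w →
      ∃ v' w' : Fin n, v = v' ∧ w = w' ∧
        Relation.TransGen (G.AugAdj fun e => D e = 2) v' w' := by
    intro v w hvw
    induction hvw with
    | single h1 =>
      obtain ⟨k, hk, rfl, rfl⟩ := h1
      obtain ⟨a, b, ha, hb, hab⟩ := augAdj_of_edge hE hD hk
      exact ⟨a, b, ha, hb, .single hab⟩
    | tail _ h1 ih =>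
      obtain ⟨k, hk, h2, rfl⟩ := h1
      obtain ⟨a, b, ha, hb, hab⟩ := augAdj_of_edge hE hD hk
      obtain ⟨v', w', hv, hw, hvw⟩ := ih
      have : w' = a := Fin.ext (by rw [← hw, ← h2, ha])
      exact ⟨v', b, hv, hb, hvw.tail (this ▸ hab)⟩
  obtain ⟨hbij, hlt⟩ := hT.final hq (edge_lt hE).1 fun v hv => by
    obtain ⟨v', w', h1, h2, h3⟩ := hlift v v hv
    have : v' = w' := Fin.ext (h1.symm.trans h2)
    exact hac v' (this ▸ h3)
  have hlt' : ∀ k < m + m, P (TL k) < P (HD k) := fun k hk => hlt k hk ((edge_lt hE).2 k hk)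
  have hst : G.IsSTOrdering s t fun v => P v := by
    refine isSTOrdering_of_lt hG ⟨fun v _ => ?_, fun v _ w _ hvw => ?_, fun x hx => ?_⟩ fun e => ?_
    · rw [Fintype.card_fin]
      exact hbij.mapsTo v.2
    · exact Fin.ext (hbij.injOn v.2 w.2 hvw)
    · rw [Fintype.card_fin] at hx
      obtain ⟨v, hv, hvx⟩ := hbij.surjOn hx
      exact ⟨⟨v, hv⟩, Set.mem_univ _, hvx⟩
    · obtain ⟨h1, h2, -⟩ := hE e e.2
      have h3 := hlt' e (by omega)
      rwa [h1, h2, input_vert_inl, input_vert_inr] at h3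
  refine isBitonicSTOrdering_of_down hG hst (fun e => D e = 2) (fun e f hef hd => ?_)
    (fun e f hef hd => ?_) fun e f hef hd => ?_
  · rcases h.next e f (nextCode_iff.2 hef) (hvis e e.2) with h1 | h1
    · exact h1.2 hd
    · omega
  all_goals
    have hN := nextCode_iff.2 hef
    obtain ⟨-, -, h2⟩ := hE e e.2
    have h3 := hlt' (m + e) (by omega)
    rcases h2 with ⟨h4, -⟩ | ⟨-, ⟨h4, h5, h6⟩ | ⟨h4, h5, h6⟩⟩
    -- The slot `m + e` is not a mere copy of `e`, since `e` has a successor in its list.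
    · exact absurd ⟨hN.2.2.2 ▸ hN.2.1, hN.2.2.2 ▸ hN.2.2.1⟩ h4
  · rwa [h5, h6, hN.2.2.2, input_vert_inr, input_vert_inr] at h3
  · exact absurd ((hD e e.2).resolve_left h4) hd
  · rw [h4] at hd
    omega
  · rwa [h5, h6, hN.2.2.2, input_vert_inr, input_vert_inr] at h3

end Graph

theorem program_correct {n m : ℕ} (G : EmbeddedDigraph (Fin n) (Fin m)) {s t : Fin n}
    (hG : G.IsPlanarST s t) : ∃ (σ : State) (T : ℕ),
      Exec (2000 * (n + m)) program G.input σ T ∧ T ≤ 2000 * (n + m) ∧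
      ((∃ π : Fin n → ℕ, G.IsBitonicSTOrdering s t π) →
        σ.reg 0 = 1 ∧ G.IsBitonicSTOrdering s t (fun v => σ.mem 2 v)) ∧
      ((¬ ∃ π : Fin n → ℕ, G.IsBitonicSTOrdering s t π) → σ.reg 0 = 0) := by
  have hm : 0 < m := G.first.pos
  have hB : n + 2 * m + 2 ≤ n + 2 * m + 2 := le_rfl
  -- All cells hold at most `n + 2 * m + 2`, enough for dart numbers, edge pointers, ranks and
  -- constants. The weight of every loop is `2`, and `m` is positive because `first` exists.
  have hW : 2 * (n + 2 * m + 2) < 2000 * (n + m) := by omega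
  -- marking
  obtain ⟨b1, T1, hT1, x1⟩ := Prog.exec_run (W := 2000 * (n + m)) (by omega) G.bounded_input
    (store 5 (reg 2) (const 1)) (lt_of_le_of_lt (by simp [Prog.wt, Expr.wt]) hW) (by simp)
  generalize hσ1 : (store 5 (reg 2) (const 1)).run G.input = σ1 at b1 x1
  have hmem : ∀ a, 2 ≤ a → G.input.mem a = fun _ => 0 := by
    intro a ha
    funext i
    have h0 : a ≠ 0 := by omega
    have h1 : a ≠ 1 := by omega
    simp [input, h0, h1]
  have hreg : ∀ r, 3 ≤ r → G.input.reg r = 0 := by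
    intro r hr
    have h0 : r ≠ 0 := by omega
    have h1 : r ≠ 1 := by omega
    have h2 : r ≠ 2 := by omega
    simp [input, h0, h1, h2]
  -- The initial store marks the list head of the source, which follows no incoming edge.
  have hM0 : MarkInv m G.first (G.input.mem 1) 0 (σ1.mem 4) (σ1.mem 5) := by
    have h4 : σ1.mem 4 = fun _ => 0 := (x1.mem_eq rfl).trans (hmem 4 (by omega))
    have h5 : σ1.mem 5 = Function.update (fun _ => 0) (G.first : ℕ) 1 := by
      rw [← hσ1, ← hmem 5 (by omega)]
      simp [input]
    constructor
    · simp [h4]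
    · simp [h5, Function.update_apply]
  obtain ⟨σ2, T2, e2, hT2, b2, hM⟩ := mark_computes hB hW σ1 b1
    ⟨holds_of_exec x1 rfl rfl rfl rfl rfl, (x1.reg_eq rfl).trans (hreg 3 (by omega)), hM0⟩
  have x2 := x1.seq e2
  -- walking along the successor lists
  obtain ⟨σ3, T3, e3, hT3, b3, i, fl, hi, hwalk⟩ := walk_computes (St := σ2.mem 5) (Dn := σ2.mem 4)
    hB hW
    (fun h h' => by
      obtain ⟨e, f, rfl, rfl, h1⟩ := exists_next_of_nextCode h
      obtain ⟨e', f', rfl, h2, h3⟩ := exists_next_of_nextCode h'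
      rw [Fin.val_inj] at h2
      subst h2
      rw [h1.left_unique h3])
    (fun h => by
      obtain ⟨e, f, rfl, rfl, h1⟩ := exists_next_of_nextCode h
      exact fun h2 => h1.ne hG (Fin.ext h2))
    (fun h => by
      obtain ⟨e, f, rfl, rfl, h1⟩ := exists_next_of_nextCode h
      by_contra h2
      exact ((mark_start hM f).1 h2).not_next h1)
    σ2 b2 ⟨holds_of_exec x2 rfl rfl rfl rfl rfl, rfl, rfl,
      (x2.reg_eq rfl).trans (hreg 4 (by omega)), (x2.reg_eq rfl).trans (hreg 5 (by omega)),
      (x2.reg_eq rfl).trans (hreg 6 (by omega)), (x2.reg_eq rfl).trans (hreg 7 (by omega)),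
      (x2.mem_eq rfl).trans (hmem 6 (by omega))⟩
  have x3 := x2.seq e3
  -- listing the edges
  obtain ⟨σ4, T4, e4, hT4, b4, hE⟩ := edge_computes (D := σ3.mem 6) hB hW σ3 b3
    ⟨holds_of_exec x3 rfl rfl rfl rfl rfl, rfl, (x3.reg_eq rfl).trans (hreg 9 (by omega))⟩
  have x4 := x3.seq e4
  -- linking the edges
  obtain ⟨σ5, T5, e5, hT5, b5, hL, hd⟩ := link_computes (TL := σ4.mem 7) (HD := σ4.mem 8) hB hW
    σ4 b4
    ⟨(x4.reg_eq rfl).trans (by simp [input]), rfl, rfl, (x4.reg_eq rfl).trans (hreg 11 (by omega)),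
      (x4.mem_eq rfl).trans (hmem 10 (by omega)), (x4.mem_eq rfl).trans (hmem 11 (by omega))⟩
  have x5 := x4.seq e5
  -- topological sorting
  obtain ⟨σ6, T6, e6, hT6, b6, hI⟩ := queue_computes (deg := σ5.mem 11) hB hW σ5 b5
    ⟨(x5.reg_eq rfl).trans (by simp [input]), rfl, (x5.reg_eq rfl).trans (hreg 12 (by omega)),
      (x5.reg_eq rfl).trans (hreg 14 (by omega)), (x5.mem_eq rfl).trans (hmem 2 (by omega))⟩
  have x6 := x5.seq e6
  obtain ⟨σ7, T7, e7, hT7, b7, qh, qt, deg, Q, hq, hK⟩ := sort_computes hB hW hL (edge_lt hE).1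
    (edge_lt hE).2 σ6 b6
    ⟨(e6.mem_eq rfl).trans (e5.mem_eq rfl), e6.mem_eq rfl, e6.mem_eq rfl,
      (x6.reg_eq rfl).trans (hreg 15 (by omega)), (x6.reg_eq rfl).trans (hreg 16 (by omega)),
      (e6.mem_eq rfl).trans hd, (e6.mem_eq rfl : σ6.mem 11 = σ5.mem 11) ▸ hI⟩
  have x7 := x6.seq e7
  -- the answer
  obtain ⟨-, T8, hT8, e8⟩ := Prog.exec_run (W := 2000 * (n + m)) (by omega) b7
    (assign 0 (sub (const 1) (reg 7)))
    (lt_of_le_of_lt (by simp [Prog.wt, Expr.wt]) hW) (by simp; omega)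
  have h7 : σ7.reg 7 = σ3.reg 7 :=
    (e7.reg_eq rfl).trans ((e6.reg_eq rfl).trans ((e5.reg_eq rfl).trans (e4.reg_eq rfl)))
  refine ⟨_, _, x7.seq e8, ?_, ?_, ?_⟩
  -- Only the time bounds remain. Unfolded, they are linear in `n` and `m`, and `2000` dominates the
  -- sum of the coefficients; additive constants are absorbed because `m` is positive.
  · clear x1 x2 x3 x4 x5 x6 x7 e2 e3 e4 e5 e6 e7 e8 hwalk hM hM0 hE hL hd hI hK
    simp only [markTest, markBody, walkTest, walkBody, visit, edgeTest, edgeBody, linkTest,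
      linkBody, queueTest, queueBody, sortTest, sortBody, Prog.time, Test.cost, Expr.cost] at *
    norm_num at *
    omega
  · intro hex
    have hrej : σ3.reg 7 = 0 := by
      by_contra h
      exact walk_reject hG hM hwalk h hex
    refine ⟨by simp [h7, hrej], ?_⟩
    rw [hrej] at hwalk
    exact walk_accept hG hM hwalk hi hE hK hq
  · intro hex
    have hrej : σ3.reg 7 ≠ 0 := by
      intro h
      rw [h] at hwalk
      exact hex ⟨_, walk_accept hG hM hwalk hi hE hK hq⟩
    have := hwalk.rej_le
    simp [h7]
    omega

end BitonicST

/-- A single word-RAM program, in linear time and on words of `O(log (n + m))` bits, writes `1` or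
`0` to register `0`, according to whether a bitonic st-ordering exists, and in the first case
writes such an ordering to array `2`. -/
theorem mainTheorem3 :
    ∃ (P : RAM.Prog) (c : ℕ),
      ∀ (n m : ℕ) (G : EmbeddedDigraph (Fin n) (Fin m)) (s t : Fin n), G.IsPlanarST s t →
        ∃ (σ : RAM.State) (T : ℕ),
          RAM.Exec (c * (n + m)) P G.input σ T ∧
          T ≤ c * (n + m) ∧
          ((∃ π : Fin n → ℕ, G.IsBitonicSTOrdering s t π) →
            σ.reg 0 = 1 ∧ G.IsBitonicSTOrdering s t (fun v => σ.mem 2 v)) ∧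
          ((¬ ∃ π : Fin n → ℕ, G.IsBitonicSTOrdering s t π) → σ.reg 0 = 0) :=
  ⟨BitonicST.program, 2000, fun _ _ G _ _ hG => BitonicST.program_correct G hG⟩
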